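/- Let $\mathsf{k}$ and $\mathfrak{h}$ be complex Hilbert spaces (inner products are linear in the second argument), and let $\mathcal{F}_J$ denote the symmetric Fock space over $L^2(J;\mathsf{k})$, for an interval $J\subset\mathbb{R}_+$, with $\mathcal{F}=\mathcal{F}_{\mathbb{R}_+}$; write $\varpi(f)=e^{-\|f\|^2/2}\big((n!)^{-1/2}f^{\otimes n}\big)_{n\ge 0}$ for the normalised exponential vectors and $x_{[0,t[}$ for the function equal to $x\in\mathsf{k}$ on $[0,t[$ and to $0$ elsewhere. For a Hilbert space $K$ and $e\in K$ let $E_e$ be the operator $u\mapsto u\otimes e$ and $E^e=(E_e)^*$. For a (norm closed) $C^*$-algebra $\mathsf{C}\subset B(\mathfrak{h})$, let $\mathsf{C}\otimes_{\mathrm M}B(K)$ be the space of all $T\in B(\mathfrak{h}\otimes K)$ with $E^eTE_d\in\mathsf{C}$ for all $d,e\in K$. A *quantum stochastic cocycle* on $\mathsf{C}$ is a family $(k_t)_{t\ge0}$ of completely bounded linear maps $k_t:\mathsf{C}\to\mathsf{C}\otimes_{\mathrm M}B(\mathcal{F})$ such that, under the identification $\mathcal{F}=\mathcal{F}_{[0,t[}\otimes\mathcal{F}_{[t,\infty[}$,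 $$k_t(\mathsf{C})\subset \big(\mathsf{C}\otimes_{\mathrm M}B(\mathcal{F}_{[0,t[})\big)\otimes I_{[t,\infty[},\qquad k_0(a)=a\otimes I_{\mathcal{F}},\qquad k_{r+t}=\widehat{k}_r\circ\sigma_r\circ k_t\qquad(r,t\ge0),$$ where $\sigma_r:\mathsf{C}\otimes_{\mathrm M}B(\mathcal{F})\to\mathsf{C}\otimes_{\mathrm M}B(\mathcal{F}_{[r,\infty[})$ is conjugation by the second quantisation of the right shift $L^2(\mathbb{R}_+;\mathsf{k})\to L^2([r,\infty[;\mathsf{k})$, and $\widehat{k}_r=k_r\otimes_{\mathrm M}\mathrm{id}_{B(\mathcal{F}_{[r,\infty[})}$ is determined by $E^e\,\widehat{k}_r(T)\,E_d=k_r(E^eTE_d)$ for $d,e\in\mathcal{F}_{[r,\infty[}$ (with $k_r$ regarded as a map into $\mathsf{C}\otimes_{\mathrm M}B(\mathcal{F}_{[0,r[})$). It is a *completely positive contraction cocycle* if each $k_t$ is completely positive and $\|k_t\|\le1$. Its *associated semigroups* are $$\mathcal{P}^{x,y}_t(a)=E_{\varpi(x_{[0,t[})}^{\,*}\,k_t(a)\,E_{\varpi(y_{[0,t[})}\qquad(x,y\in\mathsf{k},\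 t\ge0,\ a\in\mathsf{C}).$$ **Theorem.** Let $\mathsf{C}$ be a nonunital $C^*$-algebra acting nondegenerately on $\mathfrak{h}$, let $\mathsf{T}$ be a total subset of $\mathsf{k}$ containing $0$, and let $\mathcal{S}=\{(\mathcal{P}^{x,y}_t)_{t\ge0}:x,y\in\mathsf{T}\}$ be a family of one-parameter semigroups of linear maps on $\mathsf{C}$ ($\mathcal{P}^{x,y}_0=\mathrm{id}$, $\mathcal{P}^{x,y}_{s+t}=\mathcal{P}^{x,y}_s\circ\mathcal{P}^{x,y}_t$). Then there is a completely positive contraction quantum stochastic cocycle on $\mathsf{C}$ whose associated semigroups include $\mathcal{S}$ (that is, have $\mathcal P^{x,y}$ as their $(x,y)$ member for all $x,y\in\mathsf{T}$) if and only if $$\mathcal{P}^{\mathbf{x}}_t\big([0,I\otimes\lambda]_{M_n(\mathsf{C})}\big)\subset\big[0,\,I\otimes(\lambda\circ\varpi^{\mathbf{x}}_t)\big]_{M_n(\mathsf{C})}$$ for all $n\ge1$, $\mathbf{x}=(x^1,\dots,x^n)\in\mathsf{T}^n$, positive semidefinite $\lambda\in M_n(\mathbb{C})$ and $t\ge0$.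 Here $\mathcal{P}^{\mathbf{x}}_t([a^i_j])=[\mathcal{P}^{x^i,x^j}_t(a^i_j)]$ on $M_n(\mathsf{C})$; $\varpi^{\mathbf{x}}_t=[\langle\varpi(x^i_{[0,t[}),\varpi(x^j_{[0,t[})\rangle]=[e^{-t\chi(x^i,x^j)}]\in M_n(\mathbb{C})$ with $\chi(x,y)=\tfrac12(\|x\|^2+\|y\|^2)-\langle x,y\rangle$; $\circ$ between matrices is the entrywise (Schur) product; $I\otimes\lambda=[\lambda^i_jI_{\mathfrak{h}}]$; and $[0,R]_{M_n(\mathsf{C})}=\{A\in M_n(\mathsf{C}):0\le A\le R\}$ in $M_n(B(\mathfrak{h}))=B(\mathfrak{h}^n)$. -/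

import Mathlib

open MeasureTheory
open scoped TensorProduct NNReal ENNReal ComplexOrder

universe u v

/-! ### Unitaries from Gram matrices -/

section Gram

variable {ι K L : Type*} [NormedAddCommGroup K] [InnerProductSpace ℂ K]
  [NormedAddCommGroup L] [InnerProductSpace ℂ L]

lemma inner_linearCombination_eq {a : ι → K} {b : ι → L}
    (hab : ∀ i j, inner ℂ (a i) (a j) = inner ℂ (b i) (b j)) (x y : ι →₀ ℂ) :
    inner ℂ (Finsupp.linearCombination ℂ a x) (Finsupp.linearCombination ℂ a y) =
      inner ℂ (Finsupp.linearCombination ℂ b x) (Finsupp.linearCombination ℂ b y) := by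
  simp only [Finsupp.linearCombination_apply, Finsupp.sum, sum_inner, inner_sum,
    inner_smul_left, inner_smul_right, hab]

lemma norm_linearCombination_eq {a : ι → K} {b : ι → L}
    (hab : ∀ i j, inner ℂ (a i) (a j) = inner ℂ (b i) (b j)) (x : ι →₀ ℂ) :
    ‖Finsupp.linearCombination ℂ b x‖ = ‖Finsupp.linearCombination ℂ a x‖ := by
  rw [@norm_eq_sqrt_re_inner ℂ, @norm_eq_sqrt_re_inner ℂ, inner_linearCombination_eq hab]

lemma denseRange_linearCombination {a : ι → K}
    (ha : (Submodule.span ℂ (Set.range a)).topologicalClosure = ⊤) :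
    DenseRange (Finsupp.linearCombination ℂ a) := by
  have : Set.range (Finsupp.linearCombination ℂ a) =
      (Submodule.span ℂ (Set.range a) : Set K) := by
    rw [← Finsupp.range_linearCombination]; rfl
  rw [DenseRange, this]
  exact Submodule.dense_iff_topologicalClosure_eq_top.mpr ha

variable [CompleteSpace K] [CompleteSpace L]

/-- If two families in Hilbert spaces are both total and have the same Gram matrix, this is the
unique unitary operator carrying `a i` to `b i` for all `i`. -/
noncomputable def gramUnitary (a : ι → K) (b : ι → L)
    (hab : ∀ i j, inner ℂ (a i) (a j) = inner ℂ (b i) (b j))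
    (ha : (Submodule.span ℂ (Set.range a)).topologicalClosure = ⊤)
    (hb : (Submodule.span ℂ (Set.range b)).topologicalClosure = ⊤) : K ≃ₗᵢ[ℂ] L :=
  let U : K →L[ℂ] L :=
    (Finsupp.linearCombination ℂ b).extendOfNorm (Finsupp.linearCombination ℂ a)
  have hU : ∀ x, U (Finsupp.linearCombination ℂ a x) = Finsupp.linearCombination ℂ b x :=
    fun x => LinearMap.extendOfNorm_eq (denseRange_linearCombination ha)
      ⟨1, fun y => by rw [one_mul, norm_linearCombination_eq hab]⟩ x
  have hn : ∀ x, ‖U x‖ = ‖x‖ := fun x =>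
    (denseRange_linearCombination ha).induction_on (p := fun x => ‖U x‖ = ‖x‖) x
      (isClosed_eq (by fun_prop) (by fun_prop))
      (fun y => by rw [hU, norm_linearCombination_eq hab])
  let V : K →ₗᵢ[ℂ] L := { toLinearMap := U.toLinearMap, norm_map' := hn }
  LinearIsometryEquiv.ofSurjective V (by
    have hc : IsClosed (Set.range V) := V.isometry.isClosedEmbedding.isClosed_range
    have hd : Dense (Set.range V) := (denseRange_linearCombination hb).mono (by
      rintro _ ⟨x, rfl⟩
      exact ⟨_, hU x⟩)
    exact Set.range_eq_univ.mp (by rw [← hc.closure_eq, hd.closure_eq]))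

lemma gramUnitary_apply (a : ι → K) (b : ι → L)
    (hab : ∀ i j, inner ℂ (a i) (a j) = inner ℂ (b i) (b j))
    (ha : (Submodule.span ℂ (Set.range a)).topologicalClosure = ⊤)
    (hb : (Submodule.span ℂ (Set.range b)).topologicalClosure = ⊤) (i : ι) :
    gramUnitary a b hab ha hb (a i) = b i := by
  have := LinearMap.extendOfNorm_eq (f := Finsupp.linearCombination ℂ b)
    (denseRange_linearCombination ha)
      ⟨1, fun y => by rw [one_mul, norm_linearCombination_eq hab]⟩ (Finsupp.single i 1)
  simpa [gramUnitary] using this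

end Gram

/-! ### Hilbert space tensor products -/

/-- The Hilbert space tensor product: the completion of the algebraic tensor product for
`⟪u ⊗ x, v ⊗ y⟫ = ⟪u, v⟫ ⟪x, y⟫`. -/
def HTensor (H K : Type*) [NormedAddCommGroup H] [InnerProductSpace ℂ H]
    [NormedAddCommGroup K] [InnerProductSpace ℂ K] : Type _ :=
  UniformSpace.Completion (H ⊗[ℂ] K)

section HTensor

variable {H K L : Type*} [NormedAddCommGroup H] [InnerProductSpace ℂ H]
  [NormedAddCommGroup K] [InnerProductSpace ℂ K] [NormedAddCommGroup L] [InnerProductSpace ℂ L]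

noncomputable instance : NormedAddCommGroup (HTensor H K) :=
  inferInstanceAs (NormedAddCommGroup (UniformSpace.Completion (H ⊗[ℂ] K)))

noncomputable instance : InnerProductSpace ℂ (HTensor H K) :=
  inferInstanceAs (InnerProductSpace ℂ (UniformSpace.Completion (H ⊗[ℂ] K)))

instance : CompleteSpace (HTensor H K) :=
  inferInstanceAs (CompleteSpace (UniformSpace.Completion (H ⊗[ℂ] K)))

/-- The inclusion of the algebraic tensor product. -/
noncomputable def HTensor.incl (H K : Type*) [NormedAddCommGroup H] [InnerProductSpace ℂ H]
    [NormedAddCommGroup K] [InnerProductSpace ℂ K] : H ⊗[ℂ] K →ₗᵢ[ℂ] HTensor H K :=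
  UniformSpace.Completion.toComplₗᵢ

/-- The elementary tensor `u ⊗ x`. -/
noncomputable def htmul (u : H) (x : K) : HTensor H K := HTensor.incl H K (u ⊗ₜ[ℂ] x)

lemma HTensor.denseRange_incl : DenseRange (HTensor.incl H K) :=
  UniformSpace.Completion.denseRange_coe

@[simp] lemma inner_htmul (u v : H) (x y : K) :
    inner ℂ (htmul u x) (htmul v y) = inner ℂ u v * inner ℂ x y := by
  rw [htmul, htmul, LinearIsometry.inner_map_map, TensorProduct.inner_tmul]

@[simp] lemma norm_htmul (u : H) (x : K) : ‖htmul u x‖ = ‖u‖ * ‖x‖ := by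
  rw [htmul, LinearIsometry.norm_map, TensorProduct.norm_tmul]

/-- The operator `E_x : u ↦ u ⊗ x`. -/
noncomputable def ketR (H : Type*) {K : Type*} [NormedAddCommGroup H] [InnerProductSpace ℂ H]
    [NormedAddCommGroup K] [InnerProductSpace ℂ K] (x : K) : H →L[ℂ] HTensor H K :=
  (HTensor.incl H K).toContinuousLinearMap ∘L (TensorProduct.mkL ℂ H K).flip x

@[simp] lemma ketR_apply (x : K) (u : H) : ketR H x u = htmul u x := rfl

/-- The operator `u ⊗ ·`. -/
noncomputable def ketL (K : Type*) {H : Type*} [NormedAddCommGroup H] [InnerProductSpace ℂ H]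
    [NormedAddCommGroup K] [InnerProductSpace ℂ K] (u : H) : K →L[ℂ] HTensor H K :=
  (HTensor.incl H K).toContinuousLinearMap ∘L TensorProduct.mkL ℂ H K u

@[simp] lemma ketL_apply (u : H) (x : K) : ketL K u x = htmul u x := rfl

/-- If `s` and `s'` are total then so is `{u ⊗ x : u ∈ s, x ∈ s'}`. -/
lemma htmul_total {ι ι' : Type*} {a : ι → H} {b : ι' → K}
    (ha : (Submodule.span ℂ (Set.range a)).topologicalClosure = ⊤)
    (hb : (Submodule.span ℂ (Set.range b)).topologicalClosure = ⊤) :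
    (Submodule.span ℂ (Set.range fun p : ι × ι' => htmul (a p.1) (b p.2))).topologicalClosure
      = ⊤ := by
  set M := (Submodule.span ℂ
    (Set.range fun p : ι × ι' => htmul (a p.1) (b p.2))).topologicalClosure with hM
  have hMc : IsClosed (M : Set (HTensor H K)) := Submodule.isClosed_topologicalClosure _
  have h1 : ∀ i x, htmul (a i) x ∈ M := by
    intro i
    have : (⊤ : Submodule ℂ K) ≤ M.comap (ketL K (a i)).toLinearMap := by
      rw [← hb]
      refine Submodule.topologicalClosure_minimal _ ?_ (hMc.preimage (ketL K (a i)).continuous)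
      rw [Submodule.span_le]
      rintro _ ⟨j, rfl⟩
      exact Submodule.le_topologicalClosure _ (Submodule.subset_span ⟨(i, j), rfl⟩)
    exact fun x => this (Submodule.mem_top (x := x))
  have h2 : ∀ u x, htmul u x ∈ M := by
    intro u x
    have : (⊤ : Submodule ℂ H) ≤ M.comap (ketR H x).toLinearMap := by
      rw [← ha]
      refine Submodule.topologicalClosure_minimal _ ?_ (hMc.preimage (ketR H x).continuous)
      rw [Submodule.span_le]
      rintro _ ⟨i, rfl⟩
      exact h1 i x
    exact this (Submodule.mem_top (x := u))
  rw [eq_top_iff]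
  intro z _
  refine HTensor.denseRange_incl.induction_on (p := fun z => z ∈ M) z hMc ?_
  intro y
  induction y using TensorProduct.induction_on with
  | zero => simp
  | tmul u x => exact h2 u x
  | add y z hy hz => rw [map_add]; exact M.add_mem hy hz

lemma span_range_id_top (H : Type*) [NormedAddCommGroup H] [InnerProductSpace ℂ H] :
    (Submodule.span ℂ (Set.range (id : H → H))).topologicalClosure = ⊤ := by
  rw [Set.range_id, Submodule.span_univ]
  exact eq_top_iff.mpr (Submodule.le_topologicalClosure _)

lemma span_range_surj_top {ι : Type*} {H : Type*} [NormedAddCommGroup H] [InnerProductSpace ℂ H]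
    {a : ι → H} (ha : Function.Surjective a) :
    (Submodule.span ℂ (Set.range a)).topologicalClosure = ⊤ := by
  rw [ha.range_eq, Submodule.span_univ]
  exact eq_top_iff.mpr (Submodule.le_topologicalClosure _)

/-- The ampliation `Y ⊗ I_L` of an operator `Y`. -/
noncomputable def ampliation (L : Type*) {H : Type*} [NormedAddCommGroup H]
    [InnerProductSpace ℂ H] [NormedAddCommGroup L] [InnerProductSpace ℂ L]
    (Y : H →L[ℂ] H) : HTensor H L →L[ℂ] HTensor H L :=
  ((HTensor.incl H L).toContinuousLinearMap ∘L Y.rTensor L).toLinearMap.extendOfNorm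
    (HTensor.incl H L).toLinearMap

@[simp] lemma ampliation_htmul (Y : H →L[ℂ] H) (u : H) (x : L) :
    ampliation L Y (htmul u x) = htmul (Y u) x :=
  LinearMap.extendOfNorm_eq (HTensor.denseRange_incl (H := H) (K := L))
    ⟨‖Y.rTensor L‖, fun y => by
      simpa using (Y.rTensor L).le_opNorm y⟩ (u ⊗ₜ[ℂ] x)

/-- The unitary `I_H ⊗ U` for a unitary `U : K → L`. -/
noncomputable def htensorCongr (H : Type*) [NormedAddCommGroup H] [InnerProductSpace ℂ H]
    [CompleteSpace K] [CompleteSpace L] (U : K ≃ₗᵢ[ℂ] L) : HTensor H K ≃ₗᵢ[ℂ] HTensor H L :=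
  gramUnitary (fun p : H × K => htmul p.1 p.2) (fun p : H × K => htmul p.1 (U p.2))
    (fun p q => by simp)
    (htmul_total (a := id) (b := id) (span_range_id_top H) (span_range_id_top K))
    (htmul_total (a := id) (b := U) (span_range_id_top H) (span_range_surj_top U.surjective))

@[simp] lemma htensorCongr_htmul [CompleteSpace K] [CompleteSpace L] (U : K ≃ₗᵢ[ℂ] L)
    (u : H) (x : K) : htensorCongr H U (htmul u x) = htmul u (U x) :=
  gramUnitary_apply (fun p : H × K => htmul p.1 p.2) _ _ _ _ (u, x)

variable [CompleteSpace H]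

/-- The slice `E^x T E_y`, where `E^x = (E_x)^*`. -/
noncomputable def slice (x y : K) (T : HTensor H K →L[ℂ] HTensor H K) : H →L[ℂ] H :=
  ContinuousLinearMap.adjoint (ketR H x) ∘L T ∘L ketR H y

lemma inner_slice (x y : K) (T : HTensor H K →L[ℂ] HTensor H K) (u v : H) :
    inner ℂ u (slice x y T v) = inner ℂ (htmul u x) (T (htmul v y)) := by
  simp [slice, ContinuousLinearMap.adjoint_inner_right]

end HTensor

/-! ### Symmetric Fock space -/

/-- A bundled complex Hilbert space (used only to define tensor powers recursively). -/
structure HilbSp : Type (u + 1) where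
  carrier : Type u
  [grp : NormedAddCommGroup carrier]
  [ips : InnerProductSpace ℂ carrier]
  [cpl : CompleteSpace carrier]

attribute [instance] HilbSp.grp HilbSp.ips HilbSp.cpl

section Fock

variable (h : Type u) [NormedAddCommGroup h] [InnerProductSpace ℂ h]

/-- The `n`-fold Hilbert space tensor power: `ℂ` (in the universe of `h`) for `n = 0`, and
`h ⊗ h^{⊗ n}` for `n + 1`. -/
noncomputable def tpow : ℕ → HilbSp.{u}
  | 0 => ⟨EuclideanSpace ℂ PUnit.{u + 1}⟩
  | n + 1 => ⟨HTensor h (tpow n).carrier⟩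

variable {h}

/-- The vector `f^{⊗ n}`. -/
noncomputable def tpowVec (f : h) : (n : ℕ) → (tpow h n).carrier
  | 0 => EuclideanSpace.single PUnit.unit (1 : ℂ)
  | n + 1 => htmul f (tpowVec f n)

lemma inner_tpowVec (f g : h) (n : ℕ) :
    inner ℂ (tpowVec f n) (tpowVec g n) = inner ℂ f g ^ n := by
  induction n with
  | zero =>
    have : inner ℂ (EuclideanSpace.single PUnit.unit (1 : ℂ) : EuclideanSpace ℂ PUnit.{u + 1})
        (EuclideanSpace.single PUnit.unit (1 : ℂ)) = 1 := by
      simp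
    rw [pow_zero]
    exact this
  | succ n ih =>
    have : inner ℂ (tpowVec f (n + 1)) (tpowVec g (n + 1)) =
      inner ℂ f g * inner ℂ (tpowVec f n) (tpowVec g n) := inner_htmul _ _ _ _
    rw [this, ih, pow_succ']

lemma norm_tpowVec (f : h) (n : ℕ) : ‖tpowVec f n‖ = ‖f‖ ^ n := by
  induction n with
  | zero =>
    have : ‖(EuclideanSpace.single PUnit.unit (1 : ℂ) : EuclideanSpace ℂ PUnit.{u + 1})‖ = 1 := by
      simp
    rw [pow_zero]
    exact this
  | succ n ih =>
    have : ‖tpowVec f (n + 1)‖ = ‖f‖ * ‖tpowVec f n‖ := norm_htmul _ _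
    rw [this, ih, pow_succ']

lemma tpowVec_smul (c : ℂ) (f : h) (n : ℕ) : tpowVec (c • f) n = c ^ n • tpowVec f n := by
  induction n with
  | zero => rw [pow_zero]; exact (one_smul ℂ (tpowVec f 0)).symm
  | succ n ih =>
    have h1 : tpowVec (c • f) (n + 1) = ketR h (tpowVec (c • f) n) (c • f) := rfl
    have h2 : tpowVec f (n + 1) = ketL (tpow h n).carrier f (tpowVec f n) := rfl
    rw [h1, h2, map_smul, ketR_apply, ← ketL_apply, ih, map_smul, smul_smul, pow_succ']
    rfl

variable (h)

/-- The `n`-fold symmetric tensor power: the closed linear span of `{f^{⊗ n} : f ∈ h}`. -/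
noncomputable def symPow (n : ℕ) : Submodule ℂ (tpow h n).carrier :=
  (Submodule.span ℂ (Set.range fun f : h => tpowVec f n)).topologicalClosure

/-- The symmetric tensors in the full Fock space `⨁ₙ h^{⊗ n}` (Hilbert space direct sum). -/
noncomputable def symFockSubmodule :
    Submodule ℂ (lp (fun n => (tpow h n).carrier) 2) where
  carrier := {ξ | ∀ n, ξ n ∈ symPow h n}
  add_mem' hx hy n := by simpa using (symPow h n).add_mem (hx n) (hy n)
  zero_mem' n := by simp
  smul_mem' c x hx n := by simpa using (symPow h n).smul_mem c (hx n)

lemma isClosed_symFockSubmodule :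
    IsClosed (symFockSubmodule h : Set (lp (fun n => (tpow h n).carrier) 2)) := by
  have : (symFockSubmodule h : Set (lp (fun n => (tpow h n).carrier) 2)) =
      ⋂ n, (fun ξ : lp (fun n => (tpow h n).carrier) 2 => ξ n) ⁻¹' (symPow h n : Set _) := by
    ext ξ; simp only [Set.mem_iInter]; rfl
  rw [this]
  exact isClosed_iInter fun n => (Submodule.isClosed_topologicalClosure _).preimage
    (lp.evalCLM ℂ (fun n => (tpow h n).carrier) 2 n).continuous

/-- The symmetric Fock space over `h`. -/
def SymFock : Type _ := symFockSubmodule h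

noncomputable instance : NormedAddCommGroup (SymFock h) :=
  inferInstanceAs (NormedAddCommGroup (symFockSubmodule h))

noncomputable instance : InnerProductSpace ℂ (SymFock h) :=
  inferInstanceAs (InnerProductSpace ℂ (symFockSubmodule h))

instance : CompleteSpace (SymFock h) :=
  (isClosed_symFockSubmodule h).completeSpace_coe

variable {h}

lemma memlp_expVec (f : h) :
    Memℓp (fun n => ((Real.sqrt n.factorial)⁻¹ : ℂ) • tpowVec f n) 2 := by
  refine memℓp_gen ?_
  have : ∀ n : ℕ, ‖((Real.sqrt n.factorial)⁻¹ : ℂ) • tpowVec f n‖ ^ (2 : ℝ≥0∞).toReal =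
      (‖f‖ ^ 2) ^ n / n.factorial := by
    intro n
    rw [norm_smul, norm_tpowVec]
    simp only [ENNReal.toReal_ofNat, Real.rpow_ofNat, norm_inv, Complex.norm_real,
      Real.norm_eq_abs, mul_pow, inv_pow, sq_abs]
    rw [Real.sq_sqrt (by positivity)]
    ring
  simp_rw [this]
  exact Real.summable_pow_div_factorial _

/-- The exponential vector `ε(f) = ((n!)^{-1/2} f^{⊗ n})ₙ`. -/
noncomputable def expVec (f : h) : SymFock h :=
  ⟨⟨fun n => ((Real.sqrt n.factorial)⁻¹ : ℂ) • tpowVec f n, memlp_expVec f⟩, fun n =>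
    (symPow h n).smul_mem _ (Submodule.le_topologicalClosure _ (Submodule.subset_span ⟨f, rfl⟩))⟩

lemma inner_expVec (f g : h) : inner ℂ (expVec f) (expVec g) = Complex.exp (inner ℂ f g) := by
  have h1 : inner ℂ (expVec f) (expVec g) = ∑' n : ℕ,
      inner ℂ (((Real.sqrt n.factorial)⁻¹ : ℂ) • tpowVec f n)
        (((Real.sqrt n.factorial)⁻¹ : ℂ) • tpowVec g n) :=
    lp.inner_eq_tsum (𝕜 := ℂ) (expVec f).1 (expVec g).1
  rw [h1, Complex.exp_eq_exp_ℂ, NormedSpace.exp_eq_tsum_div]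
  refine tsum_congr fun n => ?_
  rw [inner_smul_left, inner_smul_right, inner_tpowVec, map_inv₀, Complex.conj_ofReal,
    ← mul_assoc, ← mul_inv, ← Complex.ofReal_mul, Real.mul_self_sqrt (by positivity)]
  simp [div_eq_inv_mul]

/-- The exponential vectors are total in the symmetric Fock space. -/
lemma expVec_total :
    (Submodule.span ℂ (Set.range (expVec : h → SymFock h))).topologicalClosure = ⊤ := by
  rw [Submodule.topologicalClosure_eq_top_iff, Submodule.eq_bot_iff]
  intro ξ hξ
  have horth : ∀ f : h, inner ℂ (expVec f) ξ = 0 := fun f =>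
    (Submodule.mem_orthogonal _ _).mp hξ _ (Submodule.subset_span ⟨f, rfl⟩)
  have key : ∀ (f : h) (n : ℕ), inner ℂ (tpowVec f n) (ξ.1 n) = 0 := by
    intro f
    set c : ℕ → ℂ := fun n =>
      inner ℂ (((Real.sqrt n.factorial)⁻¹ : ℂ) • tpowVec f n) (ξ.1 n) with hc
    have hs : ∀ z : ℂ, HasSum (fun n => z ^ n * c n) 0 := by
      intro z
      have h1 := lp.hasSum_inner (𝕜 := ℂ) (expVec ((starRingEnd ℂ) z • f)).1 ξ.1
      have h2 : inner ℂ (expVec ((starRingEnd ℂ) z • f)).1 ξ.1 = 0 :=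
        horth ((starRingEnd ℂ) z • f)
      rw [h2] at h1
      have h3 : ∀ n, inner ℂ ((expVec ((starRingEnd ℂ) z • f)).1 n) (ξ.1 n) = z ^ n * c n := by
        intro n
        have : (expVec ((starRingEnd ℂ) z • f)).1 n =
          ((Real.sqrt n.factorial)⁻¹ : ℂ) • tpowVec ((starRingEnd ℂ) z • f) n := rfl
        rw [this, tpowVec_smul, smul_comm, inner_smul_left, map_pow, Complex.conj_conj]
      simpa only [h3] using h1
    have hp : HasFPowerSeriesOnBall (0 : ℂ → ℂ) (FormalMultilinearSeries.ofScalars ℂ c) 0 1 := by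
      refine ⟨?_, zero_lt_one, fun {y} _ => ?_⟩
      · refine FormalMultilinearSeries.le_radius_of_summable _ (r := 1) ?_
        have := (hs 1).summable.norm
        refine Summable.of_nonneg_of_le (fun n => by positivity) (fun n => ?_) this
        simp
      · have := hs y
        simp only [FormalMultilinearSeries.ofScalars_apply_eq, smul_eq_mul, Pi.zero_apply]
        exact this.congr_fun (fun n => mul_comm _ _)
    have hc0 : c = 0 :=
      (FormalMultilinearSeries.ofScalars_series_eq_zero ℂ).mp hp.hasFPowerSeriesAt.eq_zero
    intro n
    have h4 : c n = 0 := congrFun hc0 n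
    rw [hc] at h4
    simp only [inner_smul_left, mul_eq_zero, map_eq_zero, inv_eq_zero, Complex.ofReal_eq_zero,
      Real.sqrt_eq_zero'] at h4
    rcases h4 with h4 | h4
    · exact absurd h4 (not_le.mpr (Nat.cast_pos.mpr n.factorial_pos))
    · exact h4
  have hz : ∀ n, ξ.1 n = 0 := by
    intro n
    have h5 : symPow h n ≤ (ℂ ∙ (ξ.1 n))ᗮ := by
      refine Submodule.topologicalClosure_minimal _ ?_ (Submodule.isClosed_orthogonal _)
      rw [Submodule.span_le]
      rintro _ ⟨f, rfl⟩
      exact Submodule.mem_orthogonal_singleton_iff_inner_left.mpr (key f n)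
    have h6 := Submodule.mem_orthogonal_singleton_iff_inner_left.mp (h5 (ξ.2 n))
    exact inner_self_eq_zero.mp h6
  exact Subtype.ext (lp.ext (funext hz))

/-- The normalised exponential (coherent) vector `ϖ(f) = e^{-‖f‖²/2} ε(f)`. -/
noncomputable def cohVec (f : h) : SymFock h := (Real.exp (-(1 / 2) * ‖f‖ ^ 2) : ℂ) • expVec f

end Fock

/-! ### The Fock space over `L²(J; k)` -/

section Noise

variable (k : Type u) [NormedAddCommGroup k] [InnerProductSpace ℂ k]

/-- `L²(J; k)` for `J ⊆ ℝ`, with respect to Lebesgue measure. -/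
abbrev NoiseL2 (J : Set ℝ) : Type u := Lp k 2 (volume.restrict J)

/-- The symmetric Fock space `𝓕_J` over `L²(J; k)`. -/
abbrev FockOn (J : Set ℝ) : Type u := SymFock (NoiseL2 k J)

/-- The symmetric Fock space `𝓕` over `L²(ℝ₊; k)`. -/
abbrev Fock : Type u := FockOn k (Set.Ici 0)

variable {k}

/-- The restriction `f ↦ f|_{J'}` from `L²(J; k)` to `L²(J'; k)`, for `J' ⊆ J`. -/
noncomputable def restrL2 {J J' : Set ℝ} (hJ : J' ⊆ J) (f : NoiseL2 k J) : NoiseL2 k J' :=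
  ((Lp.memLp f).mono_measure (Measure.restrict_mono hJ le_rfl)).toLp f

lemma restrL2_coeFn {J J' : Set ℝ} (hJ : J' ⊆ J) (f : NoiseL2 k J) :
    restrL2 hJ f =ᵐ[volume.restrict J'] f := MemLp.coeFn_toLp _

lemma inner_restrL2_add {J J₁ J₂ : Set ℝ} (h₁ : J₁ ⊆ J) (h₂ : J₂ ⊆ J) (hu : J₁ ∪ J₂ = J)
    (hd : Disjoint J₁ J₂) (hm : MeasurableSet J₂) (f g : NoiseL2 k J) :
    inner ℂ f g = inner ℂ (restrL2 h₁ f) (restrL2 h₁ g) +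
      inner ℂ (restrL2 h₂ f) (restrL2 h₂ g) := by
  have key : ∀ {J' : Set ℝ} (h' : J' ⊆ J), inner ℂ (restrL2 h' f) (restrL2 h' g) =
      ∫ x in J', inner ℂ (f x) (g x) := by
    intro J' h'
    rw [L2.inner_def]
    refine integral_congr_ae ?_
    filter_upwards [restrL2_coeFn h' f, restrL2_coeFn h' g] with x hx hy
    rw [hx, hy]
  have hi : IntegrableOn (fun x => inner ℂ (f x) (g x)) J := L2.integrable_inner f g
  rw [key h₁, key h₂, L2.inner_def, ← setIntegral_union hd hm (hi.mono_set h₁) (hi.mono_set h₂), hu]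

lemma exists_restrL2_eq {J J₁ J₂ : Set ℝ} (h₁ : J₁ ⊆ J) (h₂ : J₂ ⊆ J)
    (hd : Disjoint J₁ J₂) (hm₁ : MeasurableSet J₁) (hm₂ : MeasurableSet J₂)
    (f₁ : NoiseL2 k J₁) (f₂ : NoiseL2 k J₂) :
    ∃ f : NoiseL2 k J, restrL2 h₁ f = f₁ ∧ restrL2 h₂ f = f₂ := by
  have m₁ : MemLp (J₁.indicator f₁) 2 (volume.restrict J) :=
    ((memLp_indicator_iff_restrict hm₁).mpr (Lp.memLp f₁)).restrict J
  have m₂ : MemLp (J₂.indicator f₂) 2 (volume.restrict J) :=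
    ((memLp_indicator_iff_restrict hm₂).mpr (Lp.memLp f₂)).restrict J
  have hf := MemLp.coeFn_toLp (m₁.add m₂)
  refine ⟨(m₁.add m₂).toLp _, Lp.ext ?_, Lp.ext ?_⟩
  · filter_upwards [restrL2_coeFn h₁ ((m₁.add m₂).toLp _),
      ae_restrict_of_ae_restrict_of_subset h₁ hf, ae_restrict_mem hm₁] with x h3 h4 h5
    rw [h3, h4, Pi.add_apply, Set.indicator_of_mem h5,
      Set.indicator_of_notMem (Set.disjoint_left.mp hd h5), add_zero]
  · filter_upwards [restrL2_coeFn h₂ ((m₁.add m₂).toLp _),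
      ae_restrict_of_ae_restrict_of_subset h₂ hf, ae_restrict_mem hm₂] with x h3 h4 h5
    rw [h3, h4, Pi.add_apply, Set.indicator_of_mem h5,
      Set.indicator_of_notMem (Set.disjoint_right.mp hd h5), zero_add]

lemma Ico_subset_Ici (r : ℝ≥0) : Set.Ico (0 : ℝ) r ⊆ Set.Ici 0 := fun _ hx => hx.1

lemma Ici_subset_Ici' (r : ℝ≥0) : Set.Ici (r : ℝ) ⊆ Set.Ici 0 := fun _ hx => r.2.trans hx

lemma Ico_union_Ici' (r : ℝ≥0) : Set.Ico (0 : ℝ) r ∪ Set.Ici (r : ℝ) = Set.Ici 0 :=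
  Set.Ico_union_Ici_eq_Ici r.2

lemma disjoint_Ico_Ici (r : ℝ≥0) : Disjoint (Set.Ico (0 : ℝ) r) (Set.Ici (r : ℝ)) :=
  Set.disjoint_left.mpr fun _ hx hy => not_le.mpr hx.2 hy

/-- The restriction of `f ∈ L²(ℝ₊; k)` to `[0, r[`. -/
noncomputable def pastL2 (r : ℝ≥0) (f : NoiseL2 k (Set.Ici 0)) : NoiseL2 k (Set.Ico 0 r) :=
  restrL2 (Ico_subset_Ici r) f

/-- The restriction of `f ∈ L²(ℝ₊; k)` to `[r, ∞[`. -/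
noncomputable def futureL2 (r : ℝ≥0) (f : NoiseL2 k (Set.Ici 0)) : NoiseL2 k (Set.Ici r) :=
  restrL2 (Ici_subset_Ici' r) f

lemma measurePreserving_sub (r : ℝ≥0) : MeasurePreserving (fun x : ℝ => x - r)
    (volume.restrict (Set.Ici (r : ℝ))) (volume.restrict (Set.Ici 0)) := by
  have h := (measurePreserving_sub_right (volume : Measure ℝ) (r : ℝ)).restrict_preimage
    (measurableSet_Ici (a := (0 : ℝ)))
  simpa using h

lemma measurePreserving_add (r : ℝ≥0) : MeasurePreserving (fun x : ℝ => x + r)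
    (volume.restrict (Set.Ici 0)) (volume.restrict (Set.Ici (r : ℝ))) := by
  have h := (measurePreserving_add_right (volume : Measure ℝ) (r : ℝ)).restrict_preimage
    (measurableSet_Ici (a := (r : ℝ)))
  simpa using h

/-- The right shift `(s_r f)(x) = f(x - r)`, from `L²(ℝ₊; k)` onto `L²([r, ∞[; k)`. -/
noncomputable def shiftL2 (r : ℝ≥0) : NoiseL2 k (Set.Ici 0) →ₗᵢ[ℂ] NoiseL2 k (Set.Ici (r : ℝ)) :=
  Lp.compMeasurePreservingₗᵢ ℂ (fun x : ℝ => x - r) (measurePreserving_sub r)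

lemma shiftL2_surjective (r : ℝ≥0) : Function.Surjective (shiftL2 (k := k) r) := by
  intro g
  refine ⟨Lp.compMeasurePreserving (fun x : ℝ => x + r) (measurePreserving_add r) g, ?_⟩
  have : shiftL2 r (Lp.compMeasurePreserving (fun x : ℝ => x + r) (measurePreserving_add r) g) =
    Lp.compMeasurePreserving (fun x : ℝ => x - r) (measurePreserving_sub r)
      (Lp.compMeasurePreserving (fun x : ℝ => x + r) (measurePreserving_add r) g) := rfl
  rw [this]
  refine Lp.ext ?_
  have h1 := Lp.coeFn_compMeasurePreserving
    (Lp.compMeasurePreserving (fun x : ℝ => x + r) (measurePreserving_add r) g)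
    (measurePreserving_sub r)
  have h2 := (measurePreserving_sub r).quasiMeasurePreserving.ae
    (Lp.coeFn_compMeasurePreserving g (measurePreserving_add r))
  filter_upwards [h1, h2] with x hx hy
  simp only [Function.comp_apply] at hx hy
  rw [hx, hy, sub_add_cancel]

lemma expVec_shift_total (r : ℝ≥0) :
    (Submodule.span ℂ (Set.range fun f : NoiseL2 k (Set.Ici 0) =>
      expVec (shiftL2 r f))).topologicalClosure = ⊤ := by
  have h := (shiftL2_surjective (k := k) r).range_comp
    (expVec : NoiseL2 k (Set.Ici (r : ℝ)) → FockOn k (Set.Ici (r : ℝ)))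
  have h2 : (Set.range fun f : NoiseL2 k (Set.Ici 0) => expVec (shiftL2 r f)) =
    Set.range (expVec : NoiseL2 k (Set.Ici (r : ℝ)) → FockOn k (Set.Ici (r : ℝ))) := h
  rw [h2]
  exact expVec_total

/-- The second quantisation `𝓕 → 𝓕_{[r, ∞[}` of the right shift, `ε(f) ↦ ε(s_r f)`. -/
noncomputable def shiftFock (k : Type u) [NormedAddCommGroup k] [InnerProductSpace ℂ k]
    (r : ℝ≥0) : Fock k ≃ₗᵢ[ℂ] FockOn k (Set.Ici (r : ℝ)) :=
  gramUnitary (fun f : NoiseL2 k (Set.Ici 0) => expVec f) (fun f => expVec (shiftL2 r f))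
    (fun f g => by rw [inner_expVec, inner_expVec, LinearIsometry.inner_map_map])
    expVec_total (expVec_shift_total r)

@[simp] lemma shiftFock_expVec (r : ℝ≥0) (f : NoiseL2 k (Set.Ici 0)) :
    shiftFock k r (expVec f) = expVec (shiftL2 r f) :=
  gramUnitary_apply (fun f : NoiseL2 k (Set.Ici 0) => expVec f) (fun f => expVec (shiftL2 r f))
    (fun f g => by rw [inner_expVec, inner_expVec, LinearIsometry.inner_map_map])
    expVec_total (expVec_shift_total r) f

variable {H : Type v} [NormedAddCommGroup H] [InnerProductSpace ℂ H]

lemma inner_fockSplit (r : ℝ≥0) (p q : H × NoiseL2 k (Set.Ici 0)) :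
    inner ℂ (htmul p.1 (expVec p.2)) (htmul q.1 (expVec q.2)) =
      inner ℂ (htmul (htmul p.1 (expVec (pastL2 r p.2))) (expVec (futureL2 r p.2)))
        (htmul (htmul q.1 (expVec (pastL2 r q.2))) (expVec (futureL2 r q.2))) := by
  simp only [inner_htmul, inner_expVec, pastL2, futureL2]
  rw [mul_assoc, ← Complex.exp_add, ← inner_restrL2_add (Ico_subset_Ici r) (Ici_subset_Ici' r)
    (Ico_union_Ici' r) (disjoint_Ico_Ici r) measurableSet_Ici]

lemma htmul_expVec_total : (Submodule.span ℂ (Set.range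
    fun p : H × NoiseL2 k (Set.Ici 0) => htmul p.1 (expVec p.2))).topologicalClosure = ⊤ :=
  htmul_total (a := id) (span_range_id_top H) expVec_total

lemma fockSplit_total (r : ℝ≥0) : (Submodule.span ℂ (Set.range
    fun p : H × NoiseL2 k (Set.Ici 0) =>
      htmul (htmul p.1 (expVec (pastL2 r p.2))) (expVec (futureL2 r p.2)))).topologicalClosure = ⊤ := by
  have h := htmul_total
    (htmul_total (a := id) (span_range_id_top H) (expVec_total (h := NoiseL2 k (Set.Ico 0 (r : ℝ)))))
    (expVec_total (h := NoiseL2 k (Set.Ici (r : ℝ))))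
  refine eq_top_iff.mpr (h.symm.le.trans (Submodule.topologicalClosure_mono
    (Submodule.span_mono ?_)))
  rintro _ ⟨⟨⟨u, f₁⟩, f₂⟩, rfl⟩
  obtain ⟨f, rfl, rfl⟩ := exists_restrL2_eq (Ico_subset_Ici r) (Ici_subset_Ici' r)
    (disjoint_Ico_Ici r) measurableSet_Ico measurableSet_Ici f₁ f₂
  exact ⟨(u, f), rfl⟩

/-- The identification `H ⊗ 𝓕 = (H ⊗ 𝓕_{[0, r[}) ⊗ 𝓕_{[r, ∞[}`, which is effected by
`u ⊗ ε(f) ↦ (u ⊗ ε(f|_{[0, r[})) ⊗ ε(f|_{[r, ∞[})`. -/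
noncomputable def fockSplit (H : Type v) [NormedAddCommGroup H] [InnerProductSpace ℂ H]
    (k : Type u) [NormedAddCommGroup k] [InnerProductSpace ℂ k] (r : ℝ≥0) :
    HTensor H (Fock k) ≃ₗᵢ[ℂ]
      HTensor (HTensor H (FockOn k (Set.Ico 0 (r : ℝ)))) (FockOn k (Set.Ici (r : ℝ))) :=
  gramUnitary (fun p : H × NoiseL2 k (Set.Ici 0) => htmul p.1 (expVec p.2))
    (fun p => htmul (htmul p.1 (expVec (pastL2 r p.2))) (expVec (futureL2 r p.2)))
    (inner_fockSplit r) htmul_expVec_total (fockSplit_total r)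

@[simp] lemma fockSplit_htmul_expVec (r : ℝ≥0) (u : H) (f : NoiseL2 k (Set.Ici 0)) :
    fockSplit H k r (htmul u (expVec f)) =
      htmul (htmul u (expVec (pastL2 r f))) (expVec (futureL2 r f)) :=
  gramUnitary_apply (fun p : H × NoiseL2 k (Set.Ici 0) => htmul p.1 (expVec p.2))
    (fun p => htmul (htmul p.1 (expVec (pastL2 r p.2))) (expVec (futureL2 r p.2)))
    (inner_fockSplit r) htmul_expVec_total (fockSplit_total r) (u, f)

/-- Conjugation `T ↦ U T U⁻¹` of an operator by a unitary, i.e. the operator corresponding to `T`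
under the identification `U`. -/
noncomputable def transport {K L : Type*} [NormedAddCommGroup K] [InnerProductSpace ℂ K]
    [NormedAddCommGroup L] [InnerProductSpace ℂ L] (U : K ≃ₗᵢ[ℂ] L) (T : K →L[ℂ] K) :
    L →L[ℂ] L :=
  (U : K →L[ℂ] L) ∘L T ∘L (U.symm : L →L[ℂ] K)

/-- For `Y ∈ B(H ⊗ 𝓕_{[0, r[})`, the operator `Y ⊗ I_{[r, ∞[}` on `H ⊗ 𝓕`. -/
noncomputable def adaptedExt (r : ℝ≥0)
    (Y : HTensor H (FockOn k (Set.Ico 0 (r : ℝ))) →L[ℂ] HTensor H (FockOn k (Set.Ico 0 (r : ℝ)))) :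
    HTensor H (Fock k) →L[ℂ] HTensor H (Fock k) :=
  transport (fockSplit H k r).symm (ampliation (FockOn k (Set.Ici (r : ℝ))) Y)

/-- The constant function `x` on `[0, t[`, extended by zero to an element of `L²(ℝ₊; k)`. -/
noncomputable def constOn (t : ℝ≥0) (x : k) : NoiseL2 k (Set.Ici 0) :=
  indicatorConstLp 2 (s := Set.Ico (0 : ℝ) t) measurableSet_Ico
    (ne_top_of_le_ne_top (by simp) (Measure.restrict_apply_le _ _)) x

end Noise

/-! ### Matrices of operators -/

section Matrices

variable {H : Type*} [NormedAddCommGroup H] [InnerProductSpace ℂ H]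

/-- The operator on the `n`-fold orthogonal sum `Hⁿ` given by a matrix with entries in `B(H)`,
which realises the identification `M_n(B(H)) = B(Hⁿ)`. -/
noncomputable def matOp {n : ℕ} (A : Matrix (Fin n) (Fin n) (H →L[ℂ] H)) :
    PiLp 2 (fun _ : Fin n => H) →L[ℂ] PiLp 2 (fun _ : Fin n => H) :=
  ((PiLp.continuousLinearEquiv 2 ℂ fun _ : Fin n => H).symm : _ →L[ℂ] _) ∘L
    ContinuousLinearMap.pi fun i => ∑ j, A i j ∘L PiLp.proj 2 (fun _ : Fin n => H) j

@[simp] lemma matOp_apply {n : ℕ} (A : Matrix (Fin n) (Fin n) (H →L[ℂ] H))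
    (u : PiLp 2 (fun _ : Fin n => H)) (i : Fin n) : matOp A u i = ∑ j, A i j (u j) := by
  simp [matOp]

/-- The matrix `I ⊗ lam` with entries `lam i j • I`. -/
noncomputable def idTensor (H : Type*) [NormedAddCommGroup H] [InnerProductSpace ℂ H] {n : ℕ}
    (lam : Matrix (Fin n) (Fin n) ℂ) : Matrix (Fin n) (Fin n) (H →L[ℂ] H) :=
  lam.map fun z => z • (1 : H →L[ℂ] H)

end Matrices

/-! ### Quantum stochastic cocycles -/

section Cocycles

variable {H : Type v} [NormedAddCommGroup H] [InnerProductSpace ℂ H] [CompleteSpace H]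

/-- A concrete (possibly nonunital) C*-algebra: a norm closed `*`-subalgebra `C` of `B(H)`;
it acts nondegenerately if `C H` is total in `H`. -/
def ActsNondegenerately (C : NonUnitalStarSubalgebra ℂ (H →L[ℂ] H)) : Prop :=
  (Submodule.span ℂ {w : H | ∃ a ∈ C, ∃ u : H, w = a u}).topologicalClosure = ⊤

/-- The algebra `C` has no identity element. -/
def IsNonunital (C : NonUnitalStarSubalgebra ℂ (H →L[ℂ] H)) : Prop :=
  ¬ ∃ e : C, ∀ a : C, e * a = a ∧ a * e = a

/-- The `n × n` matrix over `B(H)` underlying a matrix over `C`. -/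
def coeMat {C : NonUnitalStarSubalgebra ℂ (H →L[ℂ] H)} {n : ℕ} (A : Matrix (Fin n) (Fin n) C) :
    Matrix (Fin n) (Fin n) (H →L[ℂ] H) :=
  A.map fun a => (a : H →L[ℂ] H)

/-- The order interval `[0, R]` in `M_n(C)`, for `R ∈ M_n(B(H))`. -/
def orderInterval (C : NonUnitalStarSubalgebra ℂ (H →L[ℂ] H)) {n : ℕ}
    (R : Matrix (Fin n) (Fin n) (H →L[ℂ] H)) : Set (Matrix (Fin n) (Fin n) C) :=
  {A | 0 ≤ matOp (coeMat A) ∧ matOp (coeMat A) ≤ matOp R}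

/-- The matrix space `C ⊗_M B(K)`: the operators on `H ⊗ K` all of whose slices `E^x T E_y`
(`x, y ∈ K`) belong to `C`. -/
def matrixSpace (C : NonUnitalStarSubalgebra ℂ (H →L[ℂ] H)) (K : Type*) [NormedAddCommGroup K]
    [InnerProductSpace ℂ K] : Submodule ℂ (HTensor H K →L[ℂ] HTensor H K) where
  carrier := {T | ∀ x y : K, slice x y T ∈ C}
  add_mem' hS hT x y := by
    have h := add_mem (hS x y) (hT x y)
    simpa [slice, ContinuousLinearMap.add_comp, ContinuousLinearMap.comp_add] using h
  zero_mem' x y := by simp [slice]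
  smul_mem' c T hT x y := by
    have h := SMulMemClass.smul_mem c (hT x y)
    simpa [slice] using h

variable {k : Type u} [NormedAddCommGroup k] [InnerProductSpace ℂ k]
  {C : NonUnitalStarSubalgebra ℂ (H →L[ℂ] H)}

/-- The slice map `T ↦ E^x T E_y` from `C ⊗_M B(K)` to `C`. -/
noncomputable def sliceIn {K : Type*} [NormedAddCommGroup K] [InnerProductSpace ℂ K] (x y : K)
    (T : matrixSpace C K) : C := ⟨slice x y T.1, T.2 x y⟩

lemma slice_transport_htensorCongr {K L : Type*} [NormedAddCommGroup K] [InnerProductSpace ℂ K]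
    [NormedAddCommGroup L] [InnerProductSpace ℂ L] [CompleteSpace K] [CompleteSpace L]
    (U : K ≃ₗᵢ[ℂ] L) (x y : L) (T : HTensor H K →L[ℂ] HTensor H K) :
    slice x y (transport (htensorCongr H U) T) = slice (U.symm x) (U.symm y) T := by
  have hs : ∀ (u : H) (z : L), (htensorCongr H U).symm (htmul u z) = htmul u (U.symm z) := by
    intro u z
    rw [LinearIsometryEquiv.symm_apply_eq, htensorCongr_htmul, U.apply_symm_apply]
  refine ContinuousLinearMap.ext fun v => ext_inner_left ℂ fun u => ?_
  rw [inner_slice, inner_slice, transport]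
  simp only [ContinuousLinearMap.comp_apply]
  have h1 : ((htensorCongr H U).symm : HTensor H L →L[ℂ] HTensor H K) (htmul v y) =
    htmul v (U.symm y) := hs v y
  rw [h1, ← hs u x]
  exact ((htensorCongr H U).symm.inner_map_eq_flip (htmul u x) _).symm

/-- The shift `σ_r : C ⊗_M B(𝓕) → C ⊗_M B(𝓕_{[r, ∞[})`: conjugation by the second quantised right
shift. (Its values are identified with operators `I_{[0, r[} ⊗ T` on `H ⊗ 𝓕`.) -/
noncomputable def shiftMap (r : ℝ≥0) (T : matrixSpace C (Fock k)) :
    matrixSpace C (FockOn k (Set.Ici (r : ℝ))) :=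
  ⟨transport (htensorCongr H (shiftFock k r)) T.1, fun x y => by
    rw [slice_transport_htensorCongr]
    exact T.2 _ _⟩

/-- Let `φ : C → C ⊗_M B(𝓕)` have values in `C ⊗_M B(𝓕_{[0, r[}) ⊗ I_{[r, ∞[}`. The lifting
`φ̂ = φ ⊗_M id : C ⊗_M B(𝓕_{[r, ∞[}) → (C ⊗_M B(𝓕_{[0, r[})) ⊗_M B(𝓕_{[r, ∞[})`, with target
identified with a space of operators on `H ⊗ 𝓕`, is determined by
`E^e φ̂(T) E_d = φ(E^e T E_d)` for all `d, e ∈ 𝓕_{[r, ∞[}`, where the left-hand side is an operator on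
`H ⊗ 𝓕_{[0, r[}`. This is the relation `S = φ̂(T)`. -/
def IsLiftValue (r : ℝ≥0) (φ : C →L[ℂ] matrixSpace C (Fock k))
    (T : matrixSpace C (FockOn k (Set.Ici (r : ℝ))))
    (S : HTensor H (Fock k) →L[ℂ] HTensor H (Fock k)) : Prop :=
  ∀ e d : FockOn k (Set.Ici (r : ℝ)),
    adaptedExt r (slice e d (transport (fockSplit H k r) S)) = (φ (sliceIn e d T)).1

/-- The matrix lifting `φ^{(n)} : M_n(C) → M_n(B(H ⊗ K))`. -/
noncomputable def matLift {K : Type*} [NormedAddCommGroup K] [InnerProductSpace ℂ K]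
    (φ : C →L[ℂ] matrixSpace C K) {n : ℕ} (A : Matrix (Fin n) (Fin n) C) :
    Matrix (Fin n) (Fin n) (HTensor H K →L[ℂ] HTensor H K) :=
  A.map fun a => (φ a).1

/-- Complete boundedness of a map `C → C ⊗_M B(K)`. -/
def IsCompletelyBounded {K : Type*} [NormedAddCommGroup K] [InnerProductSpace ℂ K]
    (φ : C →L[ℂ] matrixSpace C K) : Prop :=
  ∃ M : ℝ, ∀ (n : ℕ) (A : Matrix (Fin n) (Fin n) C),
    ‖matOp (matLift φ A)‖ ≤ M * ‖matOp (coeMat A)‖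

/-- Complete positivity of a map `C → C ⊗_M B(K)`. -/
def IsCompletelyPositive {K : Type*} [NormedAddCommGroup K] [InnerProductSpace ℂ K]
    (φ : C →L[ℂ] matrixSpace C K) : Prop :=
  ∀ (n : ℕ) (A : Matrix (Fin n) (Fin n) C), 0 ≤ matOp (coeMat A) → 0 ≤ matOp (matLift φ A)

/-- Completely bounded quantum stochastic processes on `C` with noise dimension space `k`:
`j_t(a) ∈ C ⊗_M B(𝓕_{[0, t[}) ⊗ I_{[t, ∞[}`. -/
structure IsQSProcess (j : ℝ≥0 → C →L[ℂ] matrixSpace C (Fock k)) : Prop where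
  adapted : ∀ (t : ℝ≥0) (a : C),
    ∃ Y ∈ matrixSpace C (FockOn k (Set.Ico 0 (t : ℝ))), (j t a).1 = adaptedExt t Y
  completelyBounded : ∀ t, IsCompletelyBounded (j t)

/-- Quantum stochastic cocycles on `C`: processes with `j_0(a) = a ⊗ I` and
`j_{r+t} = ĵ_r ∘ σ_r ∘ j_t`. -/
structure IsQSCocycle (j : ℝ≥0 → C →L[ℂ] matrixSpace C (Fock k)) : Prop
    extends IsQSProcess j where
  initial : ∀ a : C, (j 0 a).1 = ampliation (Fock k) (a : H →L[ℂ] H)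
  cocycle : ∀ (r t : ℝ≥0) (a : C), IsLiftValue r (j r) (shiftMap r (j t a)) (j (r + t) a).1

/-- Completely positive contraction cocycles on `C`. -/
structure IsCPContractionCocycle (j : ℝ≥0 → C →L[ℂ] matrixSpace C (Fock k)) : Prop
    extends IsQSCocycle j where
  completelyPositive : ∀ t, IsCompletelyPositive (j t)
  contractive : ∀ t, ‖j t‖ ≤ 1

/-- The associated semigroups `a ↦ E(x_{[0, t[})^* j_t(a) E(y_{[0, t[})` of a cocycle, where
`E(f) = E_{ϖ(f)}`. -/
noncomputable def assocSemigroup (j : ℝ≥0 → C →L[ℂ] matrixSpace C (Fock k)) (x y : k) (t : ℝ≥0)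
    (a : C) : C :=
  sliceIn (cohVec (constOn t x)) (cohVec (constOn t y)) (j t a)

/-- One-parameter semigroups of linear maps on `C`. -/
structure IsSemigroup (P : ℝ≥0 → C →ₗ[ℂ] C) : Prop where
  zero : P 0 = LinearMap.id
  add : ∀ s t, P (s + t) = P s ∘ₗ P t

/-- The Schur-action map `[a i j] ↦ [P^{x i, x j}_t (a i j)]` on `M_n(C)`. -/
noncomputable def schurMap {I : Type*} (P : I → I → ℝ≥0 → C →ₗ[ℂ] C) {n : ℕ} (x : Fin n → I) (t : ℝ≥0)
    (A : Matrix (Fin n) (Fin n) C) : Matrix (Fin n) (Fin n) C :=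
  Matrix.of fun i j => P (x i) (x j) t (A i j)

/-- `χ(x, y) = (‖x‖² + ‖y‖²) / 2 - ⟪x, y⟫`. -/
noncomputable def chiForm (x y : k) : ℂ := (1 / 2) * ((‖x‖ : ℂ) ^ 2 + (‖y‖ : ℂ) ^ 2) - inner ℂ x y

/-- The Gram matrix `[⟪ϖ(xⁱ_{[0, t[}), ϖ(xʲ_{[0, t[})⟫] = [e^{-t χ(xⁱ, xʲ)}]`. -/
noncomputable def gramMat {n : ℕ} (x : Fin n → k) (t : ℝ≥0) : Matrix (Fin n) (Fin n) ℂ :=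
  Matrix.of fun i j => Complex.exp (-(t : ℂ) * chiForm (x i) (x j))

end Cocycles

/-! Necessity. Let `φ` be a completely positive contraction on `C` and let `A ≤ lam ⊗ 1`. As `C` has
no unit, `lam ⊗ 1 - A` is compressed by an approximate unit `e`; the result lies in `M_n(C)` and has
positive image. The defect `lam ⊗ (1 - φ (e * e))` is positive by Schur's theorem, and in the limit
`φ` respects the interval `[0, I ⊗ lam]` (`IsCPMap.isPosKernel_sub`). Slicing by coherent vectors
then multiplies `lam` entrywise by their Gram matrix.

Sufficiency. For `T`-valued step functions `f`, `g` of bounded support, composing the given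
semigroups along a common subdivision of `[0, t[` yields an evolution `P^{f,g}_t`. Applying the
order condition interval by interval, each time with `lam` replaced by its Schur product with the
Gram matrix of the later intervals, shows that matrices of evolutions carry `[0, I ⊗ lam]` into `[0,
I ⊗ (lam ∘ G)]`, where `G` is the Gram matrix of the coherent vectors `ϖ(f)` on `[0, t[`
(`isPosKernel_evolution`). For `a ≥ 0` and `lam` equal to `‖a‖` times the all-ones matrix, this says
that the form `⟪u, P^{f,g}_t(a) v⟫` on the vectors `u ⊗ ϖ(f)`, `v ⊗ ϖ(g)` is positive and bounded by
`‖a‖` times the squared norm. It therefore comes from a bounded operator `Y_t(a)`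
(`exists_clm_of_kernel`, `exists_evolutionOp`), and `k_t(a) = Y_t(a) ⊗ I`.

The construction rests on the totality of the vectors `ϖ(f)` (`expVec_stepVec_total`), where `0 ∈ T`
enters. Rapid switching between two step functions converges weakly to their mean, so the closed
span of the exponential vectors is stable under midpoints; analyticity of `z ↦ ε(a + z b)` extends
this to complex lines, hence to all combinations.

Everything else is read off on coherent vectors: complete positivity and the bound by `1` from the
same order condition with repeated indices, and the cocycle relation from the factorisation of the
evolution of a concatenation (`evolutionAt_concatAt`). No continuity of the semigroups in time is
involved. -/

/-! ### Positive operator-valued kernels -/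

section PosKernel

variable {ι ι' : Type*} {K L : Type*} [NormedAddCommGroup K] [InnerProductSpace ℂ K]
  [NormedAddCommGroup L] [InnerProductSpace ℂ L]

/-- Positivity of an operator-valued kernel on a finite set. -/
def IsPosKernel [Fintype ι] (A : ι → ι → K →L[ℂ] K) : Prop :=
  ∀ u : ι → K, 0 ≤ ∑ i, ∑ j, inner ℂ (u i) (A i j (u j))

lemma ContinuousLinearMap.nonneg_iff_inner (T : K →L[ℂ] K) :
    0 ≤ T ↔ ∀ x, 0 ≤ inner ℂ x (T x) := by
  rw [ContinuousLinearMap.nonneg_iff_isPositive, ContinuousLinearMap.isPositive_iff_complex]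
  refine forall_congr' fun x => ?_
  rw [← inner_conj_symm x (T x), Complex.nonneg_iff]
  simp only [Complex.conj_re, Complex.conj_im, Complex.ext_iff]
  simp
  exact ⟨fun h => ⟨h.2, h.1.symm⟩, fun h => ⟨h.2.symm, h.1⟩⟩

lemma inner_matOp {n : ℕ} (A : Matrix (Fin n) (Fin n) (K →L[ℂ] K))
    (u w : PiLp 2 (fun _ : Fin n => K)) :
    inner ℂ u (matOp A w) = ∑ i, ∑ j, inner ℂ (u i) (A i j (w j)) := by
  simp [PiLp.inner_apply, inner_sum]

lemma matOp_nonneg_iff {n : ℕ} (A : Matrix (Fin n) (Fin n) (K →L[ℂ] K)) :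
    0 ≤ matOp A ↔ IsPosKernel A := by
  rw [ContinuousLinearMap.nonneg_iff_inner]
  refine ⟨fun h u => ?_, fun h x => ?_⟩
  · simpa only [inner_matOp] using h (WithLp.toLp 2 u)
  · rw [inner_matOp]
    exact h _

lemma matOp_sub {n : ℕ} (A B : Matrix (Fin n) (Fin n) (K →L[ℂ] K)) :
    matOp (A - B) = matOp A - matOp B := by
  ext u i
  simp [Finset.sum_sub_distrib]

lemma matOp_le_iff {n : ℕ} (A B : Matrix (Fin n) (Fin n) (K →L[ℂ] K)) :
    matOp A ≤ matOp B ↔ IsPosKernel (fun i j => B i j - A i j) := by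
  rw [ContinuousLinearMap.le_def, ← matOp_sub, ← ContinuousLinearMap.nonneg_iff_isPositive,
    matOp_nonneg_iff]
  rfl

variable [Fintype ι] [Fintype ι']

lemma IsPosKernel.add {A B : ι → ι → K →L[ℂ] K} (hA : IsPosKernel A) (hB : IsPosKernel B) :
    IsPosKernel (fun i j => A i j + B i j) := fun u => by
  simpa [inner_add_right, Finset.sum_add_distrib] using add_nonneg (hA u) (hB u)

/-- The quadratic form of the pulled-back kernel at `u` is that of `A` at the sums of `u` over the
fibres of `π`; injectivity plays no role. The lemma serves both for reindexing and for repeating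
rows and columns. -/
lemma IsPosKernel.comp {A : ι → ι → K →L[ℂ] K} (hA : IsPosKernel A) (π : ι' → ι) :
    IsPosKernel (fun p q => A (π p) (π q)) := fun u => by
  classical
  refine (hA fun i => ∑ p with π p = i, u p).trans_eq ?_
  have h1 : ∀ f : ι' → ℂ, ∑ p, f p = ∑ i, ∑ p with π p = i, f p := fun f =>
    (Finset.sum_fiberwise _ _ _).symm
  rw [h1]
  refine Finset.sum_congr rfl fun i _ => ?_
  have h2 : ∀ p ∈ Finset.univ.filter (fun p => π p = i),
      ∑ q, inner ℂ (u p) (A (π p) (π q) (u q)) =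
        ∑ j, ∑ q with π q = j, inner ℂ (u p) (A i j (u q)) := fun p hp => by
    rw [h1]
    refine Finset.sum_congr rfl fun j _ => Finset.sum_congr rfl fun q hq => ?_
    rw [(Finset.mem_filter.mp hp).2, (Finset.mem_filter.mp hq).2]
  rw [Finset.sum_congr rfl h2, Finset.sum_comm]
  refine Finset.sum_congr rfl fun j _ => ?_
  rw [sum_inner]
  refine Finset.sum_congr rfl fun p _ => ?_
  rw [map_sum, inner_sum]

/-- Schur multiplication by a positive semidefinite matrix preserves positivity. -/
lemma IsPosKernel.schur {A : ι → ι → K →L[ℂ] K} (hA : IsPosKernel A) {G : Matrix ι ι ℂ}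
    (hG : G.PosSemidef) : IsPosKernel (fun i j => G i j • A i j) := fun u => by
  classical
  obtain ⟨B, rfl⟩ : ∃ B : Matrix ι ι ℂ, G = B.conjTranspose * B := by
    open scoped MatrixOrder in
    obtain ⟨B, hB⟩ := CStarAlgebra.nonneg_iff_eq_star_mul_self.mp hG.nonneg
    exact ⟨B, hB⟩
  -- Each row `m` of `B` contributes the form of `A` at the rescaled vectors `B m i • u i`.
  have : ∑ i, ∑ j, inner ℂ (u i) (((B.conjTranspose * B) i j • A i j) (u j)) =
      ∑ m, ∑ i, ∑ j, inner ℂ (B m i • u i) (A i j (B m j • u j)) := by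
    rw [Finset.sum_comm]
    conv_rhs => rw [Finset.sum_comm]; enter [2, i]; rw [Finset.sum_comm]
    rw [Finset.sum_comm]
    refine Finset.sum_congr rfl fun i _ => Finset.sum_congr rfl fun j _ => ?_
    simp only [Matrix.mul_apply, Matrix.conjTranspose_apply, smul_apply,
      inner_smul_right, Finset.sum_mul, map_smul, inner_smul_left]
    refine Finset.sum_congr rfl fun m _ => ?_
    simp only [RCLike.star_def]
    ring
  rw [this]
  exact Finset.sum_nonneg fun m _ => hA _

lemma isPosKernel_unit (T : K →L[ℂ] K) : IsPosKernel (fun _ _ : Unit => T) ↔ 0 ≤ T := by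
  rw [ContinuousLinearMap.nonneg_iff_inner]
  refine ⟨fun h x => by simpa using h fun _ => x, fun h u => by simpa using h (u ())⟩

/-- Positivity of a kernel can be checked on linear combinations from a total family. -/
lemma isPosKernel_of_total {κ : Type*} {b : κ → K}
    (hb : (Submodule.span ℂ (Set.range b)).topologicalClosure = ⊤) {A : ι → ι → K →L[ℂ] K}
    (h : ∀ (s : Finset κ) (c : ι → κ → ℂ), 0 ≤ ∑ k, ∑ l, ∑ p ∈ s, ∑ q ∈ s,
      inner ℂ (c k p • b p) (A k l (c l q • b q))) : IsPosKernel A := by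
  classical
  intro u
  have hd : DenseRange (fun (x : ι → κ →₀ ℂ) i => Finsupp.linearCombination ℂ b (x i)) :=
    DenseRange.piMap (fun _ => denseRange_linearCombination hb)
  refine hd.induction_on (p := fun u => 0 ≤ ∑ i, ∑ j, inner ℂ (u i) (A i j (u j))) u
    (isClosed_le continuous_const (by fun_prop)) fun x => ?_
  -- The union of the supports is one finite set over which all the combinations `x i` can be
  -- written at once; the additional coefficients are zero.
  refine (h (Finset.univ.biUnion fun i => (x i).support) (fun i => x i)).trans_eq ?_
  refine Finset.sum_congr rfl fun k _ => Finset.sum_congr rfl fun l _ => ?_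
  have h1 : ∀ i, Finsupp.linearCombination ℂ b (x i) =
      ∑ p ∈ Finset.univ.biUnion fun i => (x i).support, x i p • b p := fun i => by
    rw [Finsupp.linearCombination_apply]
    exact Finsupp.sum_of_support_subset _
      (fun p hp => Finset.mem_biUnion.mpr ⟨i, Finset.mem_univ _, hp⟩) _ (by simp)
  beta_reduce
  rw [h1 k, h1 l, sum_inner]
  refine Finset.sum_congr rfl fun p _ => ?_
  rw [map_sum, inner_sum]

end PosKernel

/-! ### Operators from kernels on total families -/

section OpOfKernel

variable {κ K : Type*} [NormedAddCommGroup K] [InnerProductSpace ℂ K]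

lemma eq_of_inner_total {b : κ → K}
    (hb : (Submodule.span ℂ (Set.range b)).topologicalClosure = ⊤) {x y : K}
    (h : ∀ i, inner ℂ (b i) x = inner ℂ (b i) y) : x = y := by
  have : x - y ∈ (Submodule.span ℂ (Set.range b)).topologicalClosureᗮ := by
    rw [Submodule.orthogonal_closure, Submodule.mem_orthogonal]
    intro z hz
    induction hz using Submodule.span_induction with
    | mem z hz => obtain ⟨i, rfl⟩ := hz; rw [inner_sub_right, h, sub_self]
    | zero => simp
    | add z w _ _ hz hw => rw [inner_add_left, hz, hw, add_zero]
    | smul c z _ hz => rw [inner_smul_left, hz, mul_zero]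
  rw [hb, Submodule.top_orthogonal_eq_bot, Submodule.mem_bot] at this
  exact sub_eq_zero.mp this

lemma clm_ext_total {L : Type*} [NormedAddCommGroup L] [InnerProductSpace ℂ L] {b : κ → K}
    (hb : (Submodule.span ℂ (Set.range b)).topologicalClosure = ⊤) {S T : K →L[ℂ] L}
    (h : ∀ i, S (b i) = T (b i)) : S = T := by
  refine ContinuousLinearMap.ext_on (Submodule.dense_iff_topologicalClosure_eq_top.mpr hb) ?_
  rintro _ ⟨i, rfl⟩
  exact h i

lemma clm_ext_inner_total {b : κ → K}
    (hb : (Submodule.span ℂ (Set.range b)).topologicalClosure = ⊤) {S T : K →L[ℂ] K}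
    (h : ∀ i j, inner ℂ (b i) (S (b j)) = inner ℂ (b i) (T (b j))) : S = T :=
  clm_ext_total hb fun j => eq_of_inner_total hb fun i => h i j

/-- The sesquilinear form on finitely supported functions given by a scalar kernel. -/
noncomputable def kernelForm (F : κ → κ → ℂ) (c d : κ →₀ ℂ) : ℂ :=
  c.sum fun i x => d.sum fun j y => (starRingEnd ℂ) x * y * F i j

lemma kernelForm_add_left (F : κ → κ → ℂ) (c c' d : κ →₀ ℂ) :
    kernelForm F (c + c') d = kernelForm F c d + kernelForm F c' d := by
  classical
  refine Finsupp.sum_add_index' (by simp) fun i x y => ?_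
  rw [← Finsupp.sum_add]
  simp [add_mul]

lemma kernelForm_add_right (F : κ → κ → ℂ) (c d d' : κ →₀ ℂ) :
    kernelForm F c (d + d') = kernelForm F c d + kernelForm F c d' := by
  classical
  rw [kernelForm, kernelForm, kernelForm, ← Finsupp.sum_add]
  refine Finsupp.sum_congr fun i _ => Finsupp.sum_add_index' (by simp) fun j x y => ?_
  ring

lemma kernelForm_smul_left (F : κ → κ → ℂ) (z : ℂ) (c d : κ →₀ ℂ) :
    kernelForm F (z • c) d = (starRingEnd ℂ) z * kernelForm F c d := by
  rw [kernelForm, Finsupp.sum_smul_index' (by simp), kernelForm, Finsupp.mul_sum]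
  refine Finsupp.sum_congr fun i _ => ?_
  rw [Finsupp.mul_sum]
  simp [mul_assoc]

lemma kernelForm_smul_right (F : κ → κ → ℂ) (z : ℂ) (c d : κ →₀ ℂ) :
    kernelForm F c (z • d) = z * kernelForm F c d := by
  rw [kernelForm, kernelForm, Finsupp.mul_sum]
  refine Finsupp.sum_congr fun i _ => ?_
  rw [Finsupp.sum_smul_index' (by simp), Finsupp.mul_sum]
  refine Finsupp.sum_congr fun j _ => ?_
  simp only [smul_eq_mul]
  ring

lemma kernelForm_polarization (F : κ → κ → ℂ) (c d : κ →₀ ℂ) :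
    4 * kernelForm F c d = kernelForm F (c + d) (c + d) - kernelForm F (c + (-1 : ℂ) • d)
      (c + (-1 : ℂ) • d) - Complex.I * kernelForm F (c + Complex.I • d) (c + Complex.I • d)
      + Complex.I * kernelForm F (c + (-Complex.I) • d) (c + (-Complex.I) • d) := by
  simp only [kernelForm_add_left, kernelForm_add_right, kernelForm_smul_left,
    kernelForm_smul_right, map_neg, map_one, Complex.conj_I]
  ring_nf
  simp
  ring

variable {b : κ → K} {F : κ → κ → ℂ} {M : ℝ}

/-- Polarisation bounds the form by `M * (‖β c‖ + ‖β d‖) ^ 2`. Replacing `c`, `d` by `s • c`, `s⁻¹ •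
d` with `s > 0` leaves the left side unchanged, and the best `s` turns the sum into a product at the
cost of the factor 4. No sign is assumed for `M`. -/
lemma norm_kernelForm_le
    (h : ∀ c, ‖kernelForm F c c‖ ≤ M * ‖Finsupp.linearCombination ℂ b c‖ ^ 2) (c d : κ →₀ ℂ) :
    ‖kernelForm F c d‖ ≤
      4 * M * (‖Finsupp.linearCombination ℂ b c‖ * ‖Finsupp.linearCombination ℂ b d‖) := by
  set β := Finsupp.linearCombination ℂ b
  have hM : ∀ c, 0 ≤ M * ‖β c‖ ^ 2 := fun c => (norm_nonneg _).trans (h c)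
  have key : ∀ c d, ‖kernelForm F c d‖ ≤ M * (‖β c‖ + ‖β d‖) ^ 2 := by
    intro c d
    -- A negative `M` forces every `β c` to vanish, and then the form vanishes by polarisation.
    rcases lt_or_ge M 0 with hM0 | hM0
    · have h0 : ∀ c, ‖β c‖ = 0 := fun c => by
        by_contra hc
        have := hM c
        nlinarith [(norm_nonneg (β c)).lt_of_ne (Ne.symm hc), sq_nonneg ‖β c‖,
          mul_pos ((norm_nonneg (β c)).lt_of_ne (Ne.symm hc))
            ((norm_nonneg (β c)).lt_of_ne (Ne.symm hc))]
      have hz : ∀ c, kernelForm F c c = 0 := fun c => by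
        have := h c
        rw [h0] at this
        simpa using this
      have h4 := kernelForm_polarization F c d
      simp only [hz, mul_zero, sub_zero, add_zero] at h4
      have : kernelForm F c d = 0 := by simpa using h4
      rw [this, h0, h0]
      simp
    · have hz : ∀ z : ℂ, ‖z‖ = 1 → ‖kernelForm F (c + z • d) (c + z • d)‖ ≤
          M * (‖β c‖ + ‖β d‖) ^ 2 := fun z hz => by
        refine (h _).trans ?_
        have : ‖β (c + z • d)‖ ≤ ‖β c‖ + ‖β d‖ := by
          rw [map_add, map_smul]
          refine (norm_add_le _ _).trans_eq ?_
          rw [norm_smul, hz, one_mul]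
        gcongr
      have h1 := hz 1 (by simp)
      rw [one_smul] at h1
      have h2 := hz (-1) (by simp)
      have h3 := hz Complex.I (by simp)
      have h4 := hz (-Complex.I) (by simp)
      have h5 : ‖4 * kernelForm F c d‖ ≤ 4 * (M * (‖β c‖ + ‖β d‖) ^ 2) := by
        rw [kernelForm_polarization]
        refine (norm_add_le _ _).trans ?_
        have h6 := norm_sub_le (kernelForm F (c + d) (c + d) -
          kernelForm F (c + (-1 : ℂ) • d) (c + (-1 : ℂ) • d))
          (Complex.I * kernelForm F (c + Complex.I • d) (c + Complex.I • d))
        have h7 := norm_sub_le (kernelForm F (c + d) (c + d))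
          (kernelForm F (c + (-1 : ℂ) • d) (c + (-1 : ℂ) • d))
        simp only [norm_mul, Complex.norm_I, one_mul] at h6 ⊢
        linarith
      rw [norm_mul] at h5
      norm_num at h5
      exact h5
  have hs : ∀ s : ℝ, 0 < s → ‖kernelForm F c d‖ ≤ M * (s * ‖β c‖ + s⁻¹ * ‖β d‖) ^ 2 := by
    intro s hs
    have := key ((s : ℂ) • c) ((s⁻¹ : ℂ) • d)
    have hs' : (s : ℂ) ≠ 0 := by exact_mod_cast hs.ne'
    rw [kernelForm_smul_left, kernelForm_smul_right, map_smul, map_smul, norm_smul, norm_smul,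
      Complex.conj_ofReal, ← mul_assoc, mul_inv_cancel₀ hs', one_mul] at this
    simpa [abs_of_pos hs] using this
  -- If one of the norms is zero there is no optimal `s`; the bound is made arbitrarily small by
  -- letting `s` tend to infinity or to zero.
  rcases (norm_nonneg (β c)).eq_or_lt with hc | hc
  · rw [← hc, zero_mul, mul_zero]
    refine le_of_forall_pos_le_add fun ε hε => ?_
    have hlim : Filter.Tendsto (fun s : ℝ => M * (s⁻¹ * ‖β d‖) ^ 2) Filter.atTop
        (nhds (M * (0 * ‖β d‖) ^ 2)) :=
      ((tendsto_inv_atTop_zero.mul_const _).pow 2).const_mul _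
    refine (ge_of_tendsto hlim ?_).trans (by simp [hε.le])
    filter_upwards [Filter.eventually_gt_atTop 0] with s h0
    have := hs s h0
    rwa [← hc, mul_zero, zero_add] at this
  rcases (norm_nonneg (β d)).eq_or_lt with hd | hd
  · rw [← hd, mul_zero, mul_zero]
    refine le_of_forall_pos_le_add fun ε hε => ?_
    have hlim : Filter.Tendsto (fun s : ℝ => M * (s⁻¹ * ‖β c‖) ^ 2) Filter.atTop
        (nhds (M * (0 * ‖β c‖) ^ 2)) :=
      ((tendsto_inv_atTop_zero.mul_const _).pow 2).const_mul _
    refine (ge_of_tendsto hlim ?_).trans (by simp [hε.le])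
    filter_upwards [Filter.eventually_gt_atTop 0] with s h0
    have := hs s⁻¹ (inv_pos.mpr h0)
    rwa [← hd, mul_zero, add_zero] at this
  -- This `s` makes the summands `s * ‖β c‖` and `s⁻¹ * ‖β d‖` equal.
  · have h1 := hs (Real.sqrt (‖β d‖ / ‖β c‖)) (Real.sqrt_pos.mpr (div_pos hd hc))
    refine h1.trans_eq ?_
    have h2 : Real.sqrt (‖β d‖ / ‖β c‖) ^ 2 = ‖β d‖ / ‖β c‖ := Real.sq_sqrt (div_pos hd hc).le
    have h3 : Real.sqrt (‖β d‖ / ‖β c‖) ≠ 0 := (Real.sqrt_pos.mpr (div_pos hd hc)).ne'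
    have : (Real.sqrt (‖β d‖ / ‖β c‖) * ‖β c‖ + (Real.sqrt (‖β d‖ / ‖β c‖))⁻¹ * ‖β d‖) ^ 2 =
        Real.sqrt (‖β d‖ / ‖β c‖) ^ 2 * ‖β c‖ ^ 2 + 2 * (‖β c‖ * ‖β d‖) +
          (Real.sqrt (‖β d‖ / ‖β c‖) ^ 2)⁻¹ * ‖β d‖ ^ 2 := by
      field_simp
      ring
    rw [this, h2]
    field_simp
    ring

/-- A scalar kernel whose quadratic form is bounded by the norm of the corresponding combination of
a total family is given by a bounded operator. -/
lemma exists_clm_of_kernel [CompleteSpace K]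
    (hb : (Submodule.span ℂ (Set.range b)).topologicalClosure = ⊤)
    (h : ∃ M : ℝ, ∀ c, ‖kernelForm F c c‖ ≤ M * ‖Finsupp.linearCombination ℂ b c‖ ^ 2) :
    ∃ Y : K →L[ℂ] K, ∀ i j, inner ℂ (b i) (Y (b j)) = F i j := by
  obtain ⟨M, hM⟩ := h
  have hd := denseRange_linearCombination hb
  set β := Finsupp.linearCombination ℂ b with hβ
  have hF := norm_kernelForm_le hM
  -- The form is conjugate linear in its first argument. Conjugation gives a linear functional,
  -- which extends to `K` and is represented by a vector (Riesz).
  let ℓ : (κ →₀ ℂ) → (κ →₀ ℂ) →ₗ[ℂ] ℂ := fun d =>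
    { toFun := fun c => (starRingEnd ℂ) (kernelForm F c d)
      map_add' := fun c c' => by rw [kernelForm_add_left, map_add]
      map_smul' := fun z c => by simp [kernelForm_smul_left] }
  have hℓ : ∀ d c, ‖ℓ d c‖ ≤ 4 * M * ‖β d‖ * ‖β c‖ := fun d c => by
    change ‖(starRingEnd ℂ) (kernelForm F c d)‖ ≤ _
    rw [RCLike.norm_conj]
    exact (hF c d).trans_eq (by ring)
  have hex : ∀ d, ∃ y : K, ∀ c, inner ℂ (β c) y = kernelForm F c d := fun d => by
    refine ⟨(InnerProductSpace.toDual ℂ K).symm ((ℓ d).extendOfNorm β), fun c => ?_⟩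
    rw [← inner_conj_symm, InnerProductSpace.toDual_symm_apply,
      LinearMap.extendOfNorm_eq hd ⟨_, hℓ d⟩]
    exact Complex.conj_conj _
  choose y hy using hex
  have hext : ∀ z w : K, (∀ c, inner ℂ (β c) z = inner ℂ (β c) w) → z = w := fun z w hzw =>
    eq_of_inner_total hb fun i => by simpa [hβ] using hzw (Finsupp.single i 1)
  let Y₀ : (κ →₀ ℂ) →ₗ[ℂ] K :=
    { toFun := y
      map_add' := fun d d' => hext _ _ fun c => by
        rw [inner_add_right, hy, hy, hy, kernelForm_add_right]
      map_smul' := fun z d => hext _ _ fun c => by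
        rw [RingHom.id_apply, inner_smul_right, hy, hy, kernelForm_smul_right] }
  have hY₀ : ∀ d, ‖Y₀ d‖ ≤ 4 * M * ‖β d‖ := fun d => by
    have hle : ∀ x : K, ‖inner ℂ x (y d)‖ ≤ 4 * M * ‖β d‖ * ‖x‖ := fun x =>
      hd.induction_on (p := fun x => ‖inner ℂ x (y d)‖ ≤ 4 * M * ‖β d‖ * ‖x‖) x
        (isClosed_le (by fun_prop) (by fun_prop)) fun c => by
          rw [hy]; exact (hF c d).trans_eq (by ring)
    -- Testing against `y d` itself turns the weak bound into a norm bound.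
    have h1 := hle (y d)
    rw [inner_self_eq_norm_sq_to_K] at h1
    have h2 : ‖y d‖ ^ 2 ≤ 4 * M * ‖β d‖ * ‖y d‖ := by simpa using h1
    rcases (norm_nonneg (y d)).eq_or_lt with h0 | h0
    · change ‖y d‖ ≤ _
      rw [← h0]
      have h3 := hM d
      rcases (norm_nonneg (β d)).eq_or_lt with h4 | h4
      · rw [← h4]; simp
      · have : 0 ≤ M := by
          by_contra hneg
          have := (norm_nonneg _).trans h3
          nlinarith [mul_pos h4 h4]
        positivity
    · change ‖y d‖ ≤ _
      nlinarith
  refine ⟨Y₀.extendOfNorm β, fun i j => ?_⟩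
  have h1 : ∀ i, b i = β (Finsupp.single i 1) := fun i => by simp [hβ]
  rw [h1 j, LinearMap.extendOfNorm_eq hd ⟨_, hY₀⟩, h1 i]
  refine (hy _ _).trans ?_
  simp [kernelForm]

end OpOfKernel

/-! ### Completely positive maps on concrete C*-algebras -/

section CP

variable {H K : Type*} [NormedAddCommGroup H] [InnerProductSpace ℂ H] [CompleteSpace H]
  [NormedAddCommGroup K] [InnerProductSpace ℂ K] [CompleteSpace K]
  {C : NonUnitalStarSubalgebra ℂ (H →L[ℂ] H)}

/-- A substitute for the missing identity: the compressions `e * a * e` recover `a`, while `e * e`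
stays in `C` and plays the role of `1`. The spectral order of `C` is needed only inside the proof;
what is kept is a filter, self-adjointness and the norm bound. -/
lemma exists_approximateUnit (hC : IsClosed (C : Set (H →L[ℂ] H))) :
    ∃ l : Filter C, l.NeBot ∧ (∀ᶠ e in l, star e = e ∧ ‖e‖ ≤ 1) ∧
      ∀ a : C, Filter.Tendsto (fun e : C => e * a * e) l (nhds a) := by
  let _ : NonUnitalCStarAlgebra C :=
    NonUnitalStarSubalgebra.nonUnitalCStarAlgebra C (h_closed := hC)
  let _ := CStarAlgebra.spectralOrder C
  have _ := CStarAlgebra.spectralOrderedRing C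
  have h := CStarAlgebra.increasingApproximateUnit C
  refine ⟨CStarAlgebra.approximateUnit C, h.neBot, ?_, fun a => ?_⟩
  · filter_upwards [h.eventually_star_eq, h.eventually_norm] with e h1 h2 using ⟨h1, h2⟩
  · have h1 := h.tendsto_mul_left a
    have h2 := h.tendsto_mul_right a
    rw [tendsto_iff_norm_sub_tendsto_zero] at h1 h2 ⊢
    refine squeeze_zero' (Filter.Eventually.of_forall fun _ => norm_nonneg _) ?_
      (by simpa using h1.add h2)
    filter_upwards [h.eventually_norm] with e he
    have : e * a * e - a = e * (a * e - a) + (e * a - a) := by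
      rw [mul_sub, mul_assoc]; abel
    rw [this]
    exact (norm_add_le _ _).trans (add_le_add_left
      ((norm_mul_le _ _).trans (mul_le_of_le_one_left (norm_nonneg _) he)) _)

/-- Elements positive in the spectral order of `C` have the form `star y * y`, so they are positive
as operators. Hence the decomposition into four positive parts, carried out inside `C`, can be used
with operator inequalities. -/
lemma clm_nonneg_of_nonneg (hC : IsClosed (C : Set (H →L[ℂ] H))) (a : C) :
    ∃ x : Fin 4 → C, (∀ i, 0 ≤ (x i : H →L[ℂ] H)) ∧ (∀ i, ‖x i‖ ≤ ‖a‖) ∧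
      a = ∑ i : Fin 4, Complex.I ^ (i : ℕ) • x i := by
  let _ : NonUnitalCStarAlgebra C :=
    NonUnitalStarSubalgebra.nonUnitalCStarAlgebra C (h_closed := hC)
  let _ := CStarAlgebra.spectralOrder C
  have _ := CStarAlgebra.spectralOrderedRing C
  obtain ⟨x, h1, h2, h3⟩ := CStarAlgebra.exists_sum_four_nonneg a
  refine ⟨x, fun i => ?_, h2, h3⟩
  obtain ⟨y, hy⟩ := CStarAlgebra.nonneg_iff_eq_star_mul_self.mp (h1 i)
  rw [hy]
  exact star_mul_self_nonneg (y : H →L[ℂ] H)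

lemma clm_le_one_of_norm_le_one {T : K →L[ℂ] K} (h : ‖T‖ ≤ 1) (h0 : 0 ≤ T) : T ≤ 1 :=
  (CStarAlgebra.norm_le_one_iff_of_nonneg T h0).mp h

/-- Each of the four positive parts becomes a positive contraction after division by `‖a‖`. The
constant 4 is crude and serves only to obtain continuity; the sharp bound comes from
`IsCPMap.norm_matOp_le`. -/
lemma norm_apply_le_four_mul (hC : IsClosed (C : Set (H →L[ℂ] H))) (φ : C →ₗ[ℂ] (K →L[ℂ] K))
    (h : ∀ a : C, 0 ≤ (a : H →L[ℂ] H) → (a : H →L[ℂ] H) ≤ 1 → 0 ≤ φ a ∧ φ a ≤ 1) (a : C) :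
    ‖φ a‖ ≤ 4 * ‖a‖ := by
  obtain ⟨x, h1, h2, h3⟩ := clm_nonneg_of_nonneg hC a
  rcases (norm_nonneg a).eq_or_lt with h0 | h0
  · rw [norm_eq_zero.mp h0.symm]; simp
  have hx : ∀ i, ‖φ (x i)‖ ≤ ‖a‖ := fun i => by
    have hs : (0 : ℂ) ≤ ((‖a‖⁻¹ : ℝ) : ℂ) := by
      exact Complex.zero_le_real.mpr (inv_nonneg.mpr h0.le)
    have hp : 0 ≤ (((‖a‖⁻¹ : ℝ) : ℂ) • x i : C).1 := smul_nonneg hs (h1 i)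
    have hn : ‖(((‖a‖⁻¹ : ℝ) : ℂ) • x i : C).1‖ ≤ 1 := by
      change ‖(((‖a‖⁻¹ : ℝ) : ℂ) • x i : C)‖ ≤ 1
      rw [norm_smul, Complex.norm_real, norm_inv, norm_norm, inv_mul_le_iff₀ h0, mul_one]
      exact h2 i
    obtain ⟨h4, h5⟩ := h _ hp (clm_le_one_of_norm_le_one hn hp)
    have h6 := (CStarAlgebra.norm_le_one_iff_of_nonneg _ h4).mpr h5
    rw [map_smul, norm_smul, Complex.norm_real, norm_inv, norm_norm, inv_mul_le_iff₀ h0,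
      mul_one] at h6
    exact h6
  conv_lhs => rw [h3, map_sum]
  refine (norm_sum_le _ _).trans ?_
  have : ∀ i ∈ (Finset.univ : Finset (Fin 4)), ‖φ (Complex.I ^ (i : ℕ) • x i)‖ ≤ ‖a‖ :=
    fun i _ => by
      rw [map_smul, norm_smul, norm_pow, Complex.norm_I, one_pow, one_mul]
      exact hx i
  exact (Finset.sum_le_sum this).trans_eq (by simp)

lemma matOp_smul {L : Type*} [NormedAddCommGroup L] [InnerProductSpace ℂ L] {n : ℕ} (z : ℂ)
    (B : Matrix (Fin n) (Fin n) (L →L[ℂ] L)) : matOp (z • B) = z • matOp B := by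
  ext u i
  simp [Finset.smul_sum]

/-- Complete positivity of a linear map from a concrete C*-algebra into `B(K)`. -/
def IsCPMap (φ : C →ₗ[ℂ] (K →L[ℂ] K)) : Prop :=
  ∀ (n : ℕ) (A : Fin n → Fin n → C), IsPosKernel (fun i j => (A i j : H →L[ℂ] H)) →
    IsPosKernel (fun i j => φ (A i j))

lemma IsCPMap.isPosKernel {φ : C →ₗ[ℂ] (K →L[ℂ] K)} (hφ : IsCPMap φ) {ι : Type*} [Fintype ι]
    {A : ι → ι → C} (hA : IsPosKernel (fun i j => (A i j : H →L[ℂ] H))) :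
    IsPosKernel (fun i j => φ (A i j)) := by
  have e := Fintype.equivFin ι
  have h := (hφ _ _ (hA.comp e.symm)).comp e
  simpa using h

lemma IsCPMap.map_nonneg {φ : C →ₗ[ℂ] (K →L[ℂ] K)} (hφ : IsCPMap φ) {a : C}
    (ha : 0 ≤ (a : H →L[ℂ] H)) : 0 ≤ φ a :=
  (isPosKernel_unit _).mp (hφ.isPosKernel (A := fun _ _ : Unit => a) ((isPosKernel_unit _).mpr ha))

/-- Positive elements have self-adjoint images, and they span `C`. -/
lemma IsCPMap.map_star (hC : IsClosed (C : Set (H →L[ℂ] H))) {φ : C →ₗ[ℂ] (K →L[ℂ] K)}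
    (hφ : IsCPMap φ) (a : C) : φ (star a) = star (φ a) := by
  obtain ⟨x, h1, -, h3⟩ := clm_nonneg_of_nonneg hC a
  have hx : ∀ i, star (x i) = x i := fun i => Subtype.ext (IsSelfAdjoint.of_nonneg (h1 i)).star_eq
  have hy : ∀ i, star (φ (x i)) = φ (x i) := fun i =>
    (IsSelfAdjoint.of_nonneg (hφ.map_nonneg (h1 i))).star_eq
  rw [h3]
  simp only [star_sum, star_smul, map_sum, map_smul, hx, hy]

lemma inner_mul_self_mul {e : C} (he : star e = e) (B : H →L[ℂ] H) (u w : H) :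
    inner ℂ u (((e : H →L[ℂ] H) * B * (e : H →L[ℂ] H)) w) =
      inner ℂ ((e : H →L[ℂ] H) u) (B ((e : H →L[ℂ] H) w)) := by
  have h1 : star (e : H →L[ℂ] H) = (e : H →L[ℂ] H) := congrArg Subtype.val he
  conv_rhs => rw [← h1]
  rw [ContinuousLinearMap.star_eq_adjoint, ContinuousLinearMap.adjoint_inner_left,
    ← ContinuousLinearMap.star_eq_adjoint, h1]
  rfl

/-- The kernel is the compression by `e` of the block matrix with rows `(1, A)` and `(A*, 1)`, which
is positive because `A` is a contraction; after compression all entries lie in `C`, the diagonal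
ones being `e * e`. Concretely the form is `‖x‖² + ‖y‖² + 2 Re ⟪x, A y⟫`, which is at least `(‖x‖ -
‖y‖)²`. -/
lemma isPosKernel_block {e : C} (he : star e = e) {n : ℕ} (A : Matrix (Fin n) (Fin n) C)
    (hA : ‖matOp (coeMat A)‖ ≤ 1) :
    IsPosKernel (fun p q => (Sum.elim (fun i => Sum.elim (fun j => if i = j then e * e else 0)
      (fun j => e * A i j * e)) (fun i => Sum.elim (fun j => e * star (A j i) * e)
        (fun j => if i = j then e * e else 0)) p q : C).1) := by
  intro u
  have hee : ∀ z w : H, inner ℂ z ((e * e : C).1 w) = inner ℂ (e.1 z) (e.1 w) := fun z w => by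
    have := inner_mul_self_mul he 1 z w
    simpa using this
  set x : PiLp 2 (fun _ : Fin n => H) := WithLp.toLp 2 fun i => e.1 (u (Sum.inl i)) with hx
  set y : PiLp 2 (fun _ : Fin n => H) := WithLp.toLp 2 fun i => e.1 (u (Sum.inr i)) with hy
  set Z := matOp (coeMat A)
  have hZ : ∀ i j, inner ℂ (u (Sum.inl i)) ((e * A i j * e : C).1 (u (Sum.inr j))) =
      inner ℂ (x i) ((A i j).1 (y j)) := fun i j => inner_mul_self_mul he _ _ _
  have hZ' : ∀ i j, inner ℂ (u (Sum.inr i)) ((e * star (A j i) * e : C).1 (u (Sum.inl j))) =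
      (starRingEnd ℂ) (inner ℂ (x j) ((A j i).1 (y i))) := fun i j => by
    rw [inner_conj_symm, ← ContinuousLinearMap.adjoint_inner_right]
    exact inner_mul_self_mul he _ _ _
  have h1 : inner ℂ x (Z y) = ∑ i, ∑ j, inner ℂ (x i) ((A i j).1 (y j)) := inner_matOp _ _ _
  have hsum : (∑ p, ∑ q, inner ℂ (u p) ((Sum.elim (fun i => Sum.elim (fun j =>
      if i = j then e * e else 0) (fun j => e * A i j * e)) (fun i => Sum.elim
      (fun j => e * star (A j i) * e) (fun j => if i = j then e * e else 0)) p q : C).1 (u q)))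
      = inner ℂ x x + inner ℂ y y + (inner ℂ x (Z y) + (starRingEnd ℂ) (inner ℂ x (Z y))) := by
    have hd : ∀ i j : Fin n, ∀ z w : H, inner ℂ z ((if i = j then e * e else 0 : C).1 w) =
        if i = j then inner ℂ (e.1 z) (e.1 w) else 0 := fun i j z w => by
      split_ifs
      · exact hee z w
      · simp
    simp only [Fintype.sum_sum_type, Sum.elim_inl, Sum.elim_inr, hZ, hZ', hd]
    rw [h1, map_sum]
    simp only [map_sum, Finset.sum_ite_eq, Finset.mem_univ, if_true, Finset.sum_add_distrib,
      PiLp.inner_apply]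
    rw [Finset.sum_comm (f := fun i j => (starRingEnd ℂ) (inner ℂ (x j) ((A j i).1 (y i))))]
    simp only [hx, hy]
    ring
  rw [hsum, Complex.add_conj, inner_self_eq_norm_sq_to_K, inner_self_eq_norm_sq_to_K]
  have h2 : -(‖x‖ * ‖y‖) ≤ (inner ℂ x (Z y)).re := by
    refine neg_le_of_abs_le ((Complex.abs_re_le_norm _).trans ((norm_inner_le_norm _ _).trans ?_))
    gcongr
    exact (Z.le_opNorm y).trans (mul_le_of_le_one_left (norm_nonneg _) hA)
  have h3 : 0 ≤ ‖x‖ ^ 2 + ‖y‖ ^ 2 + 2 * (inner ℂ x (Z y)).re := by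
    nlinarith [sq_nonneg (‖x‖ - ‖y‖)]
  simpa using Complex.zero_le_real.mpr h3

/-- A completely positive map that is contractive on squares of self-adjoint contractions is
completely contractive. -/
lemma IsCPMap.norm_matOp_le (hC : IsClosed (C : Set (H →L[ℂ] H))) {φ : C →ₗ[ℂ] (K →L[ℂ] K)}
    (hφ : IsCPMap φ) (hc : Continuous φ)
    (h1 : ∀ e : C, star e = e → ‖e‖ ≤ 1 → φ (e * e) ≤ 1) {n : ℕ}
    (A : Matrix (Fin n) (Fin n) C) :
    ‖matOp (A.map fun a => φ a)‖ ≤ ‖matOp (coeMat A)‖ := by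
  obtain ⟨l, hl, hl1, hl2⟩ := exists_approximateUnit hC
  have key : ∀ A : Matrix (Fin n) (Fin n) C, ‖matOp (coeMat A)‖ ≤ 1 →
      ‖matOp (A.map fun a => φ a)‖ ≤ 1 := by
    intro A hA
    set Φ := matOp (A.map fun a => φ a) with hΦ
    -- The image of the block matrix is positive at the vector `(x, y)`. Its diagonal entries `φ (e
    -- * e)` are at most `1`, and along the approximate unit its off-diagonal part converges to `Φ`
    -- and its adjoint.
    have main : ∀ x y : PiLp 2 (fun _ : Fin n => K),
        -(2 * (inner ℂ x (Φ y)).re) ≤ ‖x‖ ^ 2 + ‖y‖ ^ 2 := by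
      intro x y
      have hlim : Filter.Tendsto (fun e : C => -(2 * (∑ i, ∑ j,
          inner ℂ (x i) (φ (e * A i j * e) (y j))).re)) l
          (nhds (-(2 * (inner ℂ x (Φ y)).re))) := by
        rw [hΦ, inner_matOp]
        refine ((Complex.continuous_re.tendsto _).comp ?_).const_mul 2 |>.neg
        refine tendsto_finsetSum _ fun i _ => tendsto_finsetSum _ fun j _ => ?_
        have h3 : Filter.Tendsto (fun e : C => φ (e * A i j * e)) l (nhds (φ (A i j))) :=
          (hc.tendsto _).comp (hl2 _)
        exact tendsto_const_nhds.inner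
          (((ContinuousLinearMap.apply ℂ K (y j)).continuous.tendsto _).comp h3)
      refine le_of_tendsto hlim ?_
      filter_upwards [hl1] with e he
      have hp := hφ.isPosKernel (isPosKernel_block he.1 A hA)
        (Sum.elim (fun i => x i) (fun i => y i))
      have hx : ∀ z : PiLp 2 (fun _ : Fin n => K),
          (∑ i, inner ℂ (z i) (φ (e * e) (z i))).re ≤ ‖z‖ ^ 2 := fun z => by
        rw [PiLp.norm_sq_eq_of_L2, Complex.re_sum]
        refine Finset.sum_le_sum fun i _ => ?_
        have h4 := h1 e he.1 he.2
        rw [ContinuousLinearMap.le_def, ← ContinuousLinearMap.nonneg_iff_isPositive,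
          ContinuousLinearMap.nonneg_iff_inner] at h4
        have h5 := h4 (z i)
        simp only [sub_apply, one_apply_eq_self, inner_sub_right,
          inner_self_eq_norm_sq_to_K] at h5
        have h6 := (Complex.nonneg_iff.mp h5).1
        rw [Complex.sub_re] at h6
        have h7 : ((‖z i‖ : ℂ) ^ 2).re = ‖z i‖ ^ 2 := by
          rw [← Complex.ofReal_pow, Complex.ofReal_re]
        erw [h7] at h6
        linarith
      have hconj : ∑ i, ∑ j, inner ℂ (y i) (φ (e * star (A j i) * e) (x j)) =
          (starRingEnd ℂ) (∑ i, ∑ j, inner ℂ (x i) (φ (e * A i j * e) (y j))) := by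
        rw [Finset.sum_comm, map_sum]
        refine Finset.sum_congr rfl fun i _ => ?_
        rw [map_sum]
        refine Finset.sum_congr rfl fun j _ => ?_
        have : e * star (A i j) * e = star (e * A i j * e) := by
          rw [star_mul, star_mul, he.1, mul_assoc]
        rw [this, hφ.map_star hC, ContinuousLinearMap.star_eq_adjoint,
          ContinuousLinearMap.adjoint_inner_right, inner_conj_symm]
      have hd : ∀ i j : Fin n, ∀ z w : K, inner ℂ z (φ (if i = j then e * e else 0 : C) w) =
          if i = j then inner ℂ z (φ (e * e) w) else 0 := fun i j z w => by
        split_ifs <;> simp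
      simp only [Fintype.sum_sum_type, Sum.elim_inl, Sum.elim_inr, hd, Finset.sum_ite_eq,
        Finset.mem_univ, if_true, Finset.sum_add_distrib, hconj] at hp
      have h8 := (Complex.nonneg_iff.mp hp).1
      have h9 := hx x
      have h10 := hx y
      simp only [Complex.add_re, Complex.conj_re] at h8
      linarith
    refine ContinuousLinearMap.opNorm_le_bound _ zero_le_one fun y => ?_
    -- The choice `x = -Φ y` gives `2 ‖Φ y‖² ≤ ‖Φ y‖² + ‖y‖²`.
    have h3 := main (-(Φ y)) y
    rw [inner_neg_left, inner_self_eq_norm_sq_to_K, norm_neg, Complex.neg_re] at h3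
    have h7 : ((‖Φ y‖ : ℂ) ^ 2).re = ‖Φ y‖ ^ 2 := by
      rw [← Complex.ofReal_pow, Complex.ofReal_re]
    erw [h7] at h3
    rw [one_mul]
    exact le_of_sq_le_sq (by linarith) (norm_nonneg _)
  -- Scaling by any `s` above the norm, rather than by the norm itself, also covers norm zero.
  refine le_of_forall_gt_imp_ge_of_dense fun s hs => ?_
  have hs0 : 0 < s := (norm_nonneg _).trans_lt hs
  have h2 := key (((s⁻¹ : ℝ) : ℂ) • A) (by
    have : coeMat (((s⁻¹ : ℝ) : ℂ) • A) = ((s⁻¹ : ℝ) : ℂ) • coeMat A := rfl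
    rw [this, matOp_smul, norm_smul, Complex.norm_real, norm_inv, Real.norm_of_nonneg hs0.le,
      inv_mul_le_iff₀ hs0, mul_one]
    exact hs.le)
  have h3 : (((s⁻¹ : ℝ) : ℂ) • A).map (fun a => φ a) =
      ((s⁻¹ : ℝ) : ℂ) • A.map (fun a => φ a) := by
    ext1 i j
    simp
  rw [h3, matOp_smul, norm_smul, Complex.norm_real, norm_inv, Real.norm_of_nonneg hs0.le,
    inv_mul_le_iff₀ hs0, mul_one] at h2
  exact h2

end CP

/-! ### Scalar upper bounds under completely positive maps -/

section CPBound

variable {H K : Type*} [NormedAddCommGroup H] [InnerProductSpace ℂ H] [CompleteSpace H]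
  [NormedAddCommGroup K] [InnerProductSpace ℂ K]
  {C : NonUnitalStarSubalgebra ℂ (H →L[ℂ] H)} {ι : Type*} [Fintype ι]

lemma isPosKernel_const {T : K →L[ℂ] K} (hT : 0 ≤ T) : IsPosKernel (fun _ _ : ι => T) :=
  ((isPosKernel_unit T).mpr hT).comp fun _ => ()

lemma isPosKernel_of_tendsto {α : Type*} {l : Filter α} [l.NeBot] {A : α → ι → ι → K →L[ℂ] K}
    {B : ι → ι → K →L[ℂ] K} (h : ∀ i j, Filter.Tendsto (fun e => A e i j) l (nhds (B i j)))
    (hA : ∀ᶠ e in l, IsPosKernel (A e)) : IsPosKernel B := by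
  intro u
  refine ge_of_tendsto (f := fun e => ∑ i, ∑ j, inner ℂ (u i) (A e i j (u j))) ?_
    (hA.mono fun e he => he u)
  refine tendsto_finsetSum _ fun i _ => tendsto_finsetSum _ fun j _ => ?_
  exact tendsto_const_nhds.inner
    (((ContinuousLinearMap.apply ℂ K (u j)).continuous.tendsto _).comp (h i j))

variable [CompleteSpace K]

/-- A completely positive map that is contractive on squares of self-adjoint contractions
preserves upper bounds of the form `I ⊗ lam`. -/
lemma IsCPMap.isPosKernel_sub (hC : IsClosed (C : Set (H →L[ℂ] H))) {φ : C →ₗ[ℂ] (K →L[ℂ] K)}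
    (hφ : IsCPMap φ) (hc : Continuous φ)
    (h1 : ∀ e : C, star e = e → ‖e‖ ≤ 1 → φ (e * e) ≤ 1) {lam : Matrix ι ι ℂ}
    (hlam : lam.PosSemidef) {A : ι → ι → C}
    (hA : IsPosKernel (fun i j => lam i j • (1 : H →L[ℂ] H) - (A i j : H →L[ℂ] H))) :
    IsPosKernel (fun i j => lam i j • (1 : K →L[ℂ] K) - φ (A i j)) := by
  obtain ⟨l, hl, hl1, hl2⟩ := exists_approximateUnit hC
  refine isPosKernel_of_tendsto (l := l)
    (A := fun e i j => lam i j • (1 : K →L[ℂ] K) - φ (e * A i j * e))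
    (fun i j => ((hc.tendsto _).comp (hl2 _)).const_sub _) ?_
  filter_upwards [hl1] with e he
  -- The entries of `lam ⊗ 1 - A` need not lie in `C`; those of its compression by `e` do, so `φ`
  -- can be applied.
  have h2 : IsPosKernel (fun i j => ((lam i j • (e * e) - e * A i j * e : C) : H →L[ℂ] H)) := by
    intro u
    refine (hA fun i => (e : H →L[ℂ] H) (u i)).trans_eq ?_
    refine Finset.sum_congr rfl fun i _ => Finset.sum_congr rfl fun j _ => ?_
    rw [← inner_mul_self_mul he.1]
    congr 2
    simp [mul_sub, sub_mul]
  have h3 := hφ.isPosKernel h2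
  -- The loss from having `φ (e * e)` in place of `1` is `lam ⊗ (1 - φ (e * e))`, the Schur product
  -- of `lam` with a positive constant kernel. Added to `h3` it gives `lam ⊗ 1 - φ (e A e)`.
  have h4 : IsPosKernel (fun i j : ι => lam i j • (1 - φ (e * e))) :=
    (isPosKernel_const (ι := ι) (T := 1 - φ (e * e)) (by
      rw [ContinuousLinearMap.nonneg_iff_isPositive]
      exact h1 e he.1 he.2)).schur hlam
  convert h3.add h4 using 3 with i j
  rw [map_sub, map_smul, smul_sub]
  abel

end CPBound

/-! ### Inner products of coherent vectors -/

section Coherent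

variable {h : Type u} [NormedAddCommGroup h] [InnerProductSpace ℂ h]

lemma inner_cohVec (f g : h) : inner ℂ (cohVec f) (cohVec g) =
    Complex.exp (-((1 / 2) * ((‖f‖ : ℂ) ^ 2 + (‖g‖ : ℂ) ^ 2) - inner ℂ f g)) := by
  rw [cohVec, cohVec, inner_smul_left, inner_smul_right, inner_expVec, Complex.conj_ofReal,
    Complex.ofReal_exp, Complex.ofReal_exp, ← Complex.exp_add, ← Complex.exp_add]
  congr 1
  push_cast
  ring

lemma norm_cohVec (f : h) : ‖cohVec f‖ = 1 := by
  have h1 := inner_cohVec f f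
  rw [inner_self_eq_norm_sq_to_K, inner_self_eq_norm_sq_to_K] at h1
  have h2 : ((‖cohVec f‖ : ℂ)) ^ 2 = 1 := by
    refine h1.trans ?_
    rw [Complex.exp_eq_one_iff]
    refine ⟨0, ?_⟩
    simp
    ring
  have h3 : ‖cohVec f‖ ^ 2 = 1 := by exact_mod_cast h2
  exact (pow_eq_one_iff_of_nonneg (norm_nonneg _) two_ne_zero).mp h3

lemma span_range_cohVec {ι : Type*} (f : ι → h) :
    Submodule.span ℂ (Set.range fun i => cohVec (f i)) =
      Submodule.span ℂ (Set.range fun i => expVec (f i)) := by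
  refine le_antisymm (Submodule.span_le.mpr ?_) (Submodule.span_le.mpr ?_)
  · rintro _ ⟨i, rfl⟩
    exact Submodule.smul_mem _ _ (Submodule.subset_span ⟨i, rfl⟩)
  · rintro _ ⟨i, rfl⟩
    have : expVec (f i) = ((Real.exp (-(1 / 2) * ‖f i‖ ^ 2) : ℂ))⁻¹ • cohVec (f i) := by
      rw [cohVec, inv_smul_smul₀]
      exact_mod_cast (Real.exp_pos _).ne'
    simp only [this]
    exact Submodule.smul_mem _ _ (Submodule.subset_span ⟨i, rfl⟩)

variable {k : Type u} [NormedAddCommGroup k] [InnerProductSpace ℂ k]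

lemma inner_constOn (t : ℝ≥0) (x y : k) :
    inner ℂ (constOn t x) (constOn t y) = (t : ℂ) * inner ℂ x y := by
  have h1 : (volume.restrict (Set.Ici (0 : ℝ))) (Set.Ico (0 : ℝ) t) = t := by
    rw [Measure.restrict_apply measurableSet_Ico,
      Set.inter_eq_left.mpr (Ico_subset_Ici t)]
    simp
  rw [constOn, constOn, L2.inner_def]
  have : (fun s => inner ℂ ((indicatorConstLp 2 (μ := volume.restrict (Set.Ici (0:ℝ)))
      (s := Set.Ico (0 : ℝ) t) measurableSet_Ico
      (ne_top_of_le_ne_top (by simp) (Measure.restrict_apply_le _ _)) x : NoiseL2 k (Set.Ici 0)) s)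
      ((indicatorConstLp 2 (μ := volume.restrict (Set.Ici (0:ℝ)))
      (s := Set.Ico (0 : ℝ) t) measurableSet_Ico
      (ne_top_of_le_ne_top (by simp) (Measure.restrict_apply_le _ _)) y : NoiseL2 k (Set.Ici 0)) s))
      =ᵐ[volume.restrict (Set.Ici 0)] (Set.Ico (0 : ℝ) t).indicator fun _ => inner ℂ x y := by
    filter_upwards [indicatorConstLp_coeFn (p := 2) (μ := volume.restrict (Set.Ici (0:ℝ)))
      (hs := measurableSet_Ico (a := (0 : ℝ)) (b := t))
      (hμs := ne_top_of_le_ne_top (by simp) (Measure.restrict_apply_le _ _)) (c := x),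
      indicatorConstLp_coeFn (p := 2) (μ := volume.restrict (Set.Ici (0:ℝ)))
      (hs := measurableSet_Ico (a := (0 : ℝ)) (b := t))
      (hμs := ne_top_of_le_ne_top (by simp) (Measure.restrict_apply_le _ _)) (c := y)] with s h2 h3
    rw [h2, h3]
    by_cases hs : s ∈ Set.Ico (0 : ℝ) t <;> simp [hs]
  rw [integral_congr_ae this, integral_indicator measurableSet_Ico, setIntegral_const,
    Measure.real, h1]
  simp

lemma inner_cohVec_constOn (t : ℝ≥0) (x y : k) :
    inner ℂ (cohVec (constOn t x)) (cohVec (constOn t y)) =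
      Complex.exp (-(t : ℂ) * chiForm x y) := by
  have hn : ∀ x : k, ((‖constOn t x‖ : ℂ)) ^ 2 = t * (‖x‖ : ℂ) ^ 2 := fun x => by
    have := inner_constOn t x x
    rwa [inner_self_eq_norm_sq_to_K, inner_self_eq_norm_sq_to_K] at this
  rw [inner_cohVec, hn, hn, inner_constOn, chiForm]
  congr 1
  ring

end Coherent

/-! ### Slices by coherent vectors and necessity of the order condition -/

section Slices

variable {H : Type v} [NormedAddCommGroup H] [InnerProductSpace ℂ H] [CompleteSpace H]
  {C : NonUnitalStarSubalgebra ℂ (H →L[ℂ] H)} {ι : Type*} [Fintype ι]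
  {K : Type*} [NormedAddCommGroup K] [InnerProductSpace ℂ K]

lemma IsPosKernel.slice {A : ι → ι → HTensor H K →L[ℂ] HTensor H K} (hA : IsPosKernel A)
    (c : ι → K) : IsPosKernel (fun i j => slice (c i) (c j) (A i j)) := fun u => by
  simpa only [inner_slice] using hA fun i => htmul (u i) (c i)

lemma slice_sub (x y : K) (S T : HTensor H K →L[ℂ] HTensor H K) :
    slice x y (S - T) = slice x y S - slice x y T := by
  simp [_root_.slice, ContinuousLinearMap.comp_sub, ContinuousLinearMap.sub_comp]

lemma slice_smul_one (x y : K) (z : ℂ) :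
    slice x y (z • (1 : HTensor H K →L[ℂ] HTensor H K)) = (z * inner ℂ x y) • (1 : H →L[ℂ] H) := by
  refine ContinuousLinearMap.ext fun w => ext_inner_left ℂ fun u => ?_
  rw [inner_slice]
  simp only [smul_apply, one_apply_eq_self, inner_smul_right, inner_htmul]
  ring

variable {k : Type u} [NormedAddCommGroup k] [InnerProductSpace ℂ k]

/-- The linear map into `B(H ⊗ K)` underlying a map into `C ⊗_M B(K)`. -/
noncomputable def toOpMap (φ : C →L[ℂ] matrixSpace C K) :
    C →ₗ[ℂ] (HTensor H K →L[ℂ] HTensor H K) :=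
  (matrixSpace C K).subtype ∘ₗ φ.toLinearMap

lemma continuous_toOpMap (φ : C →L[ℂ] matrixSpace C K) : Continuous (toOpMap φ) :=
  continuous_subtype_val.comp φ.continuous

lemma isCPMap_toOpMap_iff (φ : C →L[ℂ] matrixSpace C K) :
    IsCPMap (toOpMap φ) ↔ IsCompletelyPositive φ := by
  refine forall_congr' fun n => ⟨fun h A hA => ?_, fun h A hA => ?_⟩
  · exact (matOp_nonneg_iff _).mpr (h A ((matOp_nonneg_iff _).mp hA))
  · exact (matOp_nonneg_iff _).mp (h A ((matOp_nonneg_iff _).mpr hA))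

lemma mem_orderInterval_iff {n : ℕ} {lam : Matrix (Fin n) (Fin n) ℂ}
    {A : Matrix (Fin n) (Fin n) C} : A ∈ orderInterval C (idTensor H lam) ↔
      IsPosKernel (fun i j => (A i j : H →L[ℂ] H)) ∧
      IsPosKernel (fun i j => lam i j • (1 : H →L[ℂ] H) - (A i j : H →L[ℂ] H)) := by
  rw [orderInterval, Set.mem_ofPred_eq, matOp_nonneg_iff, matOp_le_iff]
  rfl

/-- The associated semigroups of a completely positive contraction cocycle map the order interval
`[0, I ⊗ lam]` into `[0, I ⊗ (lam ∘ ϖ_t)]`. -/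
theorem mapsTo_orderInterval_assocSemigroup (hC : IsClosed (C : Set (H →L[ℂ] H)))
    {j : ℝ≥0 → C →L[ℂ] matrixSpace C (Fock k)} (hcp : ∀ t, IsCompletelyPositive (j t))
    (hn : ∀ t, ‖j t‖ ≤ 1) {n : ℕ} (x : Fin n → k) {lam : Matrix (Fin n) (Fin n) ℂ}
    (hlam : lam.PosSemidef) (t : ℝ≥0) {A : Matrix (Fin n) (Fin n) C}
    (hA : A ∈ orderInterval C (idTensor H lam)) :
    (Matrix.of fun p q => assocSemigroup j (x p) (x q) t (A p q)) ∈
      orderInterval C (idTensor H (lam.hadamard (gramMat x t))) := by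
  rw [mem_orderInterval_iff] at hA ⊢
  have hφ := (isCPMap_toOpMap_iff (j t)).mpr (hcp t)
  have h1 : ∀ e : C, star e = e → ‖e‖ ≤ 1 → toOpMap (j t) (e * e) ≤ 1 := fun e he hn' => by
    refine clm_le_one_of_norm_le_one ?_ (hφ.map_nonneg ?_)
    · refine ((j t).le_opNorm _).trans (mul_le_one₀ (hn t) (norm_nonneg _) ?_)
      exact (norm_mul_le _ _).trans (mul_le_one₀ hn' (norm_nonneg _) hn')
    · nth_rewrite 1 [← he]
      exact star_mul_self_nonneg (e : H →L[ℂ] H)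
  refine ⟨(hφ.isPosKernel hA.1).slice fun p => cohVec (constOn t (x p)), ?_⟩
  -- Slicing `lam ⊗ 1` by coherent vectors multiplies its entries by their inner products, which are
  -- the entries of the Gram matrix.
  have h2 := (hφ.isPosKernel_sub hC (continuous_toOpMap _) h1 hlam hA.2).slice
    fun p => cohVec (constOn t (x p))
  simp only [slice_sub, slice_smul_one, inner_cohVec_constOn] at h2
  exact h2

end Slices

/-! ### Step functions on the half line -/

section StepFunctions

variable {α β γ : Type*}

/-- `f` is constant on each of the consecutive half-open intervals, starting at `0`, whose lengths
are listed in `D`. -/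
def AdaptedTo : List ℝ≥0 → (ℝ≥0 → α) → Prop
  | [], _ => True
  | d :: D, f => (∀ s < d, f s = f 0) ∧ AdaptedTo D fun s => f (s + d)

lemma AdaptedTo.map {D : List ℝ≥0} {f : ℝ≥0 → α} (h : AdaptedTo D f) (F : α → β) :
    AdaptedTo D fun s => F (f s) := by
  induction D generalizing f with
  | nil => trivial
  | cons d D ih => exact ⟨fun s hs => congrArg F (h.1 s hs), ih h.2⟩

lemma AdaptedTo.prodMk {D : List ℝ≥0} {f : ℝ≥0 → α} {g : ℝ≥0 → β} (hf : AdaptedTo D f)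
    (hg : AdaptedTo D g) : AdaptedTo D fun s => (f s, g s) := by
  induction D generalizing f g with
  | nil => trivial
  | cons d D ih => exact ⟨fun s hs => Prod.ext (hf.1 s hs) (hg.1 s hs), ih hf.2 hg.2⟩

lemma adaptedTo_pi {ι : Type*} {D : List ℝ≥0} {f : ι → ℝ≥0 → α} :
    (AdaptedTo D fun s i => f i s) ↔ ∀ i, AdaptedTo D (f i) := by
  induction D generalizing f with
  | nil => exact ⟨fun _ _ => trivial, fun _ => trivial⟩
  | cons d D ih =>
    refine ⟨fun h i => ⟨fun s hs => congrFun (h.1 s hs) i, ih.mp h.2 i⟩,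
      fun h => ⟨fun s hs => funext fun i => (h i).1 s hs, ih.mpr fun i => (h i).2⟩⟩

/-- Intervals of length zero impose no condition, so zero durations are harmless throughout. -/
lemma adaptedTo_of_sum_eq_zero {D : List ℝ≥0} (hD : D.sum = 0) (f : ℝ≥0 → α) : AdaptedTo D f := by
  induction D generalizing f with
  | nil => trivial
  | cons d D ih =>
    rw [List.sum_cons, add_eq_zero] at hD
    exact ⟨fun s hs => absurd (hD.1 ▸ hs) not_lt_zero, ih hD.2 _⟩

lemma AdaptedTo.append {D D' : List ℝ≥0} {f : ℝ≥0 → α} (h : AdaptedTo D f)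
    (h' : AdaptedTo D' fun s => f (s + D.sum)) : AdaptedTo (D ++ D') f := by
  induction D generalizing f with
  | nil => simpa using h'
  | cons d D ih =>
    refine ⟨h.1, ih h.2 ?_⟩
    simpa [add_assoc, add_comm d] using h'

lemma AdaptedTo.congr {D : List ℝ≥0} {f g : ℝ≥0 → α} (h : AdaptedTo D f)
    (hfg : ∀ s < D.sum, f s = g s) : AdaptedTo D g := by
  induction D generalizing f g with
  | nil => trivial
  | cons d D ih =>
    rw [List.sum_cons] at hfg
    refine ⟨fun s hs => ?_, ih h.2 fun s hs => hfg _ (by rw [add_comm d]; gcongr)⟩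
    have h0 : 0 < d + D.sum := (pos_of_gt hs).trans_le le_self_add
    rw [← hfg s (hs.trans_le le_self_add), ← hfg 0 h0, h.1 s hs]

lemma AdaptedTo.split {d e : ℝ≥0} {D : List ℝ≥0} {f : ℝ≥0 → α} (hde : d ≤ e)
    (h : AdaptedTo (e :: D) f) : AdaptedTo ((e - d) :: D) fun s => f (s + d) := by
  refine ⟨fun s hs => ?_, ?_⟩
  · have h1 : s + d < e := lt_tsub_iff_right.mp hs
    beta_reduce
    rw [h.1 _ h1, zero_add, h.1 d (lt_of_le_of_lt le_add_self h1)]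
  · simpa [add_assoc, tsub_add_cancel_of_le hde] using h.2

lemma AdaptedTo.cons_of_le {d e : ℝ≥0} {D D' : List ℝ≥0} {f : ℝ≥0 → α} (hde : d ≤ e)
    (h : AdaptedTo (e :: D) f) (h' : AdaptedTo D' fun s => f (s + d)) : AdaptedTo (d :: D') f :=
  ⟨fun s hs => h.1 s (hs.trans_le hde), h'⟩

/-- Of the two first intervals, the longer is cut where the shorter ends. One interval is then
common to both lists, and removing it lowers the total number of durations by one, although the
remainder of the cut (possibly of length zero) is kept. -/
lemma exists_common_adaptedTo {f : ℝ≥0 → α} {g : ℝ≥0 → β} {D D' : List ℝ≥0}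
    (hf : AdaptedTo D f) (hg : AdaptedTo D' g) (hs : D.sum = D'.sum) :
    ∃ D'' : List ℝ≥0, D''.sum = D.sum ∧ AdaptedTo D'' f ∧ AdaptedTo D'' g := by
  induction hn : D.length + D'.length using Nat.strong_induction_on generalizing D D' f g with
  | _ n ih =>
  match D, D' with
  | [], D' => exact ⟨D', hs.symm, adaptedTo_of_sum_eq_zero hs.symm f, hg⟩
  | D, [] => exact ⟨D, rfl, hf, adaptedTo_of_sum_eq_zero hs g⟩
  | d :: D, d' :: D' =>
    simp only [List.sum_cons] at hs ⊢
    rcases le_total d d' with h | h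
    · obtain ⟨E, hE, h1, h2⟩ := ih (D.length + ((d' - d) :: D').length)
        (by simp at hn ⊢; omega) hf.2 (hg.split h) (by
          rw [List.sum_cons]
          refine add_left_cancel (a := d) ?_
          rw [hs, ← add_assoc, add_tsub_cancel_of_le h]) rfl
      exact ⟨d :: E, by simp [hE], ⟨hf.1, h1⟩, hg.cons_of_le h h2⟩
    · obtain ⟨E, hE, h1, h2⟩ := ih (((d - d') :: D).length + D'.length)
        (by simp at hn ⊢; omega) (hf.split h) hg.2 (by
          rw [List.sum_cons]
          refine add_left_cancel (a := d') ?_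
          rw [← hs, ← add_assoc, add_tsub_cancel_of_le h]) rfl
      refine ⟨d' :: E, ?_, hf.cons_of_le h h1, ⟨hg.1, h2⟩⟩
      rw [List.sum_cons, hE, List.sum_cons, ← add_assoc, add_tsub_cancel_of_le h]

/-- `f` is a (right continuous) step function on each bounded interval `[0, t[`. -/
def IsLocStep (f : ℝ≥0 → α) : Prop := ∀ t, ∃ D : List ℝ≥0, D.sum = t ∧ AdaptedTo D f

lemma isLocStep_const (x : α) : IsLocStep fun _ => x :=
  fun t => ⟨[t], by simp, fun _ _ => rfl, trivial⟩

lemma IsLocStep.map {f : ℝ≥0 → α} (h : IsLocStep f) (F : α → β) : IsLocStep fun s => F (f s) :=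
  fun t => (h t).imp fun _ hD => ⟨hD.1, hD.2.map F⟩

lemma IsLocStep.prodMk {f : ℝ≥0 → α} {g : ℝ≥0 → β} (hf : IsLocStep f) (hg : IsLocStep g) :
    IsLocStep fun s => (f s, g s) := fun t => by
  obtain ⟨D, hD, h1⟩ := hf t
  obtain ⟨D', hD', h2⟩ := hg t
  obtain ⟨E, hE, h3, h4⟩ := exists_common_adaptedTo h1 h2 (hD.trans hD'.symm)
  exact ⟨E, hE.trans hD, h3.prodMk h4⟩

lemma IsLocStep.map₂ {f : ℝ≥0 → α} {g : ℝ≥0 → β} (hf : IsLocStep f) (hg : IsLocStep g)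
    (F : α → β → γ) : IsLocStep fun s => F (f s) (g s) :=
  (hf.prodMk hg).map fun p => F p.1 p.2

lemma IsLocStep.ite {b : ℝ≥0 → Bool} {f g : ℝ≥0 → α} (hb : IsLocStep b) (hf : IsLocStep f)
    (hg : IsLocStep g) : IsLocStep fun s => if b s then f s else g s :=
  (hb.prodMk (hf.prodMk hg)).map fun p => if p.1 then p.2.1 else p.2.2

/-- The concatenation of `f` on `[0, r[` with the shift of `g` to `[r, ∞[`. -/
noncomputable def concatAt (r : ℝ≥0) (f g : ℝ≥0 → α) : ℝ≥0 → α :=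
  fun s => if s < r then f s else g (s - r)

lemma concatAt_add (r : ℝ≥0) (f g : ℝ≥0 → α) (s : ℝ≥0) : concatAt r f g (s + r) = g s := by
  simp [concatAt]

lemma concatAt_of_lt {r s : ℝ≥0} (h : s < r) (f g : ℝ≥0 → α) : concatAt r f g s = f s :=
  if_pos h

lemma AdaptedTo.concatAt {D D' : List ℝ≥0} {f g : ℝ≥0 → α} (hf : AdaptedTo D f)
    (hg : AdaptedTo D' g) : AdaptedTo (D ++ D') (concatAt D.sum f g) := by
  refine (hf.congr fun s hs => (concatAt_of_lt hs f g).symm).append ?_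
  simpa only [concatAt_add] using hg

lemma AdaptedTo.of_le {D : List ℝ≥0} {f : ℝ≥0 → α} (h : AdaptedTo D f) {t : ℝ≥0}
    (ht : t ≤ D.sum) : ∃ D' : List ℝ≥0, D'.sum = t ∧ AdaptedTo D' f := by
  induction D generalizing f t with
  | nil => exact ⟨[], (nonpos_iff_eq_zero.mp ht).symm, trivial⟩
  | cons d D ih =>
    rcases le_total t d with h1 | h1
    · exact ⟨[t], by simp, h.cons_of_le h1 trivial⟩
    · obtain ⟨D', hD', h2⟩ := ih h.2 (t := t - d) (by
        rw [List.sum_cons] at ht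
        exact tsub_le_iff_left.mpr ht)
      exact ⟨d :: D', by rw [List.sum_cons, hD', add_tsub_cancel_of_le h1], h.1, h2⟩

lemma IsLocStep.concatAt {f g : ℝ≥0 → α} (hf : IsLocStep f) (hg : IsLocStep g) (r : ℝ≥0) :
    IsLocStep (concatAt r f g) := fun t => by
  obtain ⟨D, rfl, h1⟩ := hf r
  obtain ⟨D', rfl, h2⟩ := hg t
  exact (h1.concatAt h2).of_le (by simp)

/-- The functions already treated are packed into one function with values in `s → α`, so only two
lists have to be refined at a time. -/
lemma exists_adaptedTo_finset {κ : Type*} {f : κ → ℝ≥0 → α} (hf : ∀ i, IsLocStep (f i))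
    (s : Finset κ) (t : ℝ≥0) : ∃ D : List ℝ≥0, D.sum = t ∧ ∀ i ∈ s, AdaptedTo D (f i) := by
  classical
  induction s using Finset.induction_on with
  | empty => exact ⟨[t], by simp, by simp⟩
  | insert a s _ ih =>
    obtain ⟨D, hD, h1⟩ := ih
    obtain ⟨D', hD', h2⟩ := hf a t
    obtain ⟨E, hE, h3, h4⟩ := exists_common_adaptedTo
      (adaptedTo_pi.mpr fun i : s => h1 i i.2) h2 (hD.trans hD'.symm)
    refine ⟨E, hE.trans hD, fun i hi => ?_⟩
    rcases Finset.mem_insert.mp hi with rfl | hi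
    · exact h4
    · exact adaptedTo_pi.mp h3 ⟨i, hi⟩

/-- The integral of a step function adapted to `D`. -/
noncomputable def stepSum : List ℝ≥0 → (ℝ≥0 → ℂ) → ℂ
  | [], _ => 0
  | d :: D, f => d * f 0 + stepSum D fun s => f (s + d)

end StepFunctions

/-! ### Evolutions generated by a family of semigroups -/

section Evolution

variable {H : Type v} [NormedAddCommGroup H] [InnerProductSpace ℂ H] [CompleteSpace H]
  {C : NonUnitalStarSubalgebra ℂ (H →L[ℂ] H)} {α : Type*} {P : α → α → ℝ≥0 → C →ₗ[ℂ] C}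

/-- The composition of the semigroup maps along the list `D` of durations. -/
noncomputable def evolution (P : α → α → ℝ≥0 → C →ₗ[ℂ] C) :
    List ℝ≥0 → (ℝ≥0 → α) → (ℝ≥0 → α) → C →ₗ[ℂ] C
  | [], _, _ => LinearMap.id
  | d :: D, f, g => P (f 0) (g 0) d ∘ₗ evolution P D (fun s => f (s + d)) fun s => g (s + d)

lemma evolution_of_sum_eq_zero (hP : ∀ x y, IsSemigroup (P x y)) {D : List ℝ≥0} (hD : D.sum = 0)
    (f g : ℝ≥0 → α) : evolution P D f g = LinearMap.id := by
  induction D generalizing f g with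
  | nil => rfl
  | cons d D ih =>
    rw [List.sum_cons, add_eq_zero] at hD
    rw [evolution, hD.1, (hP _ _).zero, ih hD.2, LinearMap.id_comp]

lemma evolution_cons_split (hP : ∀ x y, IsSemigroup (P x y)) {d e : ℝ≥0} {D : List ℝ≥0}
    {f g : ℝ≥0 → α} (hde : d ≤ e) (hf : AdaptedTo (e :: D) f) (hg : AdaptedTo (e :: D) g) :
    evolution P (e :: D) f g = P (f 0) (g 0) d ∘ₗ
      evolution P ((e - d) :: D) (fun s => f (s + d)) fun s => g (s + d) := by
  rw [evolution, evolution, ← LinearMap.comp_assoc]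
  have h1 : P (f 0) (g 0) d ∘ₗ P (f (0 + d)) (g (0 + d)) (e - d) = P (f 0) (g 0) e := by
    -- If `d = e`, the value at `d` belongs to the next interval and need not equal the value at
    -- `0`, but then the remainder has length zero and contributes the identity.
    rcases hde.eq_or_lt with rfl | h
    · rw [tsub_self, (hP _ _).zero, LinearMap.comp_id]
    · rw [zero_add, hf.1 d h, hg.1 d h, ← (hP _ _).add, add_tsub_cancel_of_le hde]
  rw [h1]
  simp [add_assoc, tsub_add_cancel_of_le hde]

/-- The semigroup law absorbs every cut inside an interval of constancy, so the cutting procedure of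
`exists_common_adaptedTo` changes neither composition. Hence `evolutionAt` does not depend on the
subdivision chosen. -/
lemma evolution_unique (hP : ∀ x y, IsSemigroup (P x y)) {f g : ℝ≥0 → α} {D D' : List ℝ≥0}
    (hf : AdaptedTo D f) (hg : AdaptedTo D g) (hf' : AdaptedTo D' f) (hg' : AdaptedTo D' g)
    (hs : D.sum = D'.sum) : evolution P D f g = evolution P D' f g := by
  induction hn : D.length + D'.length using Nat.strong_induction_on generalizing D D' f g with
  | _ n ih =>
  match D, D' with
  | [], D' => rw [evolution_of_sum_eq_zero hP hs.symm, evolution]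
  | D, [] => rw [evolution_of_sum_eq_zero hP hs, evolution]
  | d :: D, d' :: D' =>
    simp only [List.sum_cons] at hs
    rcases le_total d d' with h | h
    · rw [evolution_cons_split hP h hf' hg', evolution,
        ih (D.length + ((d' - d) :: D').length) (by simp at hn ⊢; omega) hf.2 hg.2
          (hf'.split h) (hg'.split h) (by
          rw [List.sum_cons]
          refine add_left_cancel (a := d) ?_
          rw [hs, ← add_assoc, add_tsub_cancel_of_le h]) rfl]
    · rw [evolution_cons_split hP h hf hg,
        ih (((d - d') :: D).length + D'.length) (by simp at hn ⊢; omega) (hf.split h) (hg.split h)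
          hf'.2 hg'.2 (by
          rw [List.sum_cons]
          refine add_left_cancel (a := d') ?_
          rw [← hs, ← add_assoc, add_tsub_cancel_of_le h]) rfl, evolution]

lemma evolution_congr (hP : ∀ x y, IsSemigroup (P x y)) {D : List ℝ≥0} {f g f' g' : ℝ≥0 → α}
    (hf : ∀ s < D.sum, f s = f' s) (hg : ∀ s < D.sum, g s = g' s) :
    evolution P D f g = evolution P D f' g' := by
  induction D generalizing f g f' g' with
  | nil => rfl
  | cons d D ih =>
    simp only [List.sum_cons] at hf hg
    rw [evolution, evolution, ih (fun s hs => hf _ (by rw [add_comm d]; gcongr))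
      (fun s hs => hg _ (by rw [add_comm d]; gcongr))]
    -- For `d = 0` the hypotheses may say nothing about the values at `0` (all durations could
    -- vanish), but the semigroup map is then the identity.
    rcases eq_or_ne d 0 with rfl | h
    · rw [(hP _ _).zero, (hP _ _).zero]
    · have h0 : 0 < d + D.sum := (pos_iff_ne_zero.mpr h).trans_le le_self_add
      rw [hf 0 h0, hg 0 h0]

lemma evolution_append (D D' : List ℝ≥0) (f g : ℝ≥0 → α) : evolution P (D ++ D') f g =
    evolution P D f g ∘ₗ evolution P D' (fun s => f (s + D.sum)) fun s => g (s + D.sum) := by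
  induction D generalizing f g with
  | nil => simp [evolution]
  | cons d D ih =>
    simp only [List.cons_append, evolution, ih, LinearMap.comp_assoc, List.sum_cons, add_assoc,
      add_comm d]

open Classical in
/-- The evolution `P^{f, g}_t` generated by a family of semigroups, for step functions `f`, `g`. -/
noncomputable def evolutionAt (P : α → α → ℝ≥0 → C →ₗ[ℂ] C) (t : ℝ≥0) (f g : ℝ≥0 → α) :
    C →ₗ[ℂ] C :=
  if h : ∃ D : List ℝ≥0, D.sum = t ∧ AdaptedTo D f ∧ AdaptedTo D g then evolution P h.choose f g
  else LinearMap.id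

lemma evolutionAt_eq (hP : ∀ x y, IsSemigroup (P x y)) {D : List ℝ≥0} {f g : ℝ≥0 → α}
    (hf : AdaptedTo D f) (hg : AdaptedTo D g) :
    evolutionAt P D.sum f g = evolution P D f g := by
  have h : ∃ D' : List ℝ≥0, D'.sum = D.sum ∧ AdaptedTo D' f ∧ AdaptedTo D' g := ⟨D, rfl, hf, hg⟩
  rw [evolutionAt, dif_pos h]
  exact evolution_unique hP h.choose_spec.2.1 h.choose_spec.2.2 hf hg h.choose_spec.1

lemma evolutionAt_zero (hP : ∀ x y, IsSemigroup (P x y)) (f g : ℝ≥0 → α) :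
    evolutionAt P 0 f g = LinearMap.id :=
  evolutionAt_eq hP (D := []) (f := f) (g := g) trivial trivial

lemma evolutionAt_const (hP : ∀ x y, IsSemigroup (P x y)) (t : ℝ≥0) {f g : ℝ≥0 → α}
    {x y : α} (hf : ∀ s < t, f s = x) (hg : ∀ s < t, g s = y) :
    evolutionAt P t f g = P x y t := by
  rcases eq_or_ne t 0 with rfl | h
  · rw [evolutionAt_zero hP, (hP _ _).zero]
  · have h0 := pos_iff_ne_zero.mpr h
    have := evolutionAt_eq hP (D := [t]) (f := f) (g := g)
      ⟨fun s hs => (hf s hs).trans (hf 0 h0).symm, trivial⟩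
      ⟨fun s hs => (hg s hs).trans (hg 0 h0).symm, trivial⟩
    rw [List.sum_singleton] at this
    rw [this, evolution, evolution, LinearMap.comp_id, hf 0 h0, hg 0 h0]

/-- This is the cocycle relation at the level of slices. The maps of earlier times act last, so the
evolution over the first `r` units of time is the outer factor. -/
lemma evolutionAt_concatAt (hP : ∀ x y, IsSemigroup (P x y)) (r t : ℝ≥0) {f g f' g' : ℝ≥0 → α}
    (hf : IsLocStep f) (hg : IsLocStep g) (hf' : IsLocStep f') (hg' : IsLocStep g') :
    evolutionAt P (r + t) (concatAt r f f') (concatAt r g g') =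
      evolutionAt P r f g ∘ₗ evolutionAt P t f' g' := by
  obtain ⟨D, rfl, h⟩ := (hf.prodMk hg) r
  obtain ⟨D', rfl, h'⟩ := (hf'.prodMk hg') t
  have h1 := h.map Prod.fst
  have h2 := h.map Prod.snd
  have h1' := h'.map Prod.fst
  have h2' := h'.map Prod.snd
  simp only at h1 h2 h1' h2'
  rw [← List.sum_append, evolutionAt_eq hP (h1.concatAt h1') (h2.concatAt h2'),
    evolutionAt_eq hP h1 h2, evolutionAt_eq hP h1' h2', evolution_append,
    evolution_congr hP (f' := f) (g' := g) (fun s hs => concatAt_of_lt hs _ _)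
      (fun s hs => concatAt_of_lt hs _ _)]
  simp only [concatAt_add]

variable {k : Type u} [NormedAddCommGroup k] [InnerProductSpace ℂ k]

lemma posSemidef_gramMat {ι : Type*} [Finite ι] (x : ι → k) (t : ℝ≥0) :
    (Matrix.of fun i j => Complex.exp (-(t : ℂ) * chiForm (x i) (x j))).PosSemidef := by
  have h : (Matrix.of fun i j => Complex.exp (-(t : ℂ) * chiForm (x i) (x j))) =
      Matrix.gram ℂ fun i => cohVec (constOn t (x i)) := by
    ext i j
    rw [Matrix.gram_apply, inner_cohVec_constOn, Matrix.of_apply]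
  rw [h]
  exact Matrix.posSemidef_gram ℂ _

/-- The exponential of the sum is a Schur product, over the intervals, of Gram matrices of coherent
vectors. -/
lemma posSemidef_exp_stepSum {ι : Type*} [Finite ι] (D : List ℝ≥0) (f : ι → ℝ≥0 → k) :
    (Matrix.of fun i j =>
      Complex.exp (-stepSum D fun s => chiForm (f i s) (f j s))).PosSemidef := by
  induction D generalizing f with
  | nil =>
    have := posSemidef_gramMat (fun i => f i 0) 0
    simpa [stepSum] using this
  | cons d D ih =>
    have h : (Matrix.of fun i j =>
        Complex.exp (-stepSum (d :: D) fun s => chiForm (f i s) (f j s))) =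
        (Matrix.of fun i j => Complex.exp (-(d : ℂ) * chiForm (f i 0) (f j 0))).hadamard
          (Matrix.of fun i j => Complex.exp (-stepSum D fun s =>
            chiForm (f i (s + d)) (f j (s + d)))) := by
      ext i j
      simp only [stepSum, Matrix.of_apply, Matrix.hadamard_apply, ← Complex.exp_add]
      congr 1
      ring
    rw [h]
    exact (posSemidef_gramMat (fun i => f i 0) d).hadamard (ih fun i s => f i (s + d))

variable {T : Set k} {P : T → T → ℝ≥0 → C →ₗ[ℂ] C}

/-- The order interval condition of the theorem, for arbitrary finite index types. -/
lemma isPosKernel_schurMap (h : ∀ (n : ℕ), 1 ≤ n → ∀ (x : Fin n → T)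
      (lam : Matrix (Fin n) (Fin n) ℂ), lam.PosSemidef → ∀ t : ℝ≥0, Set.MapsTo (schurMap P x t)
        (orderInterval C (idTensor H lam))
        (orderInterval C (idTensor H (lam.hadamard (gramMat (fun i => (x i : k)) t)))))
    {ι : Type*} [Fintype ι] (x : ι → T) {lam : Matrix ι ι ℂ} (hlam : lam.PosSemidef) (t : ℝ≥0)
    {A : ι → ι → C} (hA : IsPosKernel fun i j => (A i j : H →L[ℂ] H))
    (hA' : IsPosKernel fun i j => lam i j • (1 : H →L[ℂ] H) - (A i j : H →L[ℂ] H)) :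
    (IsPosKernel fun i j => (P (x i) (x j) t (A i j) : H →L[ℂ] H)) ∧
    IsPosKernel fun i j => (lam i j * Complex.exp (-(t : ℂ) * chiForm (x i : k) (x j))) •
      (1 : H →L[ℂ] H) - (P (x i) (x j) t (A i j) : H →L[ℂ] H) := by
  rcases isEmpty_or_nonempty ι with hι | hι
  · exact ⟨fun u => by simp, fun u => by simp⟩
  have e := Fintype.equivFin ι
  have h1 := h _ Fintype.card_pos (fun i => x (e.symm i)) (lam.submatrix e.symm e.symm)
    (hlam.submatrix _) t (mem_orderInterval_iff (A := Matrix.of fun i j =>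
      A (e.symm i) (e.symm j)).mpr ⟨hA.comp e.symm, hA'.comp e.symm⟩)
  rw [mem_orderInterval_iff] at h1
  have h2 := h1.1.comp e
  have h3 := h1.2.comp e
  simp only [schurMap, gramMat, Matrix.of_apply, Matrix.hadamard_apply, Matrix.submatrix_apply,
    Equiv.symm_apply_apply] at h2 h3
  exact ⟨h2, h3⟩

/-- Induction from the last interval back to the first. The bound for the later intervals is `lam`
Schur-multiplied by a Gram matrix; it is again positive semidefinite and serves as the `lam` of the
order condition for the preceding interval. The condition is thus used for general `lam`. -/
lemma isPosKernel_evolution (h : ∀ (n : ℕ), 1 ≤ n → ∀ (x : Fin n → T)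
      (lam : Matrix (Fin n) (Fin n) ℂ), lam.PosSemidef → ∀ t : ℝ≥0, Set.MapsTo (schurMap P x t)
        (orderInterval C (idTensor H lam))
        (orderInterval C (idTensor H (lam.hadamard (gramMat (fun i => (x i : k)) t)))))
    {ι : Type*} [Fintype ι] {lam : Matrix ι ι ℂ} (hlam : lam.PosSemidef)
    {A : ι → ι → C} (hA : IsPosKernel fun i j => (A i j : H →L[ℂ] H))
    (hA' : IsPosKernel fun i j => lam i j • (1 : H →L[ℂ] H) - (A i j : H →L[ℂ] H))
    (D : List ℝ≥0) (f : ι → ℝ≥0 → T) :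
    (IsPosKernel fun i j => (evolution P D (f i) (f j) (A i j) : H →L[ℂ] H)) ∧
    IsPosKernel fun i j =>
      (lam i j * Complex.exp (-stepSum D fun s => chiForm (f i s : k) (f j s))) •
        (1 : H →L[ℂ] H) - (evolution P D (f i) (f j) (A i j) : H →L[ℂ] H) := by
  induction D generalizing f with
  | nil => simpa [evolution, stepSum] using ⟨hA, hA'⟩
  | cons d D ih =>
    obtain ⟨h1, h2⟩ := ih fun i s => f i (s + d)
    have h3 := isPosKernel_schurMap h (fun i => f i 0)
      (hlam.hadamard (posSemidef_exp_stepSum D fun i s => (f i (s + d) : k))) d h1 h2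
    refine ⟨h3.1, ?_⟩
    have h4 : ∀ i j, lam i j *
        Complex.exp (-stepSum (d :: D) fun s => chiForm (f i s : k) (f j s)) =
        lam.hadamard (Matrix.of fun i j => Complex.exp (-stepSum D fun s =>
          chiForm (f i (s + d) : k) (f j (s + d)))) i j *
            Complex.exp (-(d : ℂ) * chiForm (f i 0 : k) (f j 0)) := fun i j => by
      rw [Matrix.hadamard_apply, Matrix.of_apply, mul_assoc, ← Complex.exp_add, stepSum]
      congr 2
      ring
    simp only [h4]
    exact h3.2

end Evolution

/-! ### Step functions as square-integrable functions -/

section StepIntegral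

variable {E : Type*} [NormedAddCommGroup E]

/-- The cut at `d` isolates the first interval and leaves a translate of a step function with one
duration fewer, so integrability and integrals follow by induction on the list. -/
lemma indicator_Ico_cons {d S : ℝ≥0} {f : ℝ≥0 → E} (hf : ∀ s < d, f s = f 0) :
    (Set.Ico (0 : ℝ) (d + S : ℝ≥0)).indicator (fun s => f s.toNNReal) =
      fun s => (Set.Ico (0 : ℝ) d).indicator (fun _ => f 0) s +
        (Set.Ico (0 : ℝ) S).indicator (fun s => f (s.toNNReal + d)) (s - d) := by
  funext s
  rcases lt_or_ge s d with h | h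
  · have h2 : s - d ∉ Set.Ico (0 : ℝ) S := fun h' => by have := h'.1; linarith
    rw [Set.indicator_of_notMem h2, add_zero]
    rcases lt_or_ge s 0 with h0 | h0
    · rw [Set.indicator_of_notMem (fun h' => h0.not_ge h'.1),
        Set.indicator_of_notMem (fun h' => h0.not_ge h'.1)]
    · have : s < (d + S : ℝ≥0) := by push_cast; linarith [S.2]
      rw [Set.indicator_of_mem (Set.mem_Ico.mpr ⟨h0, this⟩),
        Set.indicator_of_mem (Set.mem_Ico.mpr ⟨h0, h⟩)]
      exact hf _ ((Real.toNNReal_lt_iff_lt_coe h0).mpr h)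
  · rw [Set.indicator_of_notMem (s := Set.Ico (0 : ℝ) d) (fun h' => h'.2.not_ge h), zero_add]
    have h0 : 0 ≤ s := d.2.trans h
    by_cases h3 : s < d + S
    · rw [Set.indicator_of_mem (Set.mem_Ico.mpr ⟨h0, by push_cast; exact h3⟩),
        Set.indicator_of_mem (Set.mem_Ico.mpr ⟨by linarith, by linarith⟩)]
      congr 1
      refine NNReal.coe_injective ?_
      rw [NNReal.coe_add, Real.coe_toNNReal _ h0, Real.coe_toNNReal _ (by linarith)]
      ring
    · rw [Set.indicator_of_notMem (fun h' => h3 (by have := h'.2; push_cast at this; exact this)),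
        Set.indicator_of_notMem (fun h' => h3 (by have := h'.2; linarith))]

lemma AdaptedTo.memLp {D : List ℝ≥0} {f : ℝ≥0 → E} (hf : AdaptedTo D f) (p : ℝ≥0∞) :
    MemLp ((Set.Ico (0 : ℝ) D.sum).indicator fun s => f s.toNNReal) p volume := by
  induction D generalizing f with
  | nil => simp
  | cons d D ih =>
    rw [List.sum_cons, indicator_Ico_cons hf.1]
    refine MemLp.add (memLp_indicator_const p measurableSet_Ico _ (Or.inr (by simp))) ?_
    exact (ih hf.2).comp_measurePreserving (measurePreserving_sub_right volume (d : ℝ))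

lemma AdaptedTo.integral_eq {D : List ℝ≥0} {f : ℝ≥0 → ℂ} (hf : AdaptedTo D f) :
    ∫ s in Set.Ico (0 : ℝ) D.sum, f s.toNNReal = stepSum D f := by
  rw [← integral_indicator measurableSet_Ico]
  induction D generalizing f with
  | nil => simp [stepSum]
  | cons d D ih =>
    have hi := memLp_one_iff_integrable.mp (hf.2.memLp 1)
    rw [List.sum_cons, indicator_Ico_cons hf.1, integral_add
      (memLp_one_iff_integrable.mp
        (memLp_indicator_const 1 measurableSet_Ico _ (Or.inr (by simp))))
      (hi.comp_sub_right (d : ℝ)),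
      integral_sub_right_eq_self ((Set.Ico (0 : ℝ) D.sum).indicator _), ih hf.2,
      integral_indicator measurableSet_Ico, setIntegral_const, stepSum]
    simp

/-- Step functions with bounded support. -/
def IsBddStep (f : ℝ≥0 → E) : Prop := IsLocStep f ∧ ∃ N, ∀ s, N ≤ s → f s = 0

lemma IsBddStep.memLp {f : ℝ≥0 → E} (hf : IsBddStep f) (p : ℝ≥0∞) {J : Set ℝ}
    (hJ : J ⊆ Set.Ici 0) : MemLp (fun s : ℝ => f s.toNNReal) p (volume.restrict J) := by
  refine MemLp.mono_measure (Measure.restrict_mono hJ le_rfl) ?_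
  obtain ⟨h1, N, hN⟩ := hf
  obtain ⟨D, rfl, hD⟩ := h1 N
  rw [← memLp_indicator_iff_restrict measurableSet_Ici]
  convert hD.memLp p using 1
  funext s
  by_cases h0 : 0 ≤ s
  · rw [Set.indicator_of_mem (by exact h0)]
    by_cases hs : s < D.sum
    · rw [Set.indicator_of_mem (Set.mem_Ico.mpr ⟨h0, hs⟩)]
    · rw [Set.indicator_of_notMem (fun h' => hs h'.2)]
      exact hN _ (NNReal.le_toNNReal_of_coe_le (not_lt.mp hs))
  · rw [Set.indicator_of_notMem (by exact h0), Set.indicator_of_notMem (fun h' => h0 h'.1)]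

lemma IsBddStep.ite {b : ℝ≥0 → Bool} {f g : ℝ≥0 → E} (hb : IsLocStep b) (hf : IsBddStep f)
    (hg : IsBddStep g) : IsBddStep fun s => if b s then f s else g s := by
  obtain ⟨N, hN⟩ := hf.2
  obtain ⟨N', hN'⟩ := hg.2
  refine ⟨hb.ite hf.1 hg.1, max N N', fun s hs => ?_⟩
  beta_reduce
  rw [hN s ((le_max_left _ _).trans hs), hN' s ((le_max_right _ _).trans hs), ite_self]

lemma IsBddStep.map₂ {E' E'' : Type*} [NormedAddCommGroup E'] [NormedAddCommGroup E'']
    {f : ℝ≥0 → E} {g : ℝ≥0 → E'} (hf : IsBddStep f) (hg : IsBddStep g) (F : E → E' → E'')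
    (hF : F 0 0 = 0) : IsBddStep fun s => F (f s) (g s) := by
  obtain ⟨N, hN⟩ := hf.2
  obtain ⟨N', hN'⟩ := hg.2
  refine ⟨hf.1.map₂ hg.1 F, max N N', fun s hs => ?_⟩
  beta_reduce
  rw [hN s ((le_max_left _ _).trans hs), hN' s ((le_max_right _ _).trans hs), hF]

end StepIntegral

/-! ### Step functions as vectors of `L²(J; k)` -/

section StepVec

variable {k : Type u} [NormedAddCommGroup k]

open Classical in
/-- The element of `L²(J; k)` given by a step function. -/
noncomputable def stepVec (J : Set ℝ) (f : ℝ≥0 → k) : NoiseL2 k J :=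
  -- The default `0` never occurs for bounded step functions; it lets `stepVec_congr` hold without
  -- an integrability hypothesis.
  if h : MemLp (fun s : ℝ => f s.toNNReal) 2 (volume.restrict J) then h.toLp _ else 0

variable {J : Set ℝ} {f g : ℝ≥0 → k}

lemma stepVec_coeFn (hJ : J ⊆ Set.Ici 0) (hf : IsBddStep f) :
    stepVec J f =ᵐ[volume.restrict J] fun s : ℝ => f s.toNNReal := by
  rw [stepVec, dif_pos (hf.memLp 2 hJ)]
  exact MemLp.coeFn_toLp _

lemma stepVec_congr (hJ : MeasurableSet J) (h : ∀ s ∈ J, f s.toNNReal = g s.toNNReal) :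
    stepVec J f = stepVec J g := by
  have hae : (fun s : ℝ => f s.toNNReal) =ᵐ[volume.restrict J] fun s : ℝ => g s.toNNReal := by
    filter_upwards [ae_restrict_mem hJ] with s hs using h s hs
  rw [stepVec, stepVec]
  by_cases hf : MemLp (fun s : ℝ => f s.toNNReal) 2 (volume.restrict J)
  · rw [dif_pos hf, dif_pos ((memLp_congr_ae hae).mp hf)]
    exact MemLp.toLp_congr _ _ hae
  · rw [dif_neg hf, dif_neg (fun h' => hf ((memLp_congr_ae hae).mpr h'))]

lemma stepVec_add (hJ : J ⊆ Set.Ici 0) (hf : IsBddStep f) (hg : IsBddStep g) :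
    stepVec J (fun s => f s + g s) = stepVec J f + stepVec J g := by
  refine Lp.ext ?_
  filter_upwards [stepVec_coeFn hJ hf, stepVec_coeFn hJ hg,
    stepVec_coeFn hJ (hf.map₂ hg (fun x y => x + y) (add_zero 0)),
    Lp.coeFn_add (stepVec J f) (stepVec J g)] with s h1 h2 h3 h4
  rw [h3, h4, Pi.add_apply, h1, h2]

variable [InnerProductSpace ℂ k]

lemma inner_stepVec_left (hJ : J ⊆ Set.Ici 0) (hf : IsBddStep f) (p : NoiseL2 k J) :
    inner ℂ p (stepVec J f) = ∫ s in J, inner ℂ (p s) (f s.toNNReal) := by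
  rw [L2.inner_def]
  refine integral_congr_ae ?_
  filter_upwards [stepVec_coeFn hJ hf] with s hs
  rw [hs]

lemma inner_stepVec (hJ : J ⊆ Set.Ici 0) (hf : IsBddStep f) (hg : IsBddStep g) :
    inner ℂ (stepVec J f) (stepVec J g) = ∫ s in J, inner ℂ (f s.toNNReal) (g s.toNNReal) := by
  rw [inner_stepVec_left hJ hg]
  refine integral_congr_ae ?_
  filter_upwards [stepVec_coeFn hJ hf] with s hs
  rw [hs]

lemma inner_cohVec_stepVec (hJ : J ⊆ Set.Ici 0) (hf : IsBddStep f) (hg : IsBddStep g) :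
    inner ℂ (cohVec (stepVec J f)) (cohVec (stepVec J g)) =
      Complex.exp (-∫ s in J, chiForm (f s.toNNReal) (g s.toNNReal)) := by
  have hn : ∀ {f : ℝ≥0 → k}, IsBddStep f → ((‖stepVec J f‖ : ℂ)) ^ 2 =
      ∫ s in J, (‖f s.toNNReal‖ : ℂ) ^ 2 := fun {f} hf => by
    have := inner_stepVec hJ hf hf
    rw [inner_self_eq_norm_sq_to_K] at this
    refine this.trans (integral_congr_ae (Filter.Eventually.of_forall fun s => ?_))
    exact inner_self_eq_norm_sq_to_K _
  have h1 : ∀ {f g : ℝ≥0 → k}, IsBddStep f → IsBddStep g →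
      Integrable (fun s : ℝ => inner ℂ (f s.toNNReal) (g s.toNNReal)) (volume.restrict J) :=
    fun {f g} hf hg => memLp_one_iff_integrable.mp
      ((hf.map₂ hg (fun x y => inner ℂ x y) (by simp)).memLp 1 hJ)
  have h2 : ∀ {f : ℝ≥0 → k}, IsBddStep f →
      Integrable (fun s : ℝ => (‖f s.toNNReal‖ : ℂ) ^ 2) (volume.restrict J) := fun {f} hf =>
    memLp_one_iff_integrable.mp
      ((hf.map₂ hf (fun x _ => (‖x‖ : ℂ) ^ 2) (by simp)).memLp 1 hJ)
  rw [inner_cohVec, hn hf, hn hg, inner_stepVec hJ hf hg]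
  have h3 : Integrable (fun s : ℝ => (1 / 2 : ℂ) *
      ((‖f s.toNNReal‖ : ℂ) ^ 2 + (‖g s.toNNReal‖ : ℂ) ^ 2)) (volume.restrict J) :=
    ((h2 hf).add (h2 hg)).const_mul _
  simp only [chiForm]
  rw [integral_sub h3 (h1 hf hg), integral_const_mul,
    integral_add (h2 hf) (h2 hg)]

lemma inner_cohVec_stepVec_Ico {D : List ℝ≥0} (hf : IsBddStep f) (hg : IsBddStep g)
    (hf' : AdaptedTo D f) (hg' : AdaptedTo D g) :
    inner ℂ (cohVec (stepVec (Set.Ico 0 (D.sum : ℝ)) f))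
      (cohVec (stepVec (Set.Ico 0 (D.sum : ℝ)) g)) =
      Complex.exp (-stepSum D fun s => chiForm (f s) (g s)) := by
  rw [inner_cohVec_stepVec (Ico_subset_Ici _) hf hg,
    ← ((hf'.prodMk hg').map fun p => chiForm p.1 p.2).integral_eq]

lemma restrL2_stepVec {J' : Set ℝ} (hJ : J ⊆ Set.Ici 0) (hJ' : J' ⊆ J) (hf : IsBddStep f) :
    restrL2 hJ' (stepVec J f) = stepVec J' f := by
  refine Lp.ext ?_
  filter_upwards [restrL2_coeFn hJ' (stepVec J f), stepVec_coeFn (hJ'.trans hJ) hf,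
    ae_restrict_of_ae_restrict_of_subset hJ' (stepVec_coeFn hJ hf)] with s h1 h2 h3
  rw [h1, h2, h3]

lemma stepVec_smul (hJ : J ⊆ Set.Ici 0) (hf : IsBddStep f) (z : ℂ) :
    stepVec J (fun s => z • f s) = z • stepVec J f := by
  refine Lp.ext ?_
  filter_upwards [stepVec_coeFn hJ hf,
    stepVec_coeFn hJ (hf.map₂ hf (fun x _ => z • x) (smul_zero z)),
    Lp.coeFn_smul z (stepVec J f)] with s h1 h3 h4
  rw [h3, h4, Pi.smul_apply, h1]

end StepVec

/-! ### Closure properties of the set of `f` with `ε(f)` in a closed subspace -/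

section ExpClosure

variable {h : Type u} [NormedAddCommGroup h] [InnerProductSpace ℂ h]

lemma norm_expVec_sq (f : h) : ‖expVec f‖ ^ 2 = Real.exp (‖f‖ ^ 2) := by
  have h1 := inner_expVec f f
  rw [inner_self_eq_norm_sq_to_K, inner_self_eq_norm_sq_to_K] at h1
  have h2 : ((‖expVec f‖ ^ 2 : ℝ) : ℂ) = ((Real.exp (‖f‖ ^ 2) : ℝ) : ℂ) := by
    push_cast
    exact h1
  exact_mod_cast h2

lemma norm_expVec_le {f : h} {R : ℝ} (hf : ‖f‖ ≤ R) : ‖expVec f‖ ≤ Real.exp (R ^ 2) := by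
  have h1 : ‖expVec f‖ ^ 2 ≤ Real.exp (R ^ 2) ^ 2 := by
    rw [norm_expVec_sq]
    have h3 : Real.exp (‖f‖ ^ 2) ≤ Real.exp (R ^ 2) :=
      Real.exp_le_exp.mpr (pow_le_pow_left₀ (norm_nonneg _) hf 2)
    have h4 : 1 ≤ Real.exp (R ^ 2) := Real.one_le_exp (sq_nonneg _)
    nlinarith
  exact le_of_sq_le_sq h1 (Real.exp_pos _).le

/-- Exponential vectors are weakly continuous on bounded sets. -/
lemma tendsto_inner_expVec {α : Type*} {l : Filter α} {g : α → h} {g₀ : h} {R : ℝ}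
    (hR : ∀ᶠ n in l, ‖g n‖ ≤ R) (hg : ∀ p : h, Filter.Tendsto (fun n => inner ℂ p (g n)) l
      (nhds (inner ℂ p g₀))) (ξ : SymFock h) :
    Filter.Tendsto (fun n => inner ℂ ξ (expVec (g n))) l (nhds (inner ℂ ξ (expVec g₀))) := by
  -- Against an exponential vector the claim is continuity of `exp`. A general `ξ` is approximated
  -- by combinations of these, uniformly along the filter because the vectors `ε(g n)` are
  -- eventually bounded.
  have hspan : ∀ ξ ∈ Submodule.span ℂ (Set.range (expVec : h → SymFock h)),
      Filter.Tendsto (fun n => inner ℂ ξ (expVec (g n))) l (nhds (inner ℂ ξ (expVec g₀))) := by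
    intro ξ hξ
    induction hξ using Submodule.span_induction with
    | mem z hz =>
      obtain ⟨p, rfl⟩ := hz
      simp only [inner_expVec]
      exact (Complex.continuous_exp.tendsto _).comp (hg p)
    | zero => simp only [inner_zero_left]; exact tendsto_const_nhds
    | add z w _ _ hz hw => simpa only [inner_add_left] using hz.add hw
    | smul c z _ hz => simpa only [inner_smul_left] using hz.const_mul _
  rw [Metric.tendsto_nhds]
  intro ε hε
  set B := Real.exp (R ^ 2) + ‖expVec g₀‖ + 1 with hB
  have hBpos : 0 < B := by positivity
  have hd := Submodule.dense_iff_topologicalClosure_eq_top.mpr (expVec_total (h := h))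
  obtain ⟨ξ', hξ', hdist⟩ := Metric.mem_closure_iff.mp (hd ξ) (ε / (3 * B)) (by positivity)
  have h1 := Metric.tendsto_nhds.mp (hspan ξ' hξ') (ε / 3) (by positivity)
  filter_upwards [h1, hR] with n h2 h3
  rw [dist_eq_norm] at hdist h2 ⊢
  have key : ∀ w : SymFock h, ‖w‖ ≤ B → ‖inner ℂ (ξ - ξ') w‖ < ε / 3 := fun w hw => by
    refine (norm_inner_le_norm _ _).trans_lt ?_
    calc ‖ξ - ξ'‖ * ‖w‖ ≤ ‖ξ - ξ'‖ * B := by gcongr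
      _ < ε / (3 * B) * B := by gcongr
      _ = ε / 3 := by field_simp
  have h4 := key (expVec (g n)) (by
    have := norm_expVec_le h3
    have := norm_nonneg (expVec g₀)
    linarith)
  have h5 := key (expVec g₀) (by
    have := Real.exp_pos (R ^ 2)
    linarith)
  have h6 : inner ℂ ξ (expVec (g n)) - inner ℂ ξ (expVec g₀) =
      inner ℂ (ξ - ξ') (expVec (g n)) - inner ℂ (ξ - ξ') (expVec g₀) +
        (inner ℂ ξ' (expVec (g n)) - inner ℂ ξ' (expVec g₀)) := by
    simp only [inner_sub_left]; ring
  rw [h6]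
  have h7 := norm_add_le (inner ℂ (ξ - ξ') (expVec (g n)) - inner ℂ (ξ - ξ') (expVec g₀))
    (inner ℂ ξ' (expVec (g n)) - inner ℂ ξ' (expVec g₀))
  have h8 := norm_sub_le (inner ℂ (ξ - ξ') (expVec (g n))) (inner ℂ (ξ - ξ') (expVec g₀))
  linarith

lemma mem_of_forall_inner_eq_zero {M : Submodule ℂ (SymFock h)}
    (hM : IsClosed (M : Set (SymFock h))) {w : SymFock h}
    (hw : ∀ ξ ∈ Mᗮ, inner ℂ ξ w = 0) : w ∈ M := by
  have : CompleteSpace M := hM.completeSpace_coe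
  rw [← Submodule.orthogonal_orthogonal M, Submodule.mem_orthogonal]
  exact hw

/-- Weak convergence suffices, since a closed subspace is the orthogonal complement of its
orthogonal complement. -/
lemma expVec_mem_of_tendsto {M : Submodule ℂ (SymFock h)} (hM : IsClosed (M : Set (SymFock h)))
    {α : Type*} {l : Filter α} [l.NeBot] {g : α → h} {g₀ : h} {R : ℝ}
    (hR : ∀ᶠ n in l, ‖g n‖ ≤ R) (hg : ∀ p : h, Filter.Tendsto (fun n => inner ℂ p (g n)) l
      (nhds (inner ℂ p g₀))) (hmem : ∀ n, expVec (g n) ∈ M) : expVec g₀ ∈ M := by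
  refine mem_of_forall_inner_eq_zero hM fun ξ hξ => ?_
  refine tendsto_nhds_unique (tendsto_inner_expVec hR hg ξ) ?_
  have : ∀ n, inner ℂ ξ (expVec (g n)) = 0 := fun n =>
    Submodule.inner_left_of_mem_orthogonal (hmem n) hξ
  simp [this]

/-- If `ξ` is an exponential vector, the function is the exponential of an affine function of `z`;
in general it is a locally uniform limit of combinations of such functions. -/
lemma differentiable_inner_expVec (ξ : SymFock h) (a b : h) :
    Differentiable ℂ fun z : ℂ => inner ℂ ξ (expVec (a + z • b)) := by
  have hspan : ∀ ξ ∈ Submodule.span ℂ (Set.range (expVec : h → SymFock h)),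
      Differentiable ℂ fun z : ℂ => inner ℂ ξ (expVec (a + z • b)) := by
    intro ξ hξ
    induction hξ using Submodule.span_induction with
    | mem z hz =>
      obtain ⟨p, rfl⟩ := hz
      simp only [inner_expVec, inner_add_right, inner_smul_right]
      fun_prop
    | zero => simp
    | add z w _ _ hz hw => simp only [inner_add_left]; exact hz.add hw
    | smul c z _ hz => simp only [inner_smul_left]; exact hz.const_mul _
  have hd := Submodule.dense_iff_topologicalClosure_eq_top.mpr (expVec_total (h := h))
  obtain ⟨ξn, hξn, hlim⟩ := mem_closure_iff_seq_limit.mp (hd ξ)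
  rw [← differentiableOn_univ]
  refine TendstoLocallyUniformlyOn.differentiableOn (φ := Filter.atTop)
    (F := fun n z => inner ℂ (ξn n) (expVec (a + z • b))) ?_
    (Filter.Eventually.of_forall fun n => (hspan _ (hξn n)).differentiableOn) isOpen_univ
  rw [Metric.tendstoLocallyUniformlyOn_iff]
  intro ε hε z₀ _
  set B := Real.exp ((‖a‖ + (‖z₀‖ + 1) * ‖b‖) ^ 2) with hB
  refine ⟨Metric.ball z₀ 1, mem_nhdsWithin_of_mem_nhds (Metric.ball_mem_nhds _ one_pos), ?_⟩
  filter_upwards [Metric.tendsto_nhds.mp hlim (ε / B) (div_pos hε (Real.exp_pos _))] with n hn z hz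
  have h1 : ‖expVec (a + z • b)‖ ≤ B := by
    refine norm_expVec_le ((norm_add_le _ _).trans ?_)
    rw [norm_smul]
    have : ‖z‖ ≤ ‖z₀‖ + 1 := by
      have h2 := norm_le_norm_add_norm_sub' z z₀
      have h3 : ‖z - z₀‖ < 1 := by simpa [dist_eq_norm] using hz
      linarith
    gcongr
  rw [dist_eq_norm, ← inner_sub_left]
  rw [dist_eq_norm, norm_sub_rev] at hn
  calc _ ≤ ‖ξ - ξn n‖ * ‖expVec (a + z • b)‖ := norm_inner_le_norm _ _
    _ ≤ ‖ξ - ξn n‖ * B := by gcongr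
    _ < ε / B * B := by gcongr
    _ = ε := div_mul_cancel₀ _ (Real.exp_pos _).ne'

/-- If `ε(a + z b)` lies in a closed subspace for `z = 1 - 2^{-n}`, then for all `z`. -/
lemma expVec_mem_of_forall_pow {M : Submodule ℂ (SymFock h)}
    (hM : IsClosed (M : Set (SymFock h))) {a b : h}
    (hmem : ∀ n : ℕ, expVec (a + (1 - (1 / 2 : ℂ) ^ n) • b) ∈ M) (z : ℂ) :
    expVec (a + z • b) ∈ M := by
  refine mem_of_forall_inner_eq_zero hM fun ξ hξ => ?_
  have hdiff := differentiable_inner_expVec ξ a b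
  have han : AnalyticOnNhd ℂ (fun z : ℂ => inner ℂ ξ (expVec (a + z • b))) Set.univ :=
    fun z _ => hdiff.analyticAt z
  -- For `ξ` orthogonal to `M` the entire function vanishes at the points `1 - 2^{-n}`, which
  -- accumulate at `1`; the identity theorem applies.
  refine han.eqOn_zero_of_preconnected_of_frequently_eq_zero isPreconnected_univ
    (Set.mem_univ (1 : ℂ)) ?_ (Set.mem_univ z)
  have hlim : Filter.Tendsto (fun n : ℕ => 1 - (1 / 2 : ℂ) ^ n) Filter.atTop
      (nhdsWithin 1 {1}ᶜ) := by
    refine tendsto_nhdsWithin_iff.mpr ⟨?_, Filter.Eventually.of_forall fun n => ?_⟩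
    · have := tendsto_pow_atTop_nhds_zero_of_norm_lt_one (x := (1 / 2 : ℂ)) (by norm_num)
      simpa using this.const_sub 1
    · simp
  refine hlim.frequently (Filter.Eventually.frequently (Filter.Eventually.of_forall fun n => ?_))
  exact Submodule.inner_left_of_mem_orthogonal (hmem n) hξ

end ExpClosure

/-! ### Totality of the exponential vectors of step functions -/

section Rademacher

/-- The parity of `⌊(n + 1) s⌋`. -/
noncomputable def parity (n : ℕ) (s : ℝ≥0) : Bool := decide (Even ⌊((n : ℝ) + 1) * s⌋)

/-- The floor is constant on `[0, δ[` with `δ = 1 / (n + 1)` and grows by one when `s` grows by `δ`;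
so the durations are copies of `δ`, the last possibly cut short. -/
lemma isLocStep_parity (n : ℕ) : IsLocStep (parity n) := by
  suffices h : IsLocStep fun s : ℝ≥0 => ⌊((n : ℝ) + 1) * s⌋ from h.map fun m => decide (Even m)
  have hn : (0 : ℝ) < (n : ℝ) + 1 := by positivity
  set δ : ℝ≥0 := ((n : ℝ≥0) + 1)⁻¹ with hδ
  have hδ' : ((n : ℝ) + 1) * δ = 1 := by
    rw [hδ]; push_cast; exact mul_inv_cancel₀ hn.ne'
  have hδ0 : 0 < δ := by positivity
  have key : ∀ (m : ℕ) (t : ℝ≥0), t ≤ m * δ →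
      ∃ D : List ℝ≥0, D.sum = t ∧ AdaptedTo D fun s : ℝ≥0 => ⌊((n : ℝ) + 1) * s⌋ := by
    intro m
    induction m with
    | zero => exact fun t ht => ⟨[], by
        rw [Nat.cast_zero, zero_mul] at ht
        exact (nonpos_iff_eq_zero.mp ht).symm, trivial⟩
    | succ m ih =>
      intro t ht
      have h0 : ∀ s : ℝ≥0, s < δ → ⌊((n : ℝ) + 1) * s⌋ = 0 := fun s hs => by
        rw [Int.floor_eq_zero_iff]
        refine ⟨by positivity, ?_⟩
        exact (mul_lt_mul_of_pos_left (NNReal.coe_lt_coe.mpr hs) hn).trans_eq hδ'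
      rcases le_total t δ with h1 | h1
      · refine ⟨[t], by simp, fun s hs => ?_, trivial⟩
        exact (h0 s (hs.trans_le h1)).trans (h0 0 hδ0).symm
      · obtain ⟨D, hD, h2⟩ := ih (t - δ) (by
          rw [tsub_le_iff_right]
          refine ht.trans_eq ?_
          push_cast
          ring)
        refine ⟨δ :: D, by rw [List.sum_cons, hD, add_tsub_cancel_of_le h1],
          fun s hs => (h0 s hs).trans (h0 0 hδ0).symm, ?_⟩
        have h3 : (fun s : ℝ≥0 => ⌊((n : ℝ) + 1) * (s + δ : ℝ≥0)⌋) =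
            fun s : ℝ≥0 => ⌊((n : ℝ) + 1) * s⌋ + 1 := by
          funext s
          rw [← Int.floor_add_one]
          congr 1
          push_cast
          rw [mul_add, hδ']
        rw [h3]
        exact h2.map fun m => m + 1
  intro t
  obtain ⟨m, hm⟩ := exists_nat_ge (t / δ)
  exact key m t ((div_le_iff₀ hδ0).mp hm)

/-- The function `(-1)^⌊(n + 1) s⌋`. -/
noncomputable def rademacher (n : ℕ) (s : ℝ) : ℂ := if Even ⌊((n : ℝ) + 1) * s⌋ then 1 else -1

lemma norm_rademacher (n : ℕ) (s : ℝ) : ‖rademacher n s‖ = 1 := by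
  rw [rademacher]; split_ifs <;> simp

lemma rademacher_add (n : ℕ) (s : ℝ) :
    rademacher n (s + ((n : ℝ) + 1)⁻¹) = -rademacher n s := by
  have hn : ((n : ℝ) + 1) ≠ 0 := by positivity
  have : ⌊((n : ℝ) + 1) * (s + ((n : ℝ) + 1)⁻¹)⌋ = ⌊((n : ℝ) + 1) * s⌋ + 1 := by
    rw [mul_add, mul_inv_cancel₀ hn, Int.floor_add_one]
  rw [rademacher, rademacher, this]
  by_cases h : Even ⌊((n : ℝ) + 1) * s⌋ <;> simp [h]

lemma measurable_rademacher (n : ℕ) : Measurable (rademacher n) := by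
  refine Measurable.ite ?_ measurable_const measurable_const
  exact (Int.measurable_floor.comp (measurable_const.mul measurable_id))
    (MeasurableSet.of_discrete (s := {m : ℤ | Even m}))

lemma integrable_rademacher_mul (n : ℕ) {φ : ℝ → ℂ} (hφ : Integrable φ) :
    Integrable fun s => rademacher n s * φ s :=
  hφ.bdd_mul (c := 1) (measurable_rademacher n).aestronglyMeasurable
    (Filter.Eventually.of_forall fun s => (norm_rademacher n s).le)

/-- A Riemann–Lebesgue argument: translation by `1 / (n + 1)` changes the sign of `rademacher n`, so
the integral is in absolute value at most half the `L¹` distance between `φ` and its translate, and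
translation is continuous in `L¹`. -/
lemma tendsto_integral_rademacher {φ : ℝ → ℂ} (hφ : Integrable φ) :
    Filter.Tendsto (fun n => ∫ s, rademacher n s * φ s) Filter.atTop (nhds 0) := by
  have : Fact ((1 : ℝ≥0∞) ≠ ∞) := ⟨ENNReal.one_ne_top⟩
  have hm := memLp_one_iff_integrable.mpr hφ
  set F : Lp ℂ 1 (volume : Measure ℝ) := hm.toLp φ with hF
  have hbound : ∀ n : ℕ, ‖∫ s, rademacher n s * φ s‖ ≤
      (1 / 2) * ‖(DomAddAct.mk (((n : ℝ) + 1)⁻¹) +ᵥ F) - F‖ := by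
    intro n
    set δ : ℝ := ((n : ℝ) + 1)⁻¹ with hδ
    have h1 : ∫ s, rademacher n s * φ s = -∫ s, rademacher n s * φ (s + δ) := by
      rw [← integral_add_right_eq_self (fun s => rademacher n s * φ s) δ, ← integral_neg]
      refine integral_congr_ae (Filter.Eventually.of_forall fun s => ?_)
      simp only [hδ, rademacher_add, neg_mul]
    have hi := integrable_rademacher_mul n hφ
    have hi' := integrable_rademacher_mul n (hφ.comp_add_right δ)
    have h2 : ∫ s, rademacher n s * φ s =
        (1 / 2) * -∫ s, rademacher n s * (φ (s + δ) - φ s) := by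
      simp only [mul_sub]
      rw [integral_sub hi' hi]
      linear_combination (1 / 2) * h1
    have h3 : ‖(DomAddAct.mk δ +ᵥ F) - F‖ = ∫ s, ‖φ (s + δ) - φ s‖ := by
      rw [L1.norm_eq_integral_norm]
      refine integral_congr_ae ?_
      have h4 : (DomAddAct.mk δ +ᵥ F : Lp ℂ 1 (volume : Measure ℝ)) =ᵐ[volume]
          fun s => φ (s + δ) := by
        rw [hF, DomAddAct.mk_vadd_toLp]
        refine (MemLp.coeFn_toLp _).trans (Filter.Eventually.of_forall fun s => ?_)
        simp [add_comm]
      filter_upwards [h4, hm.coeFn_toLp, Lp.coeFn_sub (DomAddAct.mk δ +ᵥ F) F] with s h5 h6 h7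
      rw [h7, Pi.sub_apply, h5, h6]
    rw [h2, h3, norm_mul, norm_neg]
    norm_num
    refine (norm_integral_le_integral_norm _).trans_eq ?_
    simp only [norm_mul, norm_rademacher, one_mul]
  refine squeeze_zero_norm hbound ?_
  have hc : Filter.Tendsto (fun n : ℕ => DomAddAct.mk (((n : ℝ) + 1)⁻¹) +ᵥ F) Filter.atTop
      (nhds (DomAddAct.mk (0 : ℝ) +ᵥ F)) := by
    have h1 : Filter.Tendsto (fun n : ℕ => ((n : ℝ) + 1)⁻¹) Filter.atTop (nhds 0) := by
      simpa [one_div] using tendsto_one_div_add_atTop_nhds_zero_nat (𝕜 := ℝ)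
    have h2 : Continuous fun c : ℝ => DomAddAct.mk c +ᵥ F :=
      (DomAddAct.continuous_mk).vadd continuous_const
    exact (h2.tendsto 0).comp h1
  have h0 : DomAddAct.mk (0 : ℝ) +ᵥ F = F := by
    rw [DomAddAct.mk_zero, zero_vadd]
  rw [h0] at hc
  have := ((hc.sub_const F).norm).const_mul (1 / 2 : ℝ)
  simpa using this

end Rademacher

/-! ### Step functions with values in a total set -/

section StepTotal

variable {k : Type u} [NormedAddCommGroup k]

/-- Step functions with values in `T` and bounded support. -/
def TStep (T : Set k) : Type _ :=
  {f : ℝ≥0 → T // IsLocStep f ∧ ∃ N, ∀ s, N ≤ s → (f s : k) = 0}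

namespace TStep

variable {T : Set k}

/-- The underlying vector-valued function. -/
def toFun (f : TStep T) (s : ℝ≥0) : k := f.1 s

lemma isBddStep (f : TStep T) : IsBddStep f.toFun := ⟨f.2.1.map Subtype.val, f.2.2⟩

/-- The zero function. -/
def zero (h0 : (0 : k) ∈ T) : TStep T := ⟨fun _ => ⟨0, h0⟩, isLocStep_const _, 0, fun _ _ => rfl⟩

/-- The function equal to `f` where `b` holds and to `g` elsewhere. -/
def ite {b : ℝ≥0 → Bool} (hb : IsLocStep b) (f g : TStep T) : TStep T :=
  ⟨fun s => if b s then f.1 s else g.1 s, hb.ite f.2.1 g.2.1, by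
    obtain ⟨N, hN⟩ := f.2.2
    obtain ⟨N', hN'⟩ := g.2.2
    refine ⟨max N N', fun s hs => ?_⟩
    beta_reduce
    split_ifs
    · exact hN s ((le_max_left _ _).trans hs)
    · exact hN' s ((le_max_right _ _).trans hs)⟩

lemma toFun_ite {b : ℝ≥0 → Bool} (hb : IsLocStep b) (f g : TStep T) :
    (ite hb f g).toFun = fun s => if b s then f.toFun s else g.toFun s := by
  funext s
  simp only [toFun, ite]
  split_ifs <;> rfl

/-- Concatenation of step functions. -/
noncomputable def concat (r : ℝ≥0) (f g : TStep T) : TStep T :=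
  ⟨concatAt r f.1 g.1, f.2.1.concatAt g.2.1 r, by
    obtain ⟨N, hN⟩ := f.2.2
    obtain ⟨N', hN'⟩ := g.2.2
    refine ⟨max N (N' + r), fun s hs => ?_⟩
    rw [concatAt]
    split_ifs
    · exact hN s ((le_max_left _ _).trans hs)
    · exact hN' _ (le_tsub_of_add_le_right ((le_max_right _ _).trans hs))⟩

lemma toFun_concat (r : ℝ≥0) (f g : TStep T) :
    (concat r f g).toFun = concatAt r f.toFun g.toFun := by
  funext s
  simp only [toFun, concat, concatAt]
  split_ifs <;> rfl

/-- The function equal to `x` on `[a, a + d[` and to `0` elsewhere. -/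
noncomputable def block (h0 : (0 : k) ∈ T) (a d : ℝ≥0) (x : T) : TStep T :=
  ⟨concatAt a (fun _ => ⟨0, h0⟩) (concatAt d (fun _ => x) fun _ => ⟨0, h0⟩),
    (isLocStep_const _).concatAt ((isLocStep_const _).concatAt (isLocStep_const _) _) _,
    a + d, fun s hs => by
      have h1 : ¬ s < a := not_lt.mpr (le_self_add.trans hs)
      have h2 : ¬ s - a < d := not_lt.mpr (le_tsub_of_add_le_left hs)
      simp [concatAt, h1, h2]⟩

lemma toFun_block (h0 : (0 : k) ∈ T) (a d : ℝ≥0) (x : T) (s : ℝ≥0) :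
    (block h0 a d x).toFun s = if a ≤ s ∧ s < a + d then (x : k) else 0 := by
  simp only [toFun, block, concatAt]
  by_cases h1 : s < a
  · simp [h1, not_le.mpr h1]
  · have h2 := not_lt.mp h1
    by_cases h3 : s < a + d
    · have : s - a < d := (tsub_lt_iff_left h2).mpr h3
      simp [h1, h2, h3, this]
    · have : ¬ s - a < d := fun h => h3 ((tsub_lt_iff_left h2).mp h)
      simp [h1, h3, this]

end TStep

variable [InnerProductSpace ℂ k] {J : Set ℝ} {T : Set k}

/-- The step functions with values in a total set span a dense subspace of `L²(J; k)`. -/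
lemma stepVec_total [CompleteSpace k] (hJ : J ⊆ Set.Ici 0) (hm : MeasurableSet J)
    (hT : (Submodule.span ℂ T).topologicalClosure = ⊤) (h0 : (0 : k) ∈ T) :
    (Submodule.span ℂ (Set.range fun f : TStep T => stepVec J f.toFun)).topologicalClosure
      = ⊤ := by
  rw [Submodule.topologicalClosure_eq_top_iff, Submodule.eq_bot_iff]
  intro p hp
  have horth : ∀ f : TStep T, inner ℂ (stepVec J f.toFun) p = 0 := fun f =>
    (Submodule.mem_orthogonal _ _).mp hp _ (Submodule.subset_span ⟨f, rfl⟩)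
  have hint : ∀ N : ℝ, Integrable p (volume.restrict (J ∩ Set.Ico 0 N)) := fun N => by
    have h1 : MemLp p 2 (volume.restrict (J ∩ Set.Ico 0 N)) :=
      (Lp.memLp p).mono_measure (Measure.restrict_mono Set.inter_subset_left le_rfl)
    have : IsFiniteMeasure (volume.restrict (J ∩ Set.Ico 0 N)) := by
      refine isFiniteMeasure_restrict.mpr (ne_top_of_le_ne_top ?_
        (measure_mono Set.inter_subset_right))
      simp
    exact h1.integrable (by norm_num)
  -- Test functions equal to `x ∈ T` on `[a, b[` and to `0` elsewhere show that this integral is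
  -- orthogonal to `T`, hence zero.
  have hblock : ∀ a b : ℝ≥0, ∫ s in J ∩ Set.Ico (a : ℝ) b, p s = 0 := by
    intro a b
    rcases lt_or_ge b a with hba | hab
    · rw [Set.Ico_eq_empty (by exact_mod_cast hba.not_gt), Set.inter_empty]
      simp
    have hI : Integrable p (volume.restrict (J ∩ Set.Ico (a : ℝ) b)) :=
      (hint b).mono_measure (Measure.restrict_mono
        (Set.inter_subset_inter_right _ (Set.Ico_subset_Ico_left a.2)) le_rfl)
    refine eq_of_inner_total (b := (Subtype.val : T → k)) (by simpa using hT) fun x => ?_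
    rw [inner_zero_right, ← integral_inner hI]
    have h1 := horth (TStep.block h0 a (b - a) x)
    rw [← inner_conj_symm, inner_stepVec_left hJ (TStep.isBddStep _), ← integral_conj] at h1
    rw [← h1, ← setIntegral_indicator measurableSet_Ico]
    refine setIntegral_congr_fun hm fun s hs => ?_
    have h2 : ((s.toNNReal : ℝ≥0) : ℝ) = s := Real.coe_toNNReal _ (hJ hs)
    have h3 : (a ≤ s.toNNReal ∧ s.toNNReal < a + (b - a)) ↔ s ∈ Set.Ico (a : ℝ) b := by
      rw [add_tsub_cancel_of_le hab, ← NNReal.coe_le_coe, ← NNReal.coe_lt_coe, h2, Set.mem_Ico]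
    simp only [TStep.toFun_block, h3]
    by_cases h4 : s ∈ Set.Ico (a : ℝ) b
    · rw [Set.indicator_of_mem h4, if_pos h4, inner_conj_symm]
    · rw [Set.indicator_of_notMem h4, if_neg h4, inner_zero_right, map_zero]
  have hzero : ∀ N : ℝ≥0, p =ᵐ[volume.restrict (J ∩ Set.Ico 0 (N : ℝ))] 0 := by
    intro N
    refine (hint N).ae_eq_zero_of_forall_setIntegral_eq_zero fun s hs _ => ?_
    have hall : ∫ x, p x ∂volume.restrict (J ∩ Set.Ico 0 (N : ℝ)) = 0 := by
      simpa using hblock 0 N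
    -- The half-open intervals form a π-system that generates the Borel sets.
    refine MeasurableSpace.induction_on_inter
      (C := fun s _ => ∫ x in s, p x ∂volume.restrict (J ∩ Set.Ico 0 (N : ℝ)) = 0)
      ((BorelSpace.measurable_eq (α := ℝ)).trans (borel_eq_generateFrom_Ico ℝ))
      (isPiSystem_Ico id id) (by simp) ?_ ?_ ?_ s hs
    · rintro _ ⟨l, u, -, rfl⟩
      rw [Measure.restrict_restrict measurableSet_Ico]
      have h5 : Set.Ico l u ∩ (J ∩ Set.Ico 0 (N : ℝ)) =
          J ∩ Set.Ico ((l.toNNReal : ℝ≥0) : ℝ) ((min u N).toNNReal : ℝ≥0) := by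
        ext s
        simp only [Set.mem_inter_iff, Set.mem_Ico, Real.coe_toNNReal', lt_max_iff, lt_min_iff,
          max_le_iff]
        constructor
        · rintro ⟨⟨h6, h7⟩, h8, h9, h10⟩
          exact ⟨h8, ⟨h6, h9⟩, Or.inl ⟨h7, h10⟩⟩
        · rintro ⟨h8, ⟨h6, h9⟩, h7 | h7⟩
          · exact ⟨⟨h6, h7.1⟩, h8, h9, h7.2⟩
          · exact absurd h7 (not_lt.mpr h9)
      rw [h5]
      exact hblock _ _
    · intro t ht h5
      have h6 := integral_add_compl ht (hint N)
      rwa [h5, zero_add, hall] at h6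
    · intro f hd hf h5
      rw [integral_iUnion hf hd (hint N).integrableOn]
      simp [h5]
  refine Lp.ext ?_
  have h6 : ∀ᵐ s ∂volume.restrict J, ∀ n : ℕ, s ∈ Set.Ico 0 (n : ℝ) → p s = 0 := by
    rw [ae_all_iff]
    intro n
    have h7 := hzero n
    rw [Set.inter_comm, ← Measure.restrict_restrict measurableSet_Ico] at h7
    exact (ae_restrict_iff' measurableSet_Ico).mp h7
  filter_upwards [h6, ae_restrict_mem hm, Lp.coeFn_zero k 2 (volume.restrict J)] with s h7 h8 h9
  obtain ⟨n, hn⟩ := exists_nat_gt s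
  rw [h7 n ⟨hJ h8, hn⟩, h9, Pi.zero_apply]

lemma inner_ite_parity (n : ℕ) {s : ℝ} (hs : 0 ≤ s) (p x y : k) :
    inner ℂ p (if parity n s.toNNReal then x else y) =
      (1 / 2) * (inner ℂ p x + inner ℂ p y) +
        (1 / 2) * (rademacher n s * (inner ℂ p x - inner ℂ p y)) := by
  rw [parity, rademacher, Real.coe_toNNReal _ hs]
  by_cases h : Even ⌊((n : ℝ) + 1) * s⌋ <;> simp [h] <;> ring

/-- Switching rapidly between two step functions approximates their mean weakly. -/
lemma tendsto_inner_stepVec_parity (hJ : J ⊆ Set.Ici 0) (hm : MeasurableSet J) {G G' : ℝ≥0 → k}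
    (hG : IsBddStep G) (hG' : IsBddStep G') (p : NoiseL2 k J) :
    Filter.Tendsto (fun n => inner ℂ p (stepVec J fun s => if parity n s then G s else G' s))
      Filter.atTop (nhds (inner ℂ p ((1 / 2 : ℂ) • stepVec J G + (1 / 2 : ℂ) • stepVec J G'))) := by
  have hi : ∀ {G : ℝ≥0 → k}, IsBddStep G →
      Integrable (fun s : ℝ => inner ℂ (p s) (G s.toNNReal)) (volume.restrict J) := fun {G} hG => by
    refine (L2.integrable_inner (𝕜 := ℂ) p (stepVec J G)).congr ?_
    filter_upwards [stepVec_coeFn hJ hG] with s hs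
    rw [hs]
  set φ : ℝ → ℂ := J.indicator fun s =>
    inner ℂ (p s) (G s.toNNReal) - inner ℂ (p s) (G' s.toNNReal) with hφ
  have hφi : Integrable φ := (integrable_indicator_iff hm).mpr ((hi hG).sub (hi hG'))
  -- The indicator of even parity is `(1 + rademacher n) / 2`, so the deviation from the mean is an
  -- integral against `rademacher n`.
  have key : ∀ n, inner ℂ p (stepVec J fun s => if parity n s then G s else G' s) =
      inner ℂ p ((1 / 2 : ℂ) • stepVec J G + (1 / 2 : ℂ) • stepVec J G') +
        (1 / 2) * ∫ s, rademacher n s * φ s := by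
    intro n
    have h1 : ∫ s, rademacher n s * φ s = ∫ s in J, rademacher n s *
        (inner ℂ (p s) (G s.toNNReal) - inner ℂ (p s) (G' s.toNNReal)) := by
      rw [← integral_indicator hm]
      refine integral_congr_ae (Filter.Eventually.of_forall fun s => ?_)
      by_cases hs : s ∈ J <;> simp [hφ, hs]
    have h2 : Integrable (fun s => rademacher n s *
        (inner ℂ (p s) (G s.toNNReal) - inner ℂ (p s) (G' s.toNNReal))) (volume.restrict J) := by
      rw [← IntegrableOn, ← integrable_indicator_iff hm]
      refine (integrable_rademacher_mul n hφi).congr (Filter.Eventually.of_forall fun s => ?_)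
      by_cases hs : s ∈ J <;> simp [hφ, hs]
    have h3 : Integrable (fun s : ℝ => inner ℂ (p s) (G s.toNNReal) +
        inner ℂ (p s) (G' s.toNNReal)) (volume.restrict J) := (hi hG).add (hi hG')
    rw [inner_stepVec_left hJ (hG.ite (isLocStep_parity n) hG'), inner_add_right, inner_smul_right,
      inner_smul_right, inner_stepVec_left hJ hG, inner_stepVec_left hJ hG', ← mul_add,
      ← integral_add (hi hG) (hi hG'), h1, ← integral_const_mul, ← integral_const_mul,
      ← integral_add (h3.const_mul _) (h2.const_mul _)]
    exact setIntegral_congr_fun hm fun s hs => inner_ite_parity n (hJ hs) _ _ _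
  simp only [key]
  have := ((tendsto_integral_rademacher hφi).const_mul (1 / 2)).const_add
    (inner ℂ p ((1 / 2 : ℂ) • stepVec J G + (1 / 2 : ℂ) • stepVec J G'))
  simpa using this

/-- The bound is independent of `b`, as `expVec_mem_of_tendsto` requires along a sequence of
switching patterns. -/
lemma norm_stepVec_ite_le (hJ : J ⊆ Set.Ici 0) {b : ℝ≥0 → Bool} (hb : IsLocStep b)
    {G G' : ℝ≥0 → k} (hG : IsBddStep G) (hG' : IsBddStep G') :
    ‖stepVec J fun s => if b s then G s else G' s‖ ≤ ‖stepVec J G‖ + ‖stepVec J G'‖ := by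
  have h0 : IsBddStep fun _ : ℝ≥0 => (0 : k) := ⟨isLocStep_const 0, 0, fun _ _ => rfl⟩
  have h1 : (fun s => if b s then G s else G' s) = fun s =>
      (if b s then G s else 0) + (if b s then 0 else G' s) := by
    funext s
    split_ifs <;> simp
  rw [h1, stepVec_add hJ (hG.ite hb h0) (h0.ite hb hG')]
  refine (norm_add_le _ _).trans (add_le_add ?_ ?_)
  · refine Lp.norm_le_norm_of_ae_le ?_
    filter_upwards [stepVec_coeFn hJ (hG.ite hb h0), stepVec_coeFn hJ hG] with s h2 h3
    rw [h2, h3]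
    split_ifs <;> simp
  · refine Lp.norm_le_norm_of_ae_le ?_
    filter_upwards [stepVec_coeFn hJ (h0.ite hb hG'), stepVec_coeFn hJ hG'] with s h2 h3
    rw [h2, h3]
    split_ifs <;> simp

/-- The step functions `g` such that the exponential vector of any function which is piecewise equal
to `g` or to a `T`-valued step function belongs to `M`. -/
def IsAdmissible (T : Set k) (J : Set ℝ) (M : Submodule ℂ (FockOn k J)) (g : ℝ≥0 → k) : Prop :=
  IsBddStep g ∧ ∀ b : ℝ≥0 → Bool, IsLocStep b → ∀ f : TStep T,
    expVec (stepVec J fun s => if b s then g s else f.toFun s) ∈ M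

variable {M : Submodule ℂ (FockOn k J)}

lemma isAdmissible_toFun (hM : ∀ f : TStep T, expVec (stepVec J f.toFun) ∈ M) (h : TStep T) :
    IsAdmissible T J M h.toFun :=
  ⟨h.isBddStep, fun b hb f => by rw [← TStep.toFun_ite hb]; exact hM _⟩

lemma IsBddStep.lineMap {g h : ℝ≥0 → k} (hg : IsBddStep g) (hh : IsBddStep h) (z : ℂ) :
    IsBddStep fun s => g s + z • (h s - g s) :=
  hg.map₂ hh (fun x y => x + z • (y - x)) (by simp)

/-- The mean of `g` and `h` is the weak limit of functions that switch between them ever faster.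
Such a function is still of the admissible form: it is `g` where `b` and the parity both hold, and
equals `TStep.ite hb h f` elsewhere. This is why admissibility quantifies over `b` and `f`. -/
lemma IsAdmissible.midpoint (hJ : J ⊆ Set.Ici 0) (hm : MeasurableSet J)
    (hMc : IsClosed (M : Set (FockOn k J))) {g : ℝ≥0 → k} (hg : IsAdmissible T J M g)
    (h : TStep T) : IsAdmissible T J M fun s => g s + (1 / 2 : ℂ) • (h.toFun s - g s) := by
  refine ⟨hg.1.lineMap h.isBddStep _, fun b hb f => ?_⟩
  have hG := hg.1.ite hb f.isBddStep
  have hG' := h.isBddStep.ite hb f.isBddStep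
  have h1 : (stepVec J fun s => if b s then g s + (1 / 2 : ℂ) • (h.toFun s - g s) else f.toFun s) =
      (1 / 2 : ℂ) • stepVec J (fun s => if b s then g s else f.toFun s) +
        (1 / 2 : ℂ) • stepVec J (fun s => if b s then h.toFun s else f.toFun s) := by
    rw [← stepVec_smul hJ hG, ← stepVec_smul hJ hG',
      ← stepVec_add hJ (hG.map₂ hG (fun x _ => (1 / 2 : ℂ) • x) (by simp))
        (hG'.map₂ hG (fun x _ => (1 / 2 : ℂ) • x) (by simp))]
    congr 1
    funext s
    split_ifs <;> module
  rw [h1]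
  refine expVec_mem_of_tendsto hMc (l := Filter.atTop)
    (Filter.Eventually.of_forall fun n => norm_stepVec_ite_le hJ (isLocStep_parity n) hG hG')
    (tendsto_inner_stepVec_parity hJ hm hG hG') fun n => ?_
  have h2 := hg.2 (fun s => b s && parity n s) (hb.map₂ (isLocStep_parity n) fun x y => x && y)
    (TStep.ite hb h f)
  rw [TStep.toFun_ite] at h2
  convert h2 using 3
  funext s
  beta_reduce
  cases b s <;> cases parity n s <;> simp

/-- Repeated midpoints reach the proportion `1 - 2^{-n}` of the way from `g` to `h`; analyticity in
`z` then gives every complex `z`. -/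
lemma IsAdmissible.lineMap (hJ : J ⊆ Set.Ici 0) (hm : MeasurableSet J)
    (hMc : IsClosed (M : Set (FockOn k J))) {g : ℝ≥0 → k} (hg : IsAdmissible T J M g)
    (h : TStep T) (z : ℂ) : IsAdmissible T J M fun s => g s + z • (h.toFun s - g s) := by
  have hpow : ∀ n : ℕ, IsAdmissible T J M fun s =>
      g s + (1 - (1 / 2 : ℂ) ^ n) • (h.toFun s - g s) := by
    intro n
    induction n with
    | zero => simpa using hg
    | succ n ih =>
      convert ih.midpoint hJ hm hMc h using 2
      rw [pow_succ]
      module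
  refine ⟨hg.1.lineMap h.isBddStep z, fun b hb f => ?_⟩
  have h0 : IsBddStep fun _ : ℝ≥0 => (0 : k) := ⟨isLocStep_const 0, 0, fun _ _ => rfl⟩
  have hG := hg.1.ite hb f.isBddStep
  have hG' := (h.isBddStep.map₂ hg.1 (fun x y => x - y) (sub_zero 0)).ite hb h0
  have h1 : ∀ z : ℂ, (stepVec J fun s => if b s then g s + z • (h.toFun s - g s) else f.toFun s) =
      stepVec J (fun s => if b s then g s else f.toFun s) +
        z • stepVec J (fun s => if b s then h.toFun s - g s else 0) := fun z => by
    rw [← stepVec_smul hJ hG',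
      ← stepVec_add hJ hG (hG'.map₂ hG (fun x _ => z • x) (by simp))]
    congr 1
    funext s
    split_ifs <;> simp
  rw [h1]
  refine expVec_mem_of_forall_pow hMc (fun n => ?_) z
  rw [← h1]
  exact (hpow n).2 b hb f

/-- The function `z g` lies on the complex line through `g` and `0`; here `0 ∈ T` is used. -/
lemma IsAdmissible.smul (hJ : J ⊆ Set.Ici 0) (hm : MeasurableSet J) (h0 : (0 : k) ∈ T)
    (hMc : IsClosed (M : Set (FockOn k J))) {g : ℝ≥0 → k} (hg : IsAdmissible T J M g) (z : ℂ) :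
    IsAdmissible T J M fun s => z • g s := by
  convert hg.lineMap hJ hm hMc (TStep.zero h0) (1 - z) using 2 with s
  have : (TStep.zero h0).toFun s = (0 : k) := rfl
  rw [this]
  module

/-- For `z ≠ 0` the sum is `2 z` times the midpoint of `z⁻¹ g` and `h`. -/
lemma IsAdmissible.add_smul (hJ : J ⊆ Set.Ici 0) (hm : MeasurableSet J) (h0 : (0 : k) ∈ T)
    (hMc : IsClosed (M : Set (FockOn k J))) {g : ℝ≥0 → k} (hg : IsAdmissible T J M g)
    (h : TStep T) (z : ℂ) : IsAdmissible T J M fun s => g s + z • h.toFun s := by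
  rcases eq_or_ne z 0 with rfl | hz
  · simpa using hg
  · convert ((hg.smul hJ hm h0 hMc z⁻¹).lineMap hJ hm hMc h (1 / 2)).smul hJ hm h0 hMc (2 * z)
      using 2 with s
    match_scalars <;> field_simp
    ring

/-- If `T` is total in `k` and contains `0`, then the exponential vectors of `T`-valued step
functions are total in Fock space. -/
theorem expVec_stepVec_total [CompleteSpace k] (hJ : J ⊆ Set.Ici 0) (hm : MeasurableSet J)
    (hT : (Submodule.span ℂ T).topologicalClosure = ⊤) (h0 : (0 : k) ∈ T) :
    (Submodule.span ℂ (Set.range fun f : TStep T =>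
      expVec (stepVec J f.toFun))).topologicalClosure = ⊤ := by
  set M := (Submodule.span ℂ (Set.range fun f : TStep T =>
      expVec (stepVec J f.toFun))).topologicalClosure with hMdef
  have hMc : IsClosed (M : Set (FockOn k J)) := Submodule.isClosed_topologicalClosure _
  have hM : ∀ f : TStep T, expVec (stepVec J f.toFun) ∈ M := fun f =>
    Submodule.le_topologicalClosure _ (Submodule.subset_span ⟨f, rfl⟩)
  -- Admissible functions absorb one `T`-valued summand at a time, so every finite combination is
  -- reached; such combinations are dense in `L²(J; k)`.
  have hcomb : ∀ c : TStep T →₀ ℂ, ∃ g : ℝ≥0 → k, IsAdmissible T J M g ∧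
      stepVec J g = Finsupp.linearCombination ℂ (fun f : TStep T => stepVec J f.toFun) c := by
    intro c
    induction c using Finsupp.induction with
    | zero =>
      refine ⟨fun s => (0 : ℂ) • (TStep.zero h0).toFun s,
        (isAdmissible_toFun hM _).smul hJ hm h0 hMc 0, ?_⟩
      rw [stepVec_smul hJ (TStep.isBddStep _), zero_smul, map_zero]
    | single_add f z c _ _ ih =>
      obtain ⟨g, hg, hgc⟩ := ih
      refine ⟨_, hg.add_smul hJ hm h0 hMc f z, ?_⟩
      rw [stepVec_add hJ hg.1 (f.isBddStep.map₂ hg.1 (fun x _ => z • x) (smul_zero z)),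
        stepVec_smul hJ f.isBddStep, hgc, map_add, Finsupp.linearCombination_single, add_comm]
  have hdense : DenseRange (Finsupp.linearCombination ℂ fun f : TStep T => stepVec J f.toFun) :=
    denseRange_linearCombination (stepVec_total hJ hm hT h0)
  have hall : ∀ p : NoiseL2 k J, expVec p ∈ M := by
    intro p
    obtain ⟨q, hq, hlim⟩ := mem_closure_iff_seq_limit.mp (hdense p)
    refine expVec_mem_of_tendsto hMc (l := Filter.atTop) (g := q) (R := ‖p‖ + 1) ?_
      (fun w => tendsto_const_nhds.inner hlim) fun n => ?_
    · exact hlim.norm.eventually_le_const (lt_add_one _)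
    · obtain ⟨c, hc⟩ := hq n
      obtain ⟨g, hg, hgc⟩ := hcomb c
      have := hg.2 (fun _ => true) (isLocStep_const _) (TStep.zero h0)
      simp only [if_true] at this
      rw [← hc, ← hgc]
      exact this
  refine eq_top_iff.mpr (expVec_total.symm.le.trans ?_)
  refine Submodule.topologicalClosure_minimal _ (Submodule.span_le.mpr ?_) hMc
  rintro _ ⟨p, rfl⟩
  exact hall p

lemma cohVec_stepVec_total [CompleteSpace k] (hJ : J ⊆ Set.Ici 0) (hm : MeasurableSet J)
    (hT : (Submodule.span ℂ T).topologicalClosure = ⊤) (h0 : (0 : k) ∈ T) :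
    (Submodule.span ℂ (Set.range fun f : TStep T =>
      cohVec (stepVec J f.toFun))).topologicalClosure = ⊤ := by
  rw [span_range_cohVec]
  exact expVec_stepVec_total hJ hm hT h0

end StepTotal

/-! ### Slices -/

section Slice

variable {H : Type*} [NormedAddCommGroup H] [InnerProductSpace ℂ H]
  {K : Type*} [NormedAddCommGroup K] [InnerProductSpace ℂ K]

lemma forall_of_total {κ : Type*} {b : κ → K}
    (hb : (Submodule.span ℂ (Set.range b)).topologicalClosure = ⊤) {p : K → Prop} (h0 : p 0)
    (hadd : ∀ x y, p x → p y → p (x + y)) (hsmul : ∀ (c : ℂ) x, p x → p (c • x))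
    (hc : IsClosed {x | p x}) (h : ∀ i, p (b i)) (x : K) : p x := by
  let M : Submodule ℂ K :=
    { carrier := {x | p x}
      add_mem' := fun {x y} hx hy => hadd x y hx hy
      zero_mem' := h0
      smul_mem' := fun c x hx => hsmul c x hx }
  have : (⊤ : Submodule ℂ K) ≤ M := by
    rw [← hb]
    refine Submodule.topologicalClosure_minimal _ (Submodule.span_le.mpr ?_) hc
    rintro _ ⟨i, rfl⟩
    exact h i
  exact this (Submodule.mem_top (x := x))

lemma ketR_add (x y : K) : ketR H (x + y) = ketR H x + ketR H y :=
  ContinuousLinearMap.ext fun u => map_add (ketL K u) x y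

lemma ketR_smul (c : ℂ) (x : K) : ketR H (c • x) = c • ketR H x :=
  ContinuousLinearMap.ext fun u => map_smul (ketL K u) c x

lemma continuous_ketR : Continuous (ketR H : K → H →L[ℂ] HTensor H K) := by
  let L : K →ₗ[ℂ] H →L[ℂ] HTensor H K :=
    { toFun := ketR H, map_add' := ketR_add, map_smul' := ketR_smul }
  exact (L.mkContinuous 1 fun x => ContinuousLinearMap.opNorm_le_bound _ (by positivity)
    fun u => by
      change ‖htmul u x‖ ≤ _
      rw [norm_htmul, one_mul, mul_comm]).continuous

variable [CompleteSpace H]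

lemma slice_add_left (x x' y : K) (T : HTensor H K →L[ℂ] HTensor H K) :
    slice (x + x') y T = slice x y T + slice x' y T := by
  simp [slice, ketR_add, ContinuousLinearMap.add_comp]

lemma slice_smul_left (c : ℂ) (x y : K) (T : HTensor H K →L[ℂ] HTensor H K) :
    slice (c • x) y T = (starRingEnd ℂ) c • slice x y T := by
  rw [slice, ketR_smul, map_smulₛₗ, ContinuousLinearMap.smul_comp, slice]

lemma slice_add_right (x y y' : K) (T : HTensor H K →L[ℂ] HTensor H K) :
    slice x (y + y') T = slice x y T + slice x y' T := by
  simp [slice, ketR_add, ContinuousLinearMap.comp_add]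

lemma slice_smul_right (c : ℂ) (x y : K) (T : HTensor H K →L[ℂ] HTensor H K) :
    slice x (c • y) T = c • slice x y T := by
  rw [slice, ketR_smul, ContinuousLinearMap.comp_smul, ContinuousLinearMap.comp_smul, slice]

lemma slice_zero_left (y : K) (T : HTensor H K →L[ℂ] HTensor H K) : slice 0 y T = 0 := by
  simpa using slice_smul_left 0 0 y T

lemma slice_zero_right (x : K) (T : HTensor H K →L[ℂ] HTensor H K) : slice x 0 T = 0 := by
  simpa using slice_smul_right 0 x 0 T

lemma continuous_slice_left (y : K) (T : HTensor H K →L[ℂ] HTensor H K) :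
    Continuous fun x => slice x y T :=
  (ContinuousLinearMap.adjoint.continuous.comp continuous_ketR).clm_comp continuous_const

lemma continuous_slice_right (x : K) (T : HTensor H K →L[ℂ] HTensor H K) :
    Continuous fun y => slice x y T :=
  continuous_const.clm_comp (continuous_const.clm_comp continuous_ketR)

variable {C : NonUnitalStarSubalgebra ℂ (H →L[ℂ] H)}

/-- Membership of a matrix space can be checked on slices by vectors from a total family. -/
lemma mem_matrixSpace_of_total (hC : IsClosed (C : Set (H →L[ℂ] H))) {κ : Type*} {b : κ → K}
    (hb : (Submodule.span ℂ (Set.range b)).topologicalClosure = ⊤)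
    {T : HTensor H K →L[ℂ] HTensor H K} (h : ∀ i j, slice (b i) (b j) T ∈ C) :
    T ∈ matrixSpace C K := by
  intro x y
  refine forall_of_total hb (p := fun x => slice x y T ∈ C) ?_ ?_ ?_
    (hC.preimage (continuous_slice_left y T)) (fun i => ?_) x
  · rw [slice_zero_left]; exact zero_mem C
  · intro x x' hx hx'; rw [slice_add_left]; exact add_mem hx hx'
  · intro c x hx; rw [slice_smul_left]; exact SMulMemClass.smul_mem _ hx
  refine forall_of_total hb (p := fun y => slice (b i) y T ∈ C) ?_ ?_ ?_
    (hC.preimage (continuous_slice_right (b i) T)) (h i) y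
  · rw [slice_zero_right]; exact zero_mem C
  · intro x x' hx hx'; rw [slice_add_right]; exact add_mem hx hx'
  · intro c x hx; rw [slice_smul_right]; exact SMulMemClass.smul_mem _ hx

end Slice

/-! ### Adapted operators -/

section Adapted

variable {H : Type v} [NormedAddCommGroup H] [InnerProductSpace ℂ H]
  {k : Type u} [NormedAddCommGroup k] [InnerProductSpace ℂ k]

lemma norm_sq_past_future (r : ℝ≥0) (f : NoiseL2 k (Set.Ici 0)) :
    ‖f‖ ^ 2 = ‖pastL2 r f‖ ^ 2 + ‖futureL2 r f‖ ^ 2 := by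
  have := inner_restrL2_add (Ico_subset_Ici r) (Ici_subset_Ici' r) (Ico_union_Ici' r)
      (disjoint_Ico_Ici r) measurableSet_Ici f f
  simp only [inner_self_eq_norm_sq_to_K] at this
  exact_mod_cast this

lemma inner_cohVec_past_future (r : ℝ≥0) (f g : NoiseL2 k (Set.Ici 0)) :
    inner ℂ (cohVec f) (cohVec g) = inner ℂ (cohVec (pastL2 r f)) (cohVec (pastL2 r g)) *
      inner ℂ (cohVec (futureL2 r f)) (cohVec (futureL2 r g)) := by
  have h1 : ∀ f g : NoiseL2 k (Set.Ici 0), inner ℂ f g =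
      inner ℂ (pastL2 r f) (pastL2 r g) + inner ℂ (futureL2 r f) (futureL2 r g) :=
    inner_restrL2_add (Ico_subset_Ici r) (Ici_subset_Ici' r) (Ico_union_Ici' r)
      (disjoint_Ico_Ici r) measurableSet_Ici
  have h2 : ∀ f : NoiseL2 k (Set.Ici 0), (‖f‖ : ℂ) ^ 2 =
      (‖pastL2 r f‖ : ℂ) ^ 2 + (‖futureL2 r f‖ : ℂ) ^ 2 := fun f => by
    exact_mod_cast norm_sq_past_future r f
  rw [inner_cohVec, inner_cohVec, inner_cohVec, ← Complex.exp_add, h1 f g, h2 f, h2 g]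
  congr 1
  ring

lemma htmul_smul_right {K : Type*} [NormedAddCommGroup K] [InnerProductSpace ℂ K] (c : ℂ) (u : H)
    (x : K) : htmul u (c • x) = c • htmul u x := map_smul (ketL K u) c x

lemma htmul_smul_left {K : Type*} [NormedAddCommGroup K] [InnerProductSpace ℂ K] (c : ℂ) (u : H)
    (x : K) : htmul (c • u) x = c • htmul u x := map_smul (ketR H x) c u

lemma fockSplit_htmul_cohVec (r : ℝ≥0) (u : H) (f : NoiseL2 k (Set.Ici 0)) :
    fockSplit H k r (htmul u (cohVec f)) =
      htmul (htmul u (cohVec (pastL2 r f))) (cohVec (futureL2 r f)) := by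
  rw [cohVec, htmul_smul_right, map_smul, fockSplit_htmul_expVec, cohVec, cohVec,
    htmul_smul_right, htmul_smul_right, htmul_smul_left, smul_smul]
  congr 1
  rw [← Complex.ofReal_mul, ← Real.exp_add, norm_sq_past_future r f]
  congr 2
  ring

lemma htmul_cohVec_total {κ : Type*} {J : Set ℝ} {f : κ → NoiseL2 k J}
    (hf : (Submodule.span ℂ (Set.range fun i => cohVec (f i))).topologicalClosure = ⊤) :
    (Submodule.span ℂ (Set.range fun p : H × κ => htmul p.1 (cohVec (f p.2)))).topologicalClosure
      = ⊤ :=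
  htmul_total (a := id) (b := fun i => cohVec (f i)) (span_range_id_top H) hf

lemma cohVec_total {J : Set ℝ} : (Submodule.span ℂ (Set.range
    (fun f : NoiseL2 k J => cohVec f))).topologicalClosure = ⊤ := by
  rw [span_range_cohVec]
  exact expVec_total

lemma inner_transport {K L : Type*} [NormedAddCommGroup K] [InnerProductSpace ℂ K]
    [NormedAddCommGroup L] [InnerProductSpace ℂ L] (U : K ≃ₗᵢ[ℂ] L) (T : K →L[ℂ] K) (x y : K) :
    inner ℂ (U x) (transport U T (U y)) = inner ℂ x (T y) := by
  have : transport U T (U y) = U (T (U.symm (U y))) := rfl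
  rw [this, U.symm_apply_apply, U.inner_map_map]

lemma inner_transport_symm {K L : Type*} [NormedAddCommGroup K] [InnerProductSpace ℂ K]
    [NormedAddCommGroup L] [InnerProductSpace ℂ L] (U : K ≃ₗᵢ[ℂ] L) (T : L →L[ℂ] L) (x y : K) :
    inner ℂ x (transport U.symm T y) = inner ℂ (U x) (T (U y)) := by
  rw [← inner_transport U.symm, U.symm_apply_apply, U.symm_apply_apply]

/-- Coherent vectors factor into past and future, and `Y ⊗ I` acts on the past only. -/
lemma inner_adaptedExt (r : ℝ≥0)
    (Y : HTensor H (FockOn k (Set.Ico 0 (r : ℝ))) →L[ℂ] HTensor H (FockOn k (Set.Ico 0 (r : ℝ))))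
    (u w : H) (f g : NoiseL2 k (Set.Ici 0)) :
    inner ℂ (htmul u (cohVec f)) (adaptedExt r Y (htmul w (cohVec g))) =
      inner ℂ (cohVec (futureL2 r f)) (cohVec (futureL2 r g)) *
      inner ℂ (htmul u (cohVec (pastL2 r f))) (Y (htmul w (cohVec (pastL2 r g)))) := by
  rw [adaptedExt, inner_transport_symm, fockSplit_htmul_cohVec, fockSplit_htmul_cohVec,
    ampliation_htmul, inner_htmul, mul_comm]

lemma adaptedExt_ext {S T : HTensor H (Fock k) →L[ℂ] HTensor H (Fock k)}
    (h : ∀ (u w : H) (f g : NoiseL2 k (Set.Ici 0)), inner ℂ (htmul u (cohVec f))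
      (S (htmul w (cohVec g))) = inner ℂ (htmul u (cohVec f)) (T (htmul w (cohVec g)))) : S = T :=
  clm_ext_inner_total (htmul_cohVec_total (f := id) cohVec_total) fun p q => h p.1 q.1 p.2 q.2

/-- The map `Y ↦ Y ⊗ I_{[r, ∞[}` as a linear map. -/
noncomputable def adaptedExtₗ (H : Type v) [NormedAddCommGroup H] [InnerProductSpace ℂ H]
    (k : Type u) [NormedAddCommGroup k] [InnerProductSpace ℂ k] (r : ℝ≥0) :
    (HTensor H (FockOn k (Set.Ico 0 (r : ℝ))) →L[ℂ] HTensor H (FockOn k (Set.Ico 0 (r : ℝ))))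
      →ₗ[ℂ] (HTensor H (Fock k) →L[ℂ] HTensor H (Fock k)) where
  toFun := adaptedExt r
  map_add' S T := adaptedExt_ext fun u w f g => by
    simp only [add_apply, inner_add_right, inner_adaptedExt, mul_add]
  map_smul' c T := adaptedExt_ext fun u w f g => by
    simp only [smul_apply, inner_smul_right, inner_adaptedExt, RingHom.id_apply]
    ring

@[simp] lemma adaptedExtₗ_apply (r : ℝ≥0)
    (Y : HTensor H (FockOn k (Set.Ico 0 (r : ℝ))) →L[ℂ] HTensor H (FockOn k (Set.Ico 0 (r : ℝ)))) :
    adaptedExtₗ H k r Y = adaptedExt r Y := rfl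

lemma adaptedExt_one (r : ℝ≥0) : adaptedExt (H := H) (k := k) r 1 = 1 :=
  adaptedExt_ext fun u w f g => by
    rw [inner_adaptedExt, one_apply_eq_self, one_apply_eq_self, inner_htmul, inner_htmul,
      inner_cohVec_past_future r f g]
    ring

/-- Between coherent vectors the entries of `Y ⊗ I` are those of `Y` times inner products of
futures. Once each index is repeated for every vector of a finite combination, positivity is Schur
multiplication by a Gram matrix. -/
lemma IsPosKernel.adaptedExt {ι : Type*} [Fintype ι] {r : ℝ≥0}
    {A : ι → ι → HTensor H (FockOn k (Set.Ico 0 (r : ℝ))) →L[ℂ]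
      HTensor H (FockOn k (Set.Ico 0 (r : ℝ)))} (hA : IsPosKernel A) :
    IsPosKernel fun i j => adaptedExt r (A i j) := by
  refine isPosKernel_of_total (htmul_cohVec_total (f := id) cohVec_total) fun s c => ?_
  have hG := Matrix.posSemidef_gram ℂ fun q : ι × s => cohVec (futureL2 r q.2.1.2)
  refine ((hA.comp (Prod.fst : ι × s → ι)).schur hG fun q =>
    c q.1 q.2 • htmul q.2.1.1 (cohVec (pastL2 r q.2.1.2))).trans_eq ?_
  simp_rw [← Finset.sum_coe_sort s]
  rw [Fintype.sum_prod_type]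
  refine Finset.sum_congr rfl fun i _ => ?_
  simp only [Fintype.sum_prod_type]
  rw [Finset.sum_comm]
  refine Finset.sum_congr rfl fun j _ => Finset.sum_congr rfl fun p _ =>
    Finset.sum_congr rfl fun q _ => ?_
  simp only [Matrix.gram_apply, smul_apply, map_smul, inner_smul_left, inner_smul_right, id,
    inner_adaptedExt]
  ring

variable [CompleteSpace H] {C : NonUnitalStarSubalgebra ℂ (H →L[ℂ] H)}

lemma slice_adaptedExt (r : ℝ≥0)
    (Y : HTensor H (FockOn k (Set.Ico 0 (r : ℝ))) →L[ℂ] HTensor H (FockOn k (Set.Ico 0 (r : ℝ))))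
    (f g : NoiseL2 k (Set.Ici 0)) :
    slice (cohVec f) (cohVec g) (adaptedExt r Y) =
      inner ℂ (cohVec (futureL2 r f)) (cohVec (futureL2 r g)) •
        slice (cohVec (pastL2 r f)) (cohVec (pastL2 r g)) Y := by
  refine ContinuousLinearMap.ext fun w => ext_inner_left ℂ fun u => ?_
  rw [inner_slice, inner_adaptedExt, smul_apply, inner_smul_right, inner_slice]

lemma adaptedExt_mem_matrixSpace (hC : IsClosed (C : Set (H →L[ℂ] H))) {r : ℝ≥0}
    {Y : HTensor H (FockOn k (Set.Ico 0 (r : ℝ))) →L[ℂ] HTensor H (FockOn k (Set.Ico 0 (r : ℝ)))}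
    (hY : Y ∈ matrixSpace C (FockOn k (Set.Ico 0 (r : ℝ)))) :
    adaptedExt r Y ∈ matrixSpace C (Fock k) :=
  mem_matrixSpace_of_total hC cohVec_total fun f g => by
    rw [slice_adaptedExt]
    exact SMulMemClass.smul_mem _ (hY _ _)

end Adapted

/-! ### Operators reconstructed from evolutions -/

section Reconstruction

variable {H : Type v} [NormedAddCommGroup H] [InnerProductSpace ℂ H]
  {k : Type u} [NormedAddCommGroup k] [InnerProductSpace ℂ k] {T : Set k}

lemma posSemidef_const (κ : Type*) [Fintype κ] {r : ℝ} (hr : 0 ≤ r) :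
    (Matrix.of fun _ _ : κ => (r : ℂ)).PosSemidef := by
  have h := Matrix.posSemidef_vecMulVec_self_star fun _ : κ => ((√r : ℝ) : ℂ)
  have h' : Matrix.vecMulVec (fun _ : κ => ((√r : ℝ) : ℂ)) (star fun _ : κ => ((√r : ℝ) : ℂ)) =
      Matrix.of fun _ _ => (r : ℂ) := by
    ext i j
    rw [Matrix.vecMulVec_apply, Pi.star_apply, Complex.star_def, Complex.conj_ofReal,
      ← Complex.ofReal_mul, Real.mul_self_sqrt hr, Matrix.of_apply]
  rwa [h'] at h

lemma kernelForm_eq_sum {κ : Type*} (F : κ → κ → ℂ) (c : κ →₀ ℂ) :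
    kernelForm F c c =
      ∑ p : c.support, ∑ q : c.support, (starRingEnd ℂ) (c p) * c q * F p q := by
  rw [kernelForm, Finsupp.sum, ← Finset.sum_coe_sort]
  refine Finset.sum_congr rfl fun p _ => ?_
  rw [Finsupp.sum, ← Finset.sum_coe_sort]

lemma inner_linearCombination_self {κ K : Type*} [NormedAddCommGroup K] [InnerProductSpace ℂ K]
    (b : κ → K) (c : κ →₀ ℂ) : ((‖Finsupp.linearCombination ℂ b c‖ : ℂ)) ^ 2 =
      ∑ p : c.support, ∑ q : c.support, (starRingEnd ℂ) (c p) * c q * inner ℂ (b p) (b q) := by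
  have := inner_self_eq_norm_sq_to_K (𝕜 := ℂ) (Finsupp.linearCombination ℂ b c)
  refine this.symm.trans ?_
  rw [Finsupp.linearCombination_apply, Finsupp.sum, ← Finset.sum_coe_sort, sum_inner]
  refine Finset.sum_congr rfl fun p _ => ?_
  rw [inner_sum]
  refine Finset.sum_congr rfl fun q _ => ?_
  rw [inner_smul_left, inner_smul_right]
  ring

lemma kernelForm_nonneg {κ : Type*} (u : κ → H) (B : κ → κ → H →L[ℂ] H) (c : κ →₀ ℂ)
    (h : IsPosKernel fun p q : c.support => B p q) :
    0 ≤ kernelForm (fun p q => inner ℂ (u p) (B p q (u q))) c c := by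
  refine (h fun p => c p • u p).trans_eq ?_
  rw [kernelForm_eq_sum]
  refine Finset.sum_congr rfl fun p _ => Finset.sum_congr rfl fun q _ => ?_
  rw [map_smul, inner_smul_left, inner_smul_right]
  ring

/-- The form of the kernel `r ⟪w p, w q⟫ • 1` at the vectors `c p • u p` is exactly `r` times the
squared norm of the combination of the tensors `u p ⊗ w p`. An upper bound by a Gram matrix thus
becomes a bound for a form on `H ⊗ K`. -/
lemma kernelForm_le {κ K : Type*} [NormedAddCommGroup K] [InnerProductSpace ℂ K] (u : κ → H)
    (w : κ → K) (B : κ → κ → H →L[ℂ] H) (r : ℝ) (c : κ →₀ ℂ)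
    (h : IsPosKernel fun p q : c.support =>
      ((r : ℂ) * inner ℂ (w p) (w q)) • (1 : H →L[ℂ] H) - B p q) :
    kernelForm (fun p q => inner ℂ (u p) (B p q (u q))) c c ≤
      ((r * ‖Finsupp.linearCombination ℂ (fun p => htmul (u p) (w p)) c‖ ^ 2 : ℝ) : ℂ) := by
  rw [← sub_nonneg]
  refine (kernelForm_nonneg u (fun p q => ((r : ℂ) * inner ℂ (w p) (w q)) • (1 : H →L[ℂ] H) -
    B p q) c h).trans_eq ?_
  rw [Complex.ofReal_mul, Complex.ofReal_pow, kernelForm_eq_sum, kernelForm_eq_sum,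
    inner_linearCombination_self, Finset.mul_sum,
    ← Finset.sum_sub_distrib]
  refine Finset.sum_congr rfl fun p _ => ?_
  rw [Finset.mul_sum, ← Finset.sum_sub_distrib]
  refine Finset.sum_congr rfl fun q _ => ?_
  rw [sub_apply, smul_apply, one_apply_eq_self, inner_sub_right, inner_smul_right, inner_htmul]
  ring

/-- The coherent vector of a step function on `[0, t[`. -/
noncomputable def pastCoh (t : ℝ≥0) (f : TStep T) : FockOn k (Set.Ico 0 (t : ℝ)) :=
  cohVec (stepVec (Set.Ico 0 (t : ℝ)) f.toFun)

lemma htmul_pastCoh_total [CompleteSpace k] (t : ℝ≥0)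
    (hT : (Submodule.span ℂ T).topologicalClosure = ⊤) (h0 : (0 : k) ∈ T) :
    (Submodule.span ℂ (Set.range fun p : H × TStep T =>
      htmul p.1 (pastCoh t p.2))).topologicalClosure = ⊤ :=
  htmul_total (a := id) (b := pastCoh t) (span_range_id_top H)
    (cohVec_stepVec_total (Ico_subset_Ici t) measurableSet_Ico hT h0)

variable [CompleteSpace H]
  {C : NonUnitalStarSubalgebra ℂ (H →L[ℂ] H)} {P : T → T → ℝ≥0 → C →ₗ[ℂ] C}

/-- The Schur-action maps of the family `P` respect the order intervals `[0, I ⊗ lam]`. -/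
def PreservesOrderIntervals (P : T → T → ℝ≥0 → C →ₗ[ℂ] C) : Prop :=
  ∀ (n : ℕ), 1 ≤ n → ∀ (x : Fin n → T) (lam : Matrix (Fin n) (Fin n) ℂ), lam.PosSemidef →
    ∀ t : ℝ≥0, Set.MapsTo (schurMap P x t) (orderInterval C (idTensor H lam))
      (orderInterval C (idTensor H (lam.hadamard (gramMat (fun i => (x i : k)) t))))

/-- Finitely many step functions share a subdivision of `[0, t[`; along it, the exponential factors
of `isPosKernel_evolution` are the inner products of the coherent vectors. -/
lemma isPosKernel_evolutionAt (hP : ∀ x y, IsSemigroup (P x y)) (hord : PreservesOrderIntervals P)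
    {κ : Type*} [Fintype κ] {lam : Matrix κ κ ℂ} (hlam : lam.PosSemidef) {A : κ → κ → C}
    (hA : IsPosKernel fun i j => (A i j : H →L[ℂ] H))
    (hA' : IsPosKernel fun i j => lam i j • (1 : H →L[ℂ] H) - (A i j : H →L[ℂ] H))
    (t : ℝ≥0) (f : κ → TStep T) :
    IsPosKernel (fun i j => (evolutionAt P t (f i).1 (f j).1 (A i j) : H →L[ℂ] H)) ∧
    IsPosKernel (fun i j => (lam i j * inner ℂ (pastCoh t (f i)) (pastCoh t (f j))) •
      (1 : H →L[ℂ] H) - (evolutionAt P t (f i).1 (f j).1 (A i j) : H →L[ℂ] H)) := by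
  obtain ⟨D, rfl, hD⟩ := exists_adaptedTo_finset (fun i => (f i).2.1) Finset.univ t
  have hD' : ∀ i, AdaptedTo D (f i).1 := fun i => hD i (Finset.mem_univ i)
  have h1 : ∀ i j, evolutionAt P D.sum (f i).1 (f j).1 = evolution P D (f i).1 (f j).1 :=
    fun i j => evolutionAt_eq hP (hD' i) (hD' j)
  have h2 : ∀ i j, inner ℂ (pastCoh D.sum (f i)) (pastCoh D.sum (f j)) =
      Complex.exp (-stepSum D fun s => chiForm ((f i).1 s : k) ((f j).1 s)) := fun i j =>
    inner_cohVec_stepVec_Ico (f i).isBddStep (f j).isBddStep ((hD' i).map Subtype.val)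
      ((hD' j).map Subtype.val)
  simp only [h1, h2]
  exact isPosKernel_evolution hord hlam hA hA' D fun i => (f i).1

variable (P) in
/-- The kernel of the operator which the reconstruction assigns to `a`. -/
noncomputable def evolutionKernel (t : ℝ≥0) (a : C) (p q : H × TStep T) : ℂ :=
  inner ℂ p.1 ((evolutionAt P t p.2.1 q.2.1 a : H →L[ℂ] H) q.1)

/-- Since `0 ≤ a ≤ ‖a‖`, the matrix with all entries `a` lies below `‖a‖` times the all-ones matrix.
The resulting bound is `‖a‖` times the Gram matrix of the coherent vectors, and so `‖a‖` times the
squared norm in `H ⊗ 𝓕_{[0, t[}`. -/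
lemma norm_kernelForm_evolutionKernel_le_of_nonneg (hP : ∀ x y, IsSemigroup (P x y))
    (hord : PreservesOrderIntervals P) (t : ℝ≥0) {a : C} (ha : 0 ≤ (a : H →L[ℂ] H))
    (c : H × TStep T →₀ ℂ) :
    ‖kernelForm (evolutionKernel P t a) c c‖ ≤ ‖a‖ *
      ‖Finsupp.linearCombination ℂ (fun p : H × TStep T => htmul p.1 (pastCoh t p.2)) c‖ ^ 2 := by
  have ha' : 0 ≤ (‖a‖ : ℂ) • (1 : H →L[ℂ] H) - (a : H →L[ℂ] H) := by
    have := (IsSelfAdjoint.of_nonneg ha).le_algebraMap_norm_self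
    rw [Algebra.algebraMap_eq_smul_one] at this
    rw [sub_nonneg]
    exact this
  have ha'' : IsPosKernel fun i j : c.support => (Matrix.of fun _ _ : c.support => (‖a‖ : ℂ)) i j •
      (1 : H →L[ℂ] H) - (a : H →L[ℂ] H) := by
    simp only [Matrix.of_apply]
    exact isPosKernel_const ha'
  obtain ⟨h1, h2⟩ := isPosKernel_evolutionAt (A := fun _ _ => a) hP hord
    (posSemidef_const c.support (norm_nonneg a)) (isPosKernel_const ha) ha''
    t fun p : c.support => p.1.2
  have h5 : 0 ≤ kernelForm (evolutionKernel P t a) c c :=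
    kernelForm_nonneg (fun p : H × TStep T => p.1)
      (fun p q => (evolutionAt P t p.2.1 q.2.1 a : H →L[ℂ] H)) c h1
  simp only [Matrix.of_apply] at h2
  have h6 := kernelForm_le (fun p : H × TStep T => p.1) (fun p => pastCoh t p.2)
      (fun p q => (evolutionAt P t p.2.1 q.2.1 a : H →L[ℂ] H)) ‖a‖ c h2
  refine (CStarAlgebra.norm_le_norm_of_nonneg_of_le h5 h6).trans_eq ?_
  rw [Complex.norm_real, Real.norm_of_nonneg (by positivity)]

/-- The four positive parts extend the bound from positive elements to all of `C`, and
`exists_clm_of_kernel` produces the operators. These are determined by their coherent matrix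
entries, so they depend linearly on `a`. -/
lemma exists_evolutionOp [CompleteSpace k] (hC : IsClosed (C : Set (H →L[ℂ] H)))
    (hT : (Submodule.span ℂ T).topologicalClosure = ⊤) (h0 : (0 : k) ∈ T)
    (hP : ∀ x y, IsSemigroup (P x y)) (hord : PreservesOrderIntervals P) (t : ℝ≥0) :
    ∃ Y : C →ₗ[ℂ] HTensor H (FockOn k (Set.Ico 0 (t : ℝ))) →L[ℂ]
        HTensor H (FockOn k (Set.Ico 0 (t : ℝ))),
      ∀ (a : C) (u v : H) (f g : TStep T),
        inner ℂ (htmul u (pastCoh t f)) (Y a (htmul v (pastCoh t g))) =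
          inner ℂ u ((evolutionAt P t f.1 g.1 a : H →L[ℂ] H) v) := by
  have hb := htmul_pastCoh_total (H := H) t hT h0
  have hbound : ∀ (a : C) c, ‖kernelForm (evolutionKernel P t a) c c‖ ≤ (4 * ‖a‖) *
      ‖Finsupp.linearCombination ℂ (fun p : H × TStep T => htmul p.1 (pastCoh t p.2)) c‖ ^ 2 := by
    intro a c
    obtain ⟨x, h1, h2, h3⟩ := clm_nonneg_of_nonneg hC a
    have h4 : kernelForm (evolutionKernel P t a) c c =
        ∑ i : Fin 4, Complex.I ^ (i : ℕ) * kernelForm (evolutionKernel P t (x i)) c c := by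
      simp only [kernelForm_eq_sum, Finset.mul_sum]
      refine Eq.trans ?_ Finset.sum_comm
      refine Finset.sum_congr rfl fun p _ => Eq.trans ?_ Finset.sum_comm
      refine Finset.sum_congr rfl fun q _ => ?_
      rw [evolutionKernel]
      nth_rewrite 1 [h3]
      simp only [evolutionKernel, map_sum, map_smul, AddSubmonoidClass.coe_finsetSum,
        sum_apply, inner_sum, Finset.mul_sum]
      refine Finset.sum_congr rfl fun i _ => ?_
      have : ∀ z : ℂ, ∀ y : C, ((z • y : C) : H →L[ℂ] H) = z • (y : H →L[ℂ] H) := fun _ _ => rfl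
      rw [this, smul_apply, inner_smul_right]
      ring
    rw [h4]
    refine (norm_sum_le _ _).trans ((Finset.sum_le_card_nsmul _ _ (‖a‖ *
      ‖Finsupp.linearCombination ℂ (fun p : H × TStep T => htmul p.1 (pastCoh t p.2)) c‖ ^ 2)
      fun i _ => ?_).trans_eq ?_)
    · rw [norm_mul, norm_pow, Complex.norm_I, one_pow, one_mul]
      exact (norm_kernelForm_evolutionKernel_le_of_nonneg hP hord t (h1 i) c).trans
        (mul_le_mul_of_nonneg_right (h2 i) (by positivity))
    · simp only [Finset.card_univ, Fintype.card_fin, nsmul_eq_mul]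
      push_cast
      ring
  choose Y hY using fun a => exists_clm_of_kernel hb ⟨_, hbound a⟩
  refine ⟨{ toFun := Y, map_add' := fun a a' => ?_, map_smul' := fun z a => ?_ },
    fun a u v f g => hY a (u, f) (v, g)⟩
  · refine clm_ext_inner_total hb fun p q => ?_
    rw [add_apply, inner_add_right, hY, hY, hY]
    simp only [evolutionKernel, map_add]
    exact inner_add_right _ _ _
  · refine clm_ext_inner_total hb fun p q => ?_
    rw [RingHom.id_apply, smul_apply, inner_smul_right, hY, hY]
    simp only [evolutionKernel, map_smul]
    exact inner_smul_right _ _ _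

end Reconstruction

/-! ### Complete positivity and contractivity of the reconstructed maps -/

section EvolutionOp

variable {H : Type v} [NormedAddCommGroup H] [InnerProductSpace ℂ H] [CompleteSpace H]
  {k : Type u} [NormedAddCommGroup k] [InnerProductSpace ℂ k] {T : Set k}
  {C : NonUnitalStarSubalgebra ℂ (H →L[ℂ] H)} {P : T → T → ℝ≥0 → C →ₗ[ℂ] C} {t : ℝ≥0}
  {Y : C →ₗ[ℂ] HTensor H (FockOn k (Set.Ico 0 (t : ℝ))) →L[ℂ]
    HTensor H (FockOn k (Set.Ico 0 (t : ℝ)))}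

/-- `Y` is the map into `B(H ⊗ 𝓕_{[0, t[})` whose coherent slices are the evolutions
generated by `P`. -/
def IsEvolutionOp (P : T → T → ℝ≥0 → C →ₗ[ℂ] C) (t : ℝ≥0)
    (Y : C →ₗ[ℂ] HTensor H (FockOn k (Set.Ico 0 (t : ℝ))) →L[ℂ]
      HTensor H (FockOn k (Set.Ico 0 (t : ℝ)))) : Prop :=
  ∀ (a : C) (u v : H) (f g : TStep T),
    inner ℂ (htmul u (pastCoh t f)) (Y a (htmul v (pastCoh t g))) =
      inner ℂ u ((evolutionAt P t f.1 g.1 a : H →L[ℂ] H) v)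

lemma IsEvolutionOp.slice_eq (hY : IsEvolutionOp P t Y) (a : C) (f g : TStep T) :
    slice (pastCoh t f) (pastCoh t g) (Y a) = (evolutionAt P t f.1 g.1 a : H →L[ℂ] H) :=
  ContinuousLinearMap.ext fun v => ext_inner_left ℂ fun u => by rw [inner_slice, hY]

lemma norm_matOp_fin_one {L : Type*} [NormedAddCommGroup L] [InnerProductSpace ℂ L]
    (Z : L →L[ℂ] L) : ‖matOp (Matrix.of fun _ _ : Fin 1 => Z)‖ = ‖Z‖ := by
  have h : ∀ u : PiLp 2 (fun _ : Fin 1 => L), ‖u‖ = ‖u 0‖ := fun u => by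
    simp [PiLp.norm_eq_of_L2]
  refine le_antisymm (ContinuousLinearMap.opNorm_le_bound _ (norm_nonneg _) fun u => ?_)
    (ContinuousLinearMap.opNorm_le_bound _ (by positivity) fun x => ?_)
  · rw [h, h u, matOp_apply]
    simpa using Z.le_opNorm (u 0)
  · have h1 := (matOp (Matrix.of fun _ _ : Fin 1 => Z)).le_opNorm (WithLp.toLp 2 fun _ => x)
    rw [h, h, matOp_apply] at h1
    simpa using h1

/-- A positive matrix over `C` is dominated by a positive scalar matrix. -/
lemma exists_le_smul_one {n : ℕ} {A : Fin n → Fin n → C} :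
    ∃ lam : Matrix (Fin n) (Fin n) ℂ, lam.PosSemidef ∧ (IsPosKernel (fun i j => (A i j : H →L[ℂ] H))
      → IsPosKernel fun i j => lam i j • (1 : H →L[ℂ] H) - (A i j : H →L[ℂ] H)) := by
  set M := matOp (coeMat (Matrix.of A)) with hM
  refine ⟨(‖M‖ : ℂ) • 1, Matrix.PosSemidef.one.smul (Complex.zero_le_real.mpr (norm_nonneg _)),
    fun hA => ?_⟩
  have h0 : 0 ≤ M := (matOp_nonneg_iff _).mpr hA
  have h1 := (IsSelfAdjoint.of_nonneg h0).le_algebraMap_norm_self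
  have h2 : algebraMap ℝ _ ‖M‖ =
      matOp (idTensor H ((‖M‖ : ℂ) • (1 : Matrix (Fin n) (Fin n) ℂ))) := by
    rw [Algebra.algebraMap_eq_smul_one]
    ext u i
    rw [matOp_apply, Finset.sum_eq_single i (fun j _ hj => by simp [idTensor, hj.symm]) (by simp)]
    simp [idTensor]
  rw [h2, hM, matOp_le_iff] at h1
  exact h1

variable [CompleteSpace k]

/-- On combinations over a finite set `s` of elementary tensors, the matrix over `ι` becomes one
over `ι × s` with repeated entries, to which `isPosKernel_evolutionAt` applies. The Gram factor in
its upper bound is accounted for by the inner products of the coherent vectors, which leaves `lam`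
itself. -/
lemma IsEvolutionOp.isPosKernel (hY : IsEvolutionOp P t Y)
    (hT : (Submodule.span ℂ T).topologicalClosure = ⊤) (h0 : (0 : k) ∈ T)
    (hP : ∀ x y, IsSemigroup (P x y)) (hord : PreservesOrderIntervals P)
    {ι : Type*} [Fintype ι] {lam : Matrix ι ι ℂ} (hlam : lam.PosSemidef) {A : ι → ι → C}
    (hA : IsPosKernel fun i j => (A i j : H →L[ℂ] H))
    (hA' : IsPosKernel fun i j => lam i j • (1 : H →L[ℂ] H) - (A i j : H →L[ℂ] H)) :
    IsPosKernel (fun i j => Y (A i j)) ∧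
    IsPosKernel fun i j => lam i j • (1 : HTensor H (FockOn k (Set.Ico 0 (t : ℝ))) →L[ℂ]
      HTensor H (FockOn k (Set.Ico 0 (t : ℝ)))) - Y (A i j) := by
  have hb := htmul_pastCoh_total (H := H) t hT h0
  have main : ∀ (s : Finset (H × TStep T)) (c : ι → H × TStep T → ℂ), _ := fun s c =>
    isPosKernel_evolutionAt (κ := ι × s) (lam := lam.submatrix Prod.fst Prod.fst)
      (A := fun p q => A p.1 q.1) hP hord (hlam.submatrix Prod.fst)
      (hA.comp Prod.fst) (hA'.comp Prod.fst) t fun p => p.2.1.2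
  refine ⟨isPosKernel_of_total hb fun s c => ?_, isPosKernel_of_total hb fun s c => ?_⟩
  · refine ((main s c).1 fun p => c p.1 p.2 • p.2.1.1).trans_eq ?_
    simp_rw [← Finset.sum_coe_sort s]
    rw [Fintype.sum_prod_type]
    refine Finset.sum_congr rfl fun i _ => ?_
    simp only [Fintype.sum_prod_type]
    rw [Finset.sum_comm]
    refine Finset.sum_congr rfl fun j _ => Finset.sum_congr rfl fun p _ =>
      Finset.sum_congr rfl fun q _ => ?_
    rw [map_smul, map_smul, inner_smul_left, inner_smul_right, inner_smul_left, inner_smul_right,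
      hY]
  · refine ((main s c).2 fun p => c p.1 p.2 • p.2.1.1).trans_eq ?_
    simp_rw [← Finset.sum_coe_sort s]
    rw [Fintype.sum_prod_type]
    refine Finset.sum_congr rfl fun i _ => ?_
    simp only [Fintype.sum_prod_type]
    rw [Finset.sum_comm]
    refine Finset.sum_congr rfl fun j _ => Finset.sum_congr rfl fun p _ =>
      Finset.sum_congr rfl fun q _ => ?_
    rw [map_smul, map_smul, inner_smul_left, inner_smul_right, inner_smul_left, inner_smul_right,
      sub_apply, sub_apply, inner_sub_right, inner_sub_right, hY, smul_apply, smul_apply,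
      one_apply_eq_self, one_apply_eq_self, inner_smul_right, inner_smul_right, inner_htmul,
      Matrix.submatrix_apply]
    ring

/-- The order condition concerns bounded intervals, so a positive matrix is first placed below some
`lam ⊗ 1`. -/
lemma IsEvolutionOp.isCPMap (hY : IsEvolutionOp P t Y)
    (hT : (Submodule.span ℂ T).topologicalClosure = ⊤) (h0 : (0 : k) ∈ T)
    (hP : ∀ x y, IsSemigroup (P x y)) (hord : PreservesOrderIntervals P) : IsCPMap Y :=
  fun _ A hA =>
    have ⟨_, hlam, h⟩ := exists_le_smul_one (A := A)
    (hY.isPosKernel hT h0 hP hord hlam hA (h hA)).1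

lemma IsEvolutionOp.map_le_one (hY : IsEvolutionOp P t Y)
    (hT : (Submodule.span ℂ T).topologicalClosure = ⊤) (h0 : (0 : k) ∈ T)
    (hP : ∀ x y, IsSemigroup (P x y)) (hord : PreservesOrderIntervals P) {a : C}
    (ha : 0 ≤ (a : H →L[ℂ] H)) (ha' : (a : H →L[ℂ] H) ≤ 1) : 0 ≤ Y a ∧ Y a ≤ 1 := by
  have h := hY.isPosKernel hT h0 hP hord (ι := Unit) (Matrix.PosSemidef.one)
    (A := fun _ _ => a) ((isPosKernel_unit _).mpr ha) (by
      simp only [Matrix.one_apply_eq, one_smul]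
      exact (isPosKernel_unit _).mpr (sub_nonneg.mpr ha'))
  simp only [Matrix.one_apply_eq, one_smul] at h
  exact ⟨(isPosKernel_unit _).mp h.1, sub_nonneg.mp ((isPosKernel_unit _).mp h.2)⟩

lemma IsEvolutionOp.mem_matrixSpace (hY : IsEvolutionOp P t Y)
    (hC : IsClosed (C : Set (H →L[ℂ] H)))
    (hT : (Submodule.span ℂ T).topologicalClosure = ⊤) (h0 : (0 : k) ∈ T) (a : C) :
    Y a ∈ matrixSpace C (FockOn k (Set.Ico 0 (t : ℝ))) :=
  mem_matrixSpace_of_total hC (b := pastCoh (T := T) t)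
    (cohVec_stepVec_total (Ico_subset_Ici t) measurableSet_Ico hT h0) fun f g => by
      rw [hY.slice_eq]
      exact SetLike.coe_mem _

/-- Continuity comes first, from the crude constant 4; it makes the complete contractivity result
available, whose `1 × 1` case gives `‖j‖ ≤ 1`. -/
lemma IsEvolutionOp.exists_process (hY : IsEvolutionOp P t Y)
    (hC : IsClosed (C : Set (H →L[ℂ] H)))
    (hT : (Submodule.span ℂ T).topologicalClosure = ⊤) (h0 : (0 : k) ∈ T)
    (hP : ∀ x y, IsSemigroup (P x y)) (hord : PreservesOrderIntervals P) :
    ∃ j : C →L[ℂ] matrixSpace C (Fock k), (∀ a, (j a).1 = adaptedExt t (Y a)) ∧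
      IsCompletelyPositive j ∧ IsCompletelyBounded j ∧ ‖j‖ ≤ 1 := by
  have h1 : ∀ a : C, 0 ≤ (a : H →L[ℂ] H) → (a : H →L[ℂ] H) ≤ 1 →
      0 ≤ (adaptedExtₗ H k t ∘ₗ Y) a ∧ (adaptedExtₗ H k t ∘ₗ Y) a ≤ 1 := fun a ha ha' => by
    obtain ⟨h2, h3⟩ := hY.map_le_one hT h0 hP hord ha ha'
    have h4 := fun {Z} (hZ : 0 ≤ Z) => (isPosKernel_unit _).mp
      (IsPosKernel.adaptedExt (H := H) (k := k) (r := t) (A := fun _ _ => Z)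
        ((isPosKernel_unit _).mpr hZ))
    refine ⟨h4 h2, sub_nonneg.mp ?_⟩
    have h5 := h4 (sub_nonneg.mpr h3)
    rw [← adaptedExtₗ_apply, map_sub, adaptedExtₗ_apply, adaptedExt_one] at h5
    exact h5
  let J : C →ₗ[ℂ] matrixSpace C (Fock k) :=
    (adaptedExtₗ H k t ∘ₗ Y).codRestrict (matrixSpace C (Fock k)) fun a =>
      adaptedExt_mem_matrixSpace hC (hY.mem_matrixSpace hC hT h0 a)
  let j : C →L[ℂ] matrixSpace C (Fock k) :=
    J.mkContinuous 4 fun a => norm_apply_le_four_mul hC (adaptedExtₗ H k t ∘ₗ Y) h1 a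
  have hj : ∀ a, (j a).1 = adaptedExt t (Y a) := fun a => rfl
  have hcp : IsCPMap (toOpMap j) := fun n A hA =>
    IsPosKernel.adaptedExt (hY.isCPMap hT h0 hP hord n A hA)
  have h6 : ∀ e : C, star e = e → ‖e‖ ≤ 1 → toOpMap j (e * e) ≤ 1 := fun e he hn => by
    have h7 : 0 ≤ ((e * e : C) : H →L[ℂ] H) := by
      nth_rewrite 1 [← he]
      exact star_mul_self_nonneg (e : H →L[ℂ] H)
    exact (h1 _ h7 (clm_le_one_of_norm_le_one ((norm_mul_le _ _).trans
      (mul_le_one₀ hn (norm_nonneg _) hn)) h7)).2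
  have h8 : ∀ (n : ℕ) (A : Matrix (Fin n) (Fin n) C),
      ‖matOp (matLift j A)‖ ≤ ‖matOp (coeMat A)‖ := fun n A =>
    hcp.norm_matOp_le hC (continuous_toOpMap j) h6 A
  refine ⟨j, hj, (isCPMap_toOpMap_iff j).mp hcp, ⟨1, fun n A => by rw [one_mul]; exact h8 n A⟩,
    ContinuousLinearMap.opNorm_le_bound _ zero_le_one fun a => ?_⟩
  rw [one_mul]
  have h9 := h8 1 (Matrix.of fun _ _ => a)
  have h10 : matLift j (Matrix.of fun _ _ : Fin 1 => a) = Matrix.of fun _ _ => (j a).1 := rfl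
  have h11 : coeMat (Matrix.of fun _ _ : Fin 1 => a) = Matrix.of fun _ _ => (a : H →L[ℂ] H) := rfl
  rw [h10, h11, norm_matOp_fin_one, norm_matOp_fin_one] at h9
  exact h9

end EvolutionOp

/-! ### Restrictions and shifts of step functions -/

section StepRestriction

variable {k : Type u} [NormedAddCommGroup k] [InnerProductSpace ℂ k] {T : Set k}

/-- The interval `[0, 0[` is empty, so all pasts coincide. -/
lemma cohVec_pastL2_zero (h0 : (0 : k) ∈ T) (f : NoiseL2 k (Set.Ici 0)) :
    cohVec (pastL2 0 f) = pastCoh 0 (TStep.zero h0) := by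
  refine congrArg cohVec (Lp.ext ?_)
  filter_upwards [ae_restrict_mem measurableSet_Ico] with s hs
  exact absurd hs.2 (not_lt.mpr hs.1)

lemma pastL2_stepVec_concat (r : ℝ≥0) (p f : TStep T) :
    pastL2 r (stepVec (Set.Ici 0) (TStep.concat r p f).toFun) =
      stepVec (Set.Ico 0 (r : ℝ)) p.toFun := by
  rw [pastL2, restrL2_stepVec le_rfl _ (TStep.isBddStep _), TStep.toFun_concat]
  exact stepVec_congr measurableSet_Ico fun s hs =>
    concatAt_of_lt ((Real.toNNReal_lt_iff_lt_coe hs.1).mpr hs.2) _ _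

lemma toFun_concat_toNNReal {r : ℝ≥0} {s : ℝ} (hs : (r : ℝ) ≤ s) (p f : TStep T) :
    (TStep.concat r p f).toFun s.toNNReal = f.toFun (s - r).toNNReal := by
  rw [TStep.toFun_concat, concatAt, if_neg (not_lt.mpr (NNReal.le_toNNReal_of_coe_le hs)),
    NNReal.sub_def, Real.coe_toNNReal _ (r.2.trans hs)]

lemma futureL2_stepVec_concat (r : ℝ≥0) (p f : TStep T) :
    futureL2 r (stepVec (Set.Ici 0) (TStep.concat r p f).toFun) =
      shiftL2 r (stepVec (Set.Ici 0) f.toFun) := by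
  rw [futureL2, restrL2_stepVec le_rfl _ (TStep.isBddStep _)]
  have h1 := Lp.coeFn_compMeasurePreserving (stepVec (Set.Ici 0) f.toFun) (measurePreserving_sub r)
  have h2 := (measurePreserving_sub r).quasiMeasurePreserving.ae
    (stepVec_coeFn le_rfl f.isBddStep)
  refine Lp.ext ?_
  filter_upwards [h1, h2, stepVec_coeFn (Ici_subset_Ici' r) (TStep.concat r p f).isBddStep,
    ae_restrict_mem measurableSet_Ici] with s h3 h4 h5 h6
  refine h5.trans (Eq.trans ?_ h3.symm)
  rw [Function.comp_apply, h4, toFun_concat_toNNReal h6]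

lemma cohVec_pastL2_stepVec (t : ℝ≥0) (f : TStep T) :
    cohVec (pastL2 t (stepVec (Set.Ici 0) f.toFun)) = pastCoh t f := by
  rw [pastL2, restrL2_stepVec le_rfl _ f.isBddStep, pastCoh]

/-- Both sides are exponentials of integrals of `chiForm`, over `[r + t, ∞[` and `[t, ∞[`, and
translation by `r` carries one integral to the other. -/
lemma inner_cohVec_futureL2_concat (r t : ℝ≥0) (p q f g : TStep T) :
    inner ℂ (cohVec (futureL2 (r + t) (stepVec (Set.Ici 0) (TStep.concat r p f).toFun)))
      (cohVec (futureL2 (r + t) (stepVec (Set.Ici 0) (TStep.concat r q g).toFun))) =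
    inner ℂ (cohVec (futureL2 t (stepVec (Set.Ici 0) f.toFun)))
      (cohVec (futureL2 t (stepVec (Set.Ici 0) g.toFun))) := by
  simp only [futureL2]
  rw [restrL2_stepVec le_rfl _ (TStep.isBddStep _), restrL2_stepVec le_rfl _ (TStep.isBddStep _),
    restrL2_stepVec le_rfl _ (TStep.isBddStep _), restrL2_stepVec le_rfl _ (TStep.isBddStep _),
    inner_cohVec_stepVec (Ici_subset_Ici' _) (TStep.isBddStep _) (TStep.isBddStep _),
    inner_cohVec_stepVec (Ici_subset_Ici' _) (TStep.isBddStep _) (TStep.isBddStep _)]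
  congr 2
  refine Eq.trans ?_ ((measurePreserving_sub_right (volume : Measure ℝ)
    (r : ℝ)).setIntegral_preimage_emb (measurableEmbedding_subRight _) (fun s => chiForm (f.toFun s.toNNReal) (g.toFun s.toNNReal)) _)
  have : (fun x : ℝ => x - r) ⁻¹' Set.Ici (t : ℝ) = Set.Ici ((r + t : ℝ≥0) : ℝ) := by
    rw [Set.preimage_sub_const_Ici, NNReal.coe_add, add_comm]
  rw [this]
  refine setIntegral_congr_fun measurableSet_Ici fun s hs => ?_
  have hs' : (r : ℝ) ≤ s := le_trans (by simp) hs
  simp only [toFun_concat_toNNReal hs']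

lemma shiftFock_cohVec (r : ℝ≥0) (f : NoiseL2 k (Set.Ici 0)) :
    shiftFock k r (cohVec f) = cohVec (shiftL2 r f) := by
  rw [cohVec, map_smul, shiftFock_expVec, cohVec, LinearIsometry.norm_map]

lemma futureL2_constOn (t : ℝ≥0) (x : k) : futureL2 t (constOn t x) = 0 := by
  refine Lp.ext ?_
  filter_upwards [restrL2_coeFn (Ici_subset_Ici' t) (constOn t x),
    ae_restrict_of_ae_restrict_of_subset (Ici_subset_Ici' t) (indicatorConstLp_coeFn
      (p := 2) (μ := volume.restrict (Set.Ici (0 : ℝ))) (hs := measurableSet_Ico)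
      (hμs := ne_top_of_le_ne_top (by simp) (Measure.restrict_apply_le (Set.Ici 0)
        (Set.Ico (0 : ℝ) t))) (c := x)),
    Lp.coeFn_zero k 2 (volume.restrict (Set.Ici (t : ℝ))),
    ae_restrict_mem measurableSet_Ici] with s h1 h2 h3 h4
  rw [h3]
  refine h1.trans (h2.trans (Set.indicator_of_notMem (fun h => not_lt.mpr h4 h.2) _))

lemma cohVec_pastL2_constOn (h0 : (0 : k) ∈ T) (t : ℝ≥0) (x : T) :
    cohVec (pastL2 t (constOn t (x : k))) = pastCoh t (TStep.block h0 0 t x) := by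
  refine congrArg cohVec (Lp.ext ?_)
  filter_upwards [restrL2_coeFn (Ico_subset_Ici t) (constOn t (x : k)),
    ae_restrict_of_ae_restrict_of_subset (Ico_subset_Ici t) (indicatorConstLp_coeFn
      (p := 2) (μ := volume.restrict (Set.Ici (0 : ℝ))) (hs := measurableSet_Ico)
      (hμs := ne_top_of_le_ne_top (by simp) (Measure.restrict_apply_le (Set.Ici 0)
        (Set.Ico (0 : ℝ) t))) (c := (x : k))),
    stepVec_coeFn (Ico_subset_Ici t) (TStep.block h0 0 t x).isBddStep,
    ae_restrict_mem measurableSet_Ico] with s h1 h2 h3 h4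
  rw [h3]
  refine h1.trans (h2.trans ((Set.indicator_of_mem h4 _).trans ?_))
  have h5 : s.toNNReal < 0 + t := by
    rw [zero_add]
    exact (Real.toNNReal_lt_iff_lt_coe h4.1).mpr h4.2
  rw [TStep.toFun_block, if_pos ⟨zero_le, h5⟩]

end StepRestriction

/-! ### The cocycle -/

section Cocycle

variable {H : Type v} [NormedAddCommGroup H] [InnerProductSpace ℂ H] [CompleteSpace H]
  {k : Type u} [NormedAddCommGroup k] [InnerProductSpace ℂ k] {T : Set k}
  {C : NonUnitalStarSubalgebra ℂ (H →L[ℂ] H)} {P : T → T → ℝ≥0 → C →ₗ[ℂ] C}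

/-- The evolution at time `0` is the identity and every past is the same unit vector, so only the
inner product of the futures remains. -/
lemma IsEvolutionOp.adaptedExt_zero {Y : C →ₗ[ℂ] HTensor H (FockOn k (Set.Ico 0 ((0 : ℝ≥0) : ℝ)))
      →L[ℂ] HTensor H (FockOn k (Set.Ico 0 ((0 : ℝ≥0) : ℝ)))} (hY : IsEvolutionOp P 0 Y)
    (h0 : (0 : k) ∈ T) (hP : ∀ x y, IsSemigroup (P x y)) (a : C) :
    adaptedExt 0 (Y a) = ampliation (Fock k) (a : H →L[ℂ] H) := by
  refine adaptedExt_ext fun u w f g => ?_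
  have h1 : inner ℂ (pastCoh 0 (TStep.zero h0)) (pastCoh 0 (TStep.zero h0)) = (1 : ℂ) := by
    rw [inner_self_eq_norm_sq_to_K, pastCoh, norm_cohVec]
    simp
  rw [inner_adaptedExt, ampliation_htmul, inner_htmul, inner_cohVec_past_future 0 f g,
    cohVec_pastL2_zero h0, cohVec_pastL2_zero h0, hY, h1, evolutionAt_zero hP, LinearMap.id_apply]
  ring

lemma IsEvolutionOp.slice_adaptedExt_eq {t : ℝ≥0}
    {Y : C →ₗ[ℂ] HTensor H (FockOn k (Set.Ico 0 (t : ℝ))) →L[ℂ]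
      HTensor H (FockOn k (Set.Ico 0 (t : ℝ)))} (hY : IsEvolutionOp P t Y) (a : C)
    (f g : TStep T) :
    slice (cohVec (stepVec (Set.Ici 0) f.toFun)) (cohVec (stepVec (Set.Ici 0) g.toFun))
      (adaptedExt t (Y a)) =
    ((inner ℂ (cohVec (futureL2 t (stepVec (Set.Ici 0) f.toFun)))
      (cohVec (futureL2 t (stepVec (Set.Ici 0) g.toFun))) : ℂ) • evolutionAt P t f.1 g.1 a : C) := by
  rw [slice_adaptedExt, cohVec_pastL2_stepVec, cohVec_pastL2_stepVec, hY.slice_eq]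
  rfl

lemma IsEvolutionOp.slice_adaptedExt_constOn {t : ℝ≥0}
    {Y : C →ₗ[ℂ] HTensor H (FockOn k (Set.Ico 0 (t : ℝ))) →L[ℂ]
      HTensor H (FockOn k (Set.Ico 0 (t : ℝ)))} (hY : IsEvolutionOp P t Y)
    (h0 : (0 : k) ∈ T) (hP : ∀ x y, IsSemigroup (P x y)) (a : C) (x y : T) :
    slice (cohVec (constOn t (x : k))) (cohVec (constOn t (y : k))) (adaptedExt t (Y a)) =
      (P x y t a : H →L[ℂ] H) := by
  have h1 : ∀ x : T, ∀ s < t, (TStep.block h0 0 t x).1 s = x := fun x s hs => by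
    refine Subtype.ext ((TStep.toFun_block h0 0 t x s).trans (if_pos ⟨zero_le, ?_⟩))
    rwa [zero_add]
  rw [slice_adaptedExt, futureL2_constOn, futureL2_constOn, cohVec_pastL2_constOn h0,
    cohVec_pastL2_constOn h0, hY.slice_eq, evolutionAt_const hP t (h1 x) (h1 y),
    inner_self_eq_norm_sq_to_K, norm_cohVec]
  simp

variable [CompleteSpace k]

/-- Both sides are continuous, conjugate linear in `e` and linear in `d`, so coherent vectors of
step functions suffice. On the left, a past on `[0, r[` followed by a shifted coherent vector is the
coherent vector of a concatenation, whose evolution factors. On the right, the slice of `S` is the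
evolution over `t`, to which `Y r` is applied. The scalar factors from the remaining futures agree
by translation invariance. -/
lemma IsEvolutionOp.slice_transport_fockSplit
    {Y : (t : ℝ≥0) → C →ₗ[ℂ] HTensor H (FockOn k (Set.Ico 0 (t : ℝ))) →L[ℂ]
      HTensor H (FockOn k (Set.Ico 0 (t : ℝ)))} (hY : ∀ t, IsEvolutionOp P t (Y t))
    (hT : (Submodule.span ℂ T).topologicalClosure = ⊤) (h0 : (0 : k) ∈ T)
    (hP : ∀ x y, IsSemigroup (P x y)) (r t : ℝ≥0) (hc : Continuous (Y r)) (a : C)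
    (S : matrixSpace C (Fock k)) (hS : S.1 = adaptedExt t (Y t a)) (e d : Fock k) :
    slice (shiftFock k r e) (shiftFock k r d)
      (transport (fockSplit H k r) (adaptedExt (r + t) (Y (r + t) a))) = Y r (sliceIn e d S) := by
  have hb := cohVec_stepVec_total (J := Set.Ici 0) le_rfl measurableSet_Ici hT h0
  set R := transport (fockSplit H k r) (adaptedExt (r + t) (Y (r + t) a)) with hR
  refine forall_of_total hb
    (p := fun e => slice (shiftFock k r e) (shiftFock k r d) R = Y r (sliceIn e d S))
    ?_ ?_ ?_ ?_ (fun f => ?_) e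
  · have : sliceIn 0 d S = 0 := Subtype.ext (slice_zero_left _ _)
    rw [map_zero, slice_zero_left, this, map_zero]
  · intro x y hx hy
    have : sliceIn (x + y) d S = sliceIn x d S + sliceIn y d S := Subtype.ext (slice_add_left ..)
    rw [map_add, slice_add_left, hx, hy, this, map_add]
  · intro c x hx
    have : sliceIn (c • x) d S = (starRingEnd ℂ) c • sliceIn x d S :=
      Subtype.ext (slice_smul_left ..)
    rw [map_smul, slice_smul_left, hx, this, map_smul]
  · exact isClosed_eq ((continuous_slice_left _ R).comp (shiftFock k r).continuous)
      (hc.comp ((continuous_slice_left d S.1).subtype_mk _))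
  refine forall_of_total hb (p := fun d => slice (shiftFock k r (cohVec (stepVec _ f.toFun)))
    (shiftFock k r d) R = Y r (sliceIn (cohVec (stepVec _ f.toFun)) d S))
    ?_ ?_ ?_ ?_ (fun g => ?_) d
  · have : sliceIn (cohVec (stepVec _ f.toFun)) 0 S = 0 := Subtype.ext (slice_zero_right _ _)
    rw [map_zero, slice_zero_right, this, map_zero]
  · intro x y hx hy
    have : sliceIn (cohVec (stepVec _ f.toFun)) (x + y) S =
        sliceIn (cohVec (stepVec _ f.toFun)) x S + sliceIn (cohVec (stepVec _ f.toFun)) y S :=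
      Subtype.ext (slice_add_right ..)
    rw [map_add, slice_add_right, hx, hy, this, map_add]
  · intro c x hx
    have : sliceIn (cohVec (stepVec _ f.toFun)) (c • x) S =
      c • sliceIn (cohVec (stepVec _ f.toFun)) x S := Subtype.ext (slice_smul_right ..)
    rw [map_smul, slice_smul_right, hx, this, map_smul]
  · exact isClosed_eq ((continuous_slice_right _ R).comp (shiftFock k r).continuous)
      (hc.comp ((continuous_slice_right (cohVec (stepVec _ f.toFun)) S.1).subtype_mk _))
  have hslice : sliceIn (cohVec (stepVec (Set.Ici 0) f.toFun))
      (cohVec (stepVec (Set.Ici 0) g.toFun)) S =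
      (inner ℂ (cohVec (futureL2 t (stepVec (Set.Ici 0) f.toFun)))
      (cohVec (futureL2 t (stepVec (Set.Ici 0) g.toFun))) : ℂ) • evolutionAt P t f.1 g.1 a :=
    Subtype.ext ((congrArg _ hS).trans ((hY t).slice_adaptedExt_eq a f g))
  refine clm_ext_inner_total (htmul_pastCoh_total (H := H) r hT h0) fun p q => ?_
  have hsplit : ∀ (p : H × TStep T) (f : TStep T),
      htmul (htmul p.1 (pastCoh r p.2)) (shiftFock k r (cohVec (stepVec (Set.Ici 0) f.toFun))) =
      fockSplit H k r (htmul p.1 (cohVec (stepVec _ (TStep.concat r p.2 f).toFun))) :=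
    fun p f => by
      rw [fockSplit_htmul_cohVec, pastL2_stepVec_concat, futureL2_stepVec_concat, shiftFock_cohVec,
        pastCoh]
  rw [inner_slice, hsplit, hsplit, hR, inner_transport, inner_adaptedExt,
    inner_cohVec_futureL2_concat, cohVec_pastL2_stepVec, cohVec_pastL2_stepVec, hY, hslice,
    map_smul, smul_apply, inner_smul_right, hY]
  have hcat : evolutionAt P (r + t) (TStep.concat r p.2 f).1 (TStep.concat r q.2 g).1 =
      evolutionAt P r p.2.1 q.2.1 ∘ₗ evolutionAt P t f.1 g.1 :=
    evolutionAt_concatAt hP r t p.2.2.1 q.2.2.1 f.2.1 g.2.1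
  rw [hcat, LinearMap.comp_apply]

/-- A family of semigroups which preserves the order intervals is associated to a completely
positive contraction cocycle. -/
theorem exists_cocycle (hC : IsClosed (C : Set (H →L[ℂ] H)))
    (hT : (Submodule.span ℂ T).topologicalClosure = ⊤) (h0 : (0 : k) ∈ T)
    (hP : ∀ x y, IsSemigroup (P x y)) (hord : PreservesOrderIntervals P) :
    ∃ j : ℝ≥0 → C →L[ℂ] matrixSpace C (Fock k), IsCPContractionCocycle j ∧
      ∀ (x y : T) (t : ℝ≥0) (a : C), P x y t a = assocSemigroup j x y t a := by
  choose Y hY using exists_evolutionOp hC hT h0 hP hord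
  have hY' : ∀ t, IsEvolutionOp P t (Y t) := hY
  choose j hj hcp hcb hn using fun t => (hY' t).exists_process hC hT h0 hP hord
  have hc : ∀ t, Continuous (Y t) := fun t => AddMonoidHomClass.continuous_of_bound (Y t) 4
    (norm_apply_le_four_mul hC (Y t) fun a ha ha' => (hY' t).map_le_one hT h0 hP hord ha ha')
  refine ⟨j, ⟨⟨⟨fun t a => ⟨Y t a, (hY' t).mem_matrixSpace hC hT h0 a, hj t a⟩, hcb⟩,
    fun a => (hj 0 a).trans ((hY' 0).adaptedExt_zero h0 hP a), fun r t a e d => ?_⟩, hcp, hn⟩,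
    fun x y t a => Subtype.ext ?_⟩
  -- Every vector of `𝓕_{[r, ∞[}` is a shifted one, and this shift cancels the one in `shiftMap`.
  · obtain ⟨e, rfl⟩ := (shiftFock k r).surjective e
    obtain ⟨d, rfl⟩ := (shiftFock k r).surjective d
    have hs : sliceIn (shiftFock k r e) (shiftFock k r d) (shiftMap r (j t a)) =
        sliceIn e d (j t a) := Subtype.ext (by
      refine (slice_transport_htensorCongr (shiftFock k r) _ _ _).trans ?_
      rw [LinearIsometryEquiv.symm_apply_apply, LinearIsometryEquiv.symm_apply_apply]
      rfl)
    rw [hs, hj, hj, IsEvolutionOp.slice_transport_fockSplit hY' hT h0 hP r t (hc r) a (j t a)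
      (hj t a)]
  · refine ((hY' t).slice_adaptedExt_constOn h0 hP a x y).symm.trans ?_
    rw [← hj]
    rfl

end Cocycle

/-! ### The characterisation of associated semigroups -/

theorem theorem5p6 {H : Type v} [NormedAddCommGroup H] [InnerProductSpace ℂ H] [CompleteSpace H]
    {k : Type u} [NormedAddCommGroup k] [InnerProductSpace ℂ k] [CompleteSpace k]
    (C : NonUnitalStarSubalgebra ℂ (H →L[ℂ] H)) (hclosed : IsClosed (C : Set (H →L[ℂ] H)))
    (hnonunital : IsNonunital C) (hnondeg : ActsNondegenerately C)
    (T : Set k) (hT : (Submodule.span ℂ T).topologicalClosure = ⊤) (h0 : (0 : k) ∈ T)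
    (P : T → T → ℝ≥0 → C →ₗ[ℂ] C) (hP : ∀ x y, IsSemigroup (P x y)) :
    (∃ j : ℝ≥0 → C →L[ℂ] matrixSpace C (Fock k), IsCPContractionCocycle j ∧
      ∀ (x y : T) (t : ℝ≥0) (a : C), P x y t a = assocSemigroup j x y t a) ↔
    ∀ (n : ℕ), 1 ≤ n → ∀ (x : Fin n → T) (lam : Matrix (Fin n) (Fin n) ℂ), lam.PosSemidef →
      ∀ t : ℝ≥0, Set.MapsTo (schurMap P x t)
        (orderInterval C (idTensor H lam))
        (orderInterval C (idTensor H (lam.hadamard (gramMat (fun i => (x i : k)) t)))) := by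
  refine ⟨fun ⟨j, hj, hjP⟩ n _ x lam hlam t A hA => ?_,
    fun hord => exists_cocycle hclosed hT h0 hP hord⟩
  have h : schurMap P x t A = Matrix.of fun p q => assocSemigroup j (x p) (x q) t (A p q) :=
    Matrix.ext fun p q => hjP _ _ _ _
  rw [h]
  exact mapsTo_orderInterval_assocSemigroup hclosed hj.completelyPositive hj.contractive
    (fun i => (x i : k)) hlam t hA
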